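/- For integers $\chi\ge 1$ and $\Delta\ge 0$, a finite simple graph $G$ admits a $(\chi,\Delta)$-coloring if its vertex set can be partitioned into $\chi$ (possibly empty) classes, each inducing a subgraph of maximum degree at most $\Delta$. Defective Coloring asks, given $G,\chi,\Delta$, whether $G$ admits a $(\chi,\Delta)$-coloring. A feedback vertex set of $G$ is a set of vertices whose deletion leaves an acyclic graph, and $\mathrm{fvs}(G)$ is the minimum size of such a set. Write $n$ for the number of vertices of $G$. The machine model is a unit-cost random access machine on natural numbers with addition and truncated subtraction; the graph is given by its adjacency matrix. Theorem. For $\chi\neq 2$, Defective Coloring is fixed-parameter tractable parameterized by feedback vertex set: there are an algorithm, a computable function $f$ and a constant $c$ such that, for every graph $G$ and all integers $\chi\ge1$, $\chi\ne2$, $\Delta\ge0$, the algorithm, given $G,\chi,\Delta$, decides in at most $f(\mathrm{fvs}(G))\,(n+1)^{c}$ steps whether $G$ admits a $(\chi,\Delta)$-coloring. More precisely, there is an algorithm which, given a graph $G$, integers $\chi\ge 1$, $\chi\neq 2$, $\Delta\ge 0$, and a feedback vertex set of $G$ of size $k$ (not necessarily minimum), decides whether $G$ admits a $(\chi,\Delta)$-coloring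 in time $k^{O(k)}n^{O(1)}$, that is, in at most $c\,k^{ck}(n+1)^{c}$ steps for some constant $c$ (where $0^0=1$). -/

import Mathlib

/-! ### Defective colorings and feedback vertex sets -/

/-- `G` admits a `(C, D)`-coloring: the vertices can be partitioned into `C` (possibly empty)
classes, the fibres of `col`, such that in the graph induced by each class every vertex has
degree at most `D`. -/
def AdmitsDefectiveColoring {V : Type*} [Finite V] (G : SimpleGraph V) (C D : ℕ) : Prop :=
  ∃ col : V → Fin C, ∀ v : V, {w : V | G.Adj v w ∧ col w = col v}.ncard ≤ D

/-- `S` is a feedback vertex set of `G`: deleting the vertices of `S` leaves a forest. -/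
def IsFeedbackVertexSet {V : Type*} (G : SimpleGraph V) (S : Finset V) : Prop :=
  (G.induce {v : V | v ∉ S}).IsAcyclic

/-- The feedback vertex number: the smallest size of a feedback vertex set. -/
noncomputable def feedbackVertexNumber {V : Type*} [Finite V] (G : SimpleGraph V) : ℕ :=
  sInf {k : ℕ | ∃ S : Finset V, IsFeedbackVertexSet G S ∧ S.card = k}

/-! ### Random access machines

The machine has registers and arrays (indexed memory banks) that hold natural numbers; a program
names finitely many of each. Its arithmetic operations are addition and truncated subtraction.
Every elementary operation costs one step (multiplication is deliberately absent, so that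
unit-cost time is polynomially related to Turing machine time). -/

namespace RAM

/-- The memory contents: `reg r` is the value of register `r`, and `arr a i` is the value of the
cell with address `i` in array `a`. -/
structure State where
  reg : ℕ → ℕ
  arr : ℕ → ℕ → ℕ

/-- Expressions: constants, registers, memory reads (indirect addressing), sum and truncated
difference. -/
inductive Expr where
  | const (m : ℕ)
  | reg (r : ℕ)
  | read (a : ℕ) (i : Expr)
  | add (e₁ e₂ : Expr)
  | sub (e₁ e₂ : Expr)

/-- The value of an expression. -/
def Expr.eval (s : State) : Expr → ℕ
  | .const m => m
  | .reg r => s.reg r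
  | .read a i => s.arr a (i.eval s)
  | .add e₁ e₂ => e₁.eval s + e₂.eval s
  | .sub e₁ e₂ => e₁.eval s - e₂.eval s

/-- The number of steps needed to evaluate an expression: one for each operation in it. -/
def Expr.cost : Expr → ℕ
  | .const _ => 1
  | .reg _ => 1
  | .read _ i => i.cost + 1
  | .add e₁ e₂ => e₁.cost + e₂.cost + 1
  | .sub e₁ e₂ => e₁.cost + e₂.cost + 1

/-- Programs: register assignment, memory write `a[i] := e`, sequencing, branching and looping.
A condition holds when its value is nonzero. -/
inductive Prog where
  | skip
  | assign (r : ℕ) (e : Expr)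
  | write (a : ℕ) (i e : Expr)
  | seq (p q : Prog)
  | ite (e : Expr) (p q : Prog)
  | while (e : Expr) (p : Prog)

/-- Store the value `x` in register `r`. -/
def State.setReg (s : State) (r x : ℕ) : State :=
  { s with reg := Function.update s.reg r x }

/-- Store the value `x` in cell `i` of array `a`. -/
def State.setArr (s : State) (a i x : ℕ) : State :=
  { s with arr := Function.update s.arr a (Function.update (s.arr a) i x) }

/-- `Exec p s t s'`: started in state `s`, the program `p` halts after exactly `t` steps, in
state `s'`. -/
inductive Exec : Prog → State → ℕ → State → Prop
  | skip (s : State) : Exec .skip s 1 s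
  | assign (s : State) (r : ℕ) (e : Expr) :
      Exec (.assign r e) s (e.cost + 1) (s.setReg r (e.eval s))
  | write (s : State) (a : ℕ) (i e : Expr) :
      Exec (.write a i e) s (i.cost + e.cost + 1) (s.setArr a (i.eval s) (e.eval s))
  | seq {p q : Prog} {s s' s'' : State} {t t' : ℕ} :
      Exec p s t s' → Exec q s' t' s'' → Exec (.seq p q) s (t + t') s''
  | ite_true {e : Expr} {p q : Prog} {s s' : State} {t : ℕ} :
      e.eval s ≠ 0 → Exec p s t s' → Exec (.ite e p q) s (e.cost + 1 + t) s'
  | ite_false {e : Expr} {p q : Prog} {s s' : State} {t : ℕ} :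
      e.eval s = 0 → Exec q s t s' → Exec (.ite e p q) s (e.cost + 1 + t) s'
  | while_true {e : Expr} {p : Prog} {s s' s'' : State} {t t' : ℕ} :
      e.eval s ≠ 0 → Exec p s t s' → Exec (.while e p) s' t' s'' →
      Exec (.while e p) s (e.cost + 1 + t + t') s''
  | while_false {e : Expr} {p : Prog} {s : State} :
      e.eval s = 0 → Exec (.while e p) s (e.cost + 1) s

/-- Started in state `s`, the program `p` halts after at most `T` steps with the truth value of
`P` in register `0` (`1` for yes and `0` for no). -/
def Prog.DecidesWithin (p : Prog) (s : State) (T : ℕ) (P : Prop) : Prop :=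
  ∃ (t : ℕ) (s' : State), Exec p s t s' ∧ t ≤ T ∧
    (P → s'.reg 0 = 1) ∧ (¬ P → s'.reg 0 = 0)

end RAM

/-! ### Parameterized problems -/

/-- A parameterized decision problem: instances with their representation in memory, their size,
the parameter, and the question asked. -/
structure ParameterizedProblem where
  Instance : Type
  encode : Instance → RAM.State
  size : Instance → ℕ
  param : Instance → ℕ
  yes : Instance → Prop

/-- Fixed-parameter tractability: one program decides every instance `x`, with parameter `k` and
size `n`, in time `f(k) * n ^ O(1)` for a computable function `f`. (The successor makes the
polynomial positive for `n = 0`.) -/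
def ParameterizedProblem.IsFPT (Q : ParameterizedProblem) : Prop :=
  ∃ (p : RAM.Prog) (f : ℕ → ℕ) (c : ℕ), Computable f ∧
    ∀ x : Q.Instance,
      p.DecidesWithin (Q.encode x) (f (Q.param x) * (Q.size x + 1) ^ c) (Q.yes x)

/-! ### The problem -/

open Classical in
/-- The memory holding a graph on `n` vertices, numbers `C` and `D` and a set `S` of vertices:
registers `0`, `1`, `2` contain `n`, `C`, `D`, array `0` contains the adjacency matrix (row by
row), array `1` contains the indicator vector of `S`, and everything else is `0`. -/
noncomputable def inputState {n : ℕ} (G : SimpleGraph (Fin n)) (C D : ℕ) (S : Finset (Fin n)) :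
    RAM.State where
  reg r := if r = 0 then n else if r = 1 then C else if r = 2 then D else 0
  arr a x :=
    if a = 0 then if ∃ i j : Fin n, G.Adj i j ∧ x = i.val * n + j.val then 1 else 0
    else if a = 1 then if ∃ v ∈ S, x = v.val then 1 else 0
    else 0

/-- An instance of Defective Coloring whose number of colors is not `2`. -/
structure DefectiveColoringInstance where
  n : ℕ
  G : SimpleGraph (Fin n)
  C : ℕ
  D : ℕ
  one_le_C : 1 ≤ C
  C_ne_two : C ≠ 2

/-- Defective Coloring, with a number of colors other than `2`, parameterized by the feedback
vertex number. Only `G`, `C`, `D` are given (the array for the vertex set is empty), and the size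
of an instance is the number of vertices. -/
noncomputable def defectiveColoringByFVS : ParameterizedProblem where
  Instance := DefectiveColoringInstance
  encode x := inputState x.G x.C x.D ∅
  size x := x.n
  param x := feedbackVertexNumber x.G
  yes x := AdmitsDefectiveColoring x.G x.C x.D

namespace RAM

/-! ### Uniform polynomial-time computability relative to a fuel bound -/

/-! Let `S` be a feedback vertex set of size k. If χ ≥ k + 2, each vertex of `S` gets its own colour
and the forest is properly coloured with two further ones. If χ ≥ 3 and k ≤ Δ + 1, all of `S` gets
one colour and the forest two others; this is where χ = 2 has to be excluded. For χ = 1 only the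
maximum degree matters. In the remaining case χ ≤ k + 1 and Δ + 2 ≤ k, so colours and relevant
degrees are all below k + 2.

In that case the colours on `S` are guessed and the forest is handled by dynamic programming. The
state of a forest vertex consists of its colour, the number of equally coloured neighbours seen so
far, and for each s in `S` the number of equally coloured neighbours that s received from the part
already absorbed. These are k + 2 digits in base k + 2, hence (k + 2)^(k + 2) states. Vertices are
removed along an elimination order of the forest, each having at most one neighbour left when it
goes; its table is merged into the table of that neighbour, or into that of an artificial root `n`
if there is none. Joint feasibility of the surviving tables is invariant (`feasible_erase`), which
yields `decideColorable_iff`.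

If no set is given, one is found by iterative compression for k = 0, 1, 2, ... . A solution for a
prefix of the vertices, together with the next vertex, has at most k + 1 elements. One guesses which
of them are deleted and then decides the forest vertices in elimination order. A vertex with no kept
neighbour is irrelevant, one with a single kept neighbour may be kept by an exchange argument, and
only a vertex with two or more kept neighbours needs a guess. Since the kept graph remains a forest,
at most 2k + 1 guesses occur (`exists_search`), so 3k + 2 bits describe a successful run
(`exists_compressSucceeds`, `findFVS_spec`).

Running times come from a calculus of functions computable in time (N + 2)^d, where the fuel N is
stored in a register. Sums, counts, bounded quantifiers and iterations run over all numbers below N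
(`Comp`, `Comp.natRec`, `Comp.letIter`). It then suffices to choose N so large that all guesses,
states and table addresses lie below it; `fuelBound` does this and has the form k^O(k) n^O(1). -/

@[simp] theorem State.setReg_reg (s : State) (r x : ℕ) :
    (s.setReg r x).reg = Function.update s.reg r x := rfl

@[simp] theorem State.setReg_arr (s : State) (r x : ℕ) : (s.setReg r x).arr = s.arr := rfl

@[simp] theorem State.setArr_reg (s : State) (a i x : ℕ) : (s.setArr a i x).reg = s.reg := rfl

@[simp] theorem State.setArr_arr (s : State) (a i x : ℕ) :
    (s.setArr a i x).arr = Function.update s.arr a (Function.update (s.arr a) i x) := rfl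

/-- The states agree on all registers below `lr` and all arrays below `la`. -/
def Same (lr la : ℕ) (s s' : State) : Prop :=
  (∀ r < lr, s'.reg r = s.reg r) ∧ ∀ a < la, s'.arr a = s.arr a

/-- All arrays from `la` on vanish from address `N` on. -/
def Tail (la N : ℕ) (s : State) : Prop := ∀ a, la ≤ a → ∀ i, N ≤ i → s.arr a i = 0

theorem Same.trans {lr la : ℕ} {s s' s'' : State} (h : Same lr la s s') (h' : Same lr la s' s'') :
    Same lr la s s'' :=
  ⟨fun r hr => (h'.1 r hr).trans (h.1 r hr), fun a ha => (h'.2 a ha).trans (h.2 a ha)⟩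

theorem Same.mono {lr la lr' la' : ℕ} {s s' : State} (h : Same lr' la' s s') (hr : lr ≤ lr')
    (ha : la ≤ la') : Same lr la s s' :=
  ⟨fun r h1 => h.1 r (h1.trans_le hr), fun a h1 => h.2 a (h1.trans_le ha)⟩

theorem Same.setReg (lr la : ℕ) (s : State) {r : ℕ} (x : ℕ) (h : lr ≤ r) :
    Same lr la s (s.setReg r x) :=
  ⟨fun r' hr' => by
    have : r' ≠ r := by omega
    simp [this], fun _ _ => rfl⟩

theorem Same.setArr (lr la : ℕ) (s : State) {a : ℕ} (i x : ℕ) (h : la ≤ a) :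
    Same lr la s (s.setArr a i x) :=
  ⟨fun _ _ => rfl, fun a' ha' => by
    have : a' ≠ a := by omega
    simp [this]⟩

theorem Tail.mono {la la' N N' : ℕ} {s : State} (h : Tail la N s) (hl : la ≤ la') (hN : N ≤ N') :
    Tail la' N' s := fun a ha i hi => h a (hl.trans ha) i (hN.trans hi)

theorem Tail.setReg {la N : ℕ} {s : State} (h : Tail la N s) (r x : ℕ) :
    Tail la N (s.setReg r x) := h

theorem Tail.setArr {la N : ℕ} {s : State} (h : Tail la N s) (a : ℕ) {i : ℕ} (x : ℕ) (hi : i < N) :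
    Tail la N (s.setArr a i x) := by
  intro b hb j hj
  have hji : j ≠ i := by omega
  by_cases hba : b = a
  · subst hba
    simpa [hji] using h b hb j hj
  · simpa [hba] using h b hb j hj

/-- The memory above level `la` is clean after the run if it was clean up to level `la'` and the
arrays in between are those of a clean state. -/
theorem Tail.of_same {la la' lr N : ℕ} {s s' : State} (h : Tail la N s) (hS : Same lr la' s s')
    (h' : Tail la' N s') : Tail la N s' := by
  intro a ha i hi
  by_cases haa : a < la'
  · rw [hS.2 a haa]
    exact h a ha i hi
  · exact h' a (by omega) i hi

/-- A context: a type of values together with the ways in which they are stored in memory. A layout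
tells the registers and the arrays that are used. Register `3` holds the fuel. -/
class Ctx (Γ : Type) where
  Lay : Type
  fuel : Γ → ℕ
  rel : Lay → Γ → State → Prop
  below : Lay → ℕ → ℕ → Prop
  rel_fuel : ∀ {ℓ γ s}, rel ℓ γ s → s.reg 3 = fuel γ
  below_three : ∀ {ℓ lr la}, below ℓ lr la → 3 < lr
  below_mono : ∀ {ℓ lr la lr' la'}, below ℓ lr la → lr ≤ lr' → la ≤ la' → below ℓ lr' la'
  frame : ∀ {ℓ lr la γ s s'}, below ℓ lr la → rel ℓ γ s → Same lr la s s' → rel ℓ γ s'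

open Ctx

/-- Bound variables (of lets, sums, quantifiers, recursions) are modelled by extending the context;
the layout remembers the register of the new variable. -/
instance Ctx.pushNum {Γ : Type} [Ctx Γ] : Ctx (Γ × ℕ) where
  Lay := Lay Γ × ℕ
  fuel x := fuel x.1
  rel ℓ x s := rel ℓ.1 x.1 s ∧ s.reg ℓ.2 = x.2
  below ℓ lr la := below ℓ.1 lr la ∧ ℓ.2 < lr
  rel_fuel h := rel_fuel h.1
  below_three h := below_three h.1
  below_mono h h1 h2 := ⟨below_mono h.1 h1 h2, h.2.trans_le h1⟩
  frame h h1 h2 := ⟨frame h.1 h1.1 h2, (h2.1 _ h.2).trans h1.2⟩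

instance Ctx.pushArr {Γ : Type} [Ctx Γ] : Ctx (Γ × (ℕ → ℕ)) where
  Lay := Lay Γ × ℕ
  fuel x := fuel x.1
  rel ℓ x s := rel ℓ.1 x.1 s ∧ s.arr ℓ.2 = x.2
  below ℓ lr la := below ℓ.1 lr la ∧ ℓ.2 < la
  rel_fuel h := rel_fuel h.1
  below_three h := below_three h.1
  below_mono h h1 h2 := ⟨below_mono h.1 h1 h2, h.2.trans_le h2⟩
  frame h h1 h2 := ⟨frame h.1 h1.1 h2, (h2.2 _ h.2).trans h1.2⟩

@[simp] theorem Ctx.fuel_pushNum {Γ : Type} [Ctx Γ] (x : Γ × ℕ) : fuel x = fuel x.1 := rfl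

@[simp] theorem Ctx.fuel_pushArr {Γ : Type} [Ctx Γ] (x : Γ × (ℕ → ℕ)) : fuel x = fuel x.1 := rfl

/-- The program `p` computes `f` into register `lr` in time `(N + 2) ^ d`, where `N` is the fuel,
and preserves everything below level `lr`, `la`. -/
def Computes {Γ : Type} [Ctx Γ] (f : Γ → ℕ) (ℓ : Lay Γ) (lr la : ℕ) (p : Prog) (d : ℕ) : Prop :=
  ∀ γ s, rel ℓ γ s → Tail la (fuel γ) s → ∃ t s', Exec p s t s' ∧ t ≤ (fuel γ + 2) ^ d ∧
    s'.reg lr = f γ ∧ Same lr la s s' ∧ Tail la (fuel γ) s'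

/-- `f` is computable in polynomial time with respect to the fuel, uniformly in the context. -/
def Comp {Γ : Type} [Ctx Γ] (f : Γ → ℕ) : Prop :=
  ∀ (ℓ : Lay Γ) (lr la : ℕ), below ℓ lr la → ∃ p d, Computes f ℓ lr la p d

section Bounds

/-- The base is at least 2, so constants are absorbed into the exponent even for N = 0. With the two
lemmas on sums and products below, only exponents need to be tracked. -/
theorem le_fuel_pow (N c : ℕ) : c ≤ (N + 2) ^ c :=
  (Nat.lt_two_pow_self).le.trans (Nat.pow_le_pow_left (by omega) c)

theorem fuel_pow_add (N a b : ℕ) : (N + 2) ^ a + (N + 2) ^ b ≤ (N + 2) ^ (a + b + 1) := by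
  have h1 : (N + 2) ^ a ≤ (N + 2) ^ (a + b) := Nat.pow_le_pow_right (by omega) (by omega)
  have h2 : (N + 2) ^ b ≤ (N + 2) ^ (a + b) := Nat.pow_le_pow_right (by omega) (by omega)
  calc _ ≤ (N + 2) ^ (a + b) * 2 := by omega
    _ ≤ (N + 2) ^ (a + b) * (N + 2) := Nat.mul_le_mul_left _ (by omega)
    _ = _ := (pow_succ _ _).symm

theorem fuel_add_le {N x y a b : ℕ} (hx : x ≤ (N + 2) ^ a) (hy : y ≤ (N + 2) ^ b) :
    x + y ≤ (N + 2) ^ (a + b + 1) := (Nat.add_le_add hx hy).trans (fuel_pow_add N a b)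

theorem fuel_mul_le {N x y a b : ℕ} (hx : x ≤ (N + 2) ^ a) (hy : y ≤ (N + 2) ^ b) :
    x * y ≤ (N + 2) ^ (a + b) := (Nat.mul_le_mul hx hy).trans (pow_add _ _ _).ge

end Bounds

/-- The loop running as long as register `r` is smaller than the fuel. -/
def loop (r : ℕ) (body : Prog) : Prog := .while (.sub (.reg 3) (.reg r)) body

/-- `I j` is the loop invariant after `j` rounds; it has to fix the fuel register and the counter,
which control the test. -/
theorem exec_loop {body : Prog} {N r d : ℕ} (I : ℕ → State → Prop)
    (hbody : ∀ j < N, ∀ s, I j s → ∃ t s', Exec body s t s' ∧ t ≤ (N + 2) ^ d ∧ I (j + 1) s')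
    (hI : ∀ j ≤ N, ∀ s, I j s → s.reg 3 = N ∧ s.reg r = j) {s : State} (h0 : I 0 s) :
    ∃ t s', Exec (loop r body) s t s' ∧ t ≤ (N + 2) ^ (d + 6) ∧ I N s' := by
  have key : ∀ m j, j + m = N → ∀ s, I j s →
      ∃ t s', Exec (loop r body) s t s' ∧ t ≤ (m + 1) * ((N + 2) ^ d + 4) ∧ I N s' := by
    intro m
    induction m with
    | zero =>
      intro j hj s hs
      obtain ⟨h1, h2⟩ := hI j (by omega) s hs
      refine ⟨_, s, .while_false ?_, ?_, ?_⟩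
      · simp only [Expr.eval, h1, h2]; omega
      · simp [Expr.cost]
      · rwa [show N = j by omega]
    | succ m ih =>
      intro j hj s hs
      obtain ⟨h1, h2⟩ := hI j (by omega) s hs
      obtain ⟨t, s', h3, h4, h5⟩ := hbody j (by omega) s hs
      obtain ⟨t', s'', h6, h7, h8⟩ := ih (j + 1) (by omega) s' h5
      refine ⟨_, s'', .while_true ?_ h3 h6, ?_, h8⟩
      · simp only [Expr.eval, h1, h2]; omega
      · calc _ ≤ (m + 1) * ((N + 2) ^ d + 4) + ((N + 2) ^ d + 4) := by
              simp only [Expr.cost]; omega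
          _ = _ := by ring
  obtain ⟨t, s', h1, h2, h3⟩ := key N 0 (by omega) s h0
  refine ⟨t, s', h1, h2.trans ?_, h3⟩
  calc (N + 1) * ((N + 2) ^ d + 4) ≤ (N + 2) ^ 1 * (N + 2) ^ (d + 4 + 1) :=
        Nat.mul_le_mul (by rw [pow_one]; omega) (fuel_add_le le_rfl (le_fuel_pow _ 4))
    _ = (N + 2) ^ (d + 6) := by rw [← pow_add]; congr 1; omega

namespace Comp

variable {Γ : Type} [Ctx Γ]

theorem of_expr {f : Γ → ℕ} (h : ∀ ℓ : Lay Γ, ∃ e : Expr, ∀ γ s, rel ℓ γ s → e.eval s = f γ) :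
    Comp f := by
  intro ℓ lr la hb
  obtain ⟨e, he⟩ := h ℓ
  refine ⟨.assign lr e, e.cost + 1, fun γ s hr ht =>
    ⟨_, _, .assign s lr e, le_fuel_pow _ _, ?_, Same.setReg _ _ _ _ le_rfl, ht.setReg _ _⟩⟩
  simp [he γ s hr]

theorem const (m : ℕ) : Comp (fun _ : Γ => m) := of_expr fun _ => ⟨.const m, fun _ _ _ => rfl⟩

theorem var : Comp (fun x : Γ × ℕ => x.2) := of_expr fun ℓ => ⟨.reg ℓ.2, fun _ _ h => h.2⟩

/-- A context morphism that only forgets and rearranges variables. -/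
def Renaming {Δ : Type} [Ctx Δ] (m : Δ → Γ) : Prop :=
  (∀ δ, Ctx.fuel (m δ) = Ctx.fuel δ) ∧
  ∀ ℓ : Lay Δ, ∃ ℓ' : Lay Γ, (∀ δ s, rel ℓ δ s → rel ℓ' (m δ) s) ∧
    ∀ lr la, below ℓ lr la → below ℓ' lr la

theorem rename {Δ : Type} [Ctx Δ] {m : Δ → Γ} {f : Γ → ℕ} (hf : Comp f) (hm : Renaming m) :
    Comp (fun δ => f (m δ)) := by
  intro ℓ lr la hb
  obtain ⟨ℓ', h1, h2⟩ := hm.2 ℓ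
  obtain ⟨p, d, h⟩ := hf ℓ' lr la (h2 _ _ hb)
  refine ⟨p, d, fun δ s hr ht => ?_⟩
  have := h (m δ) s (h1 _ _ hr)
  rw [hm.1] at this
  exact this ht

theorem renaming_fstNum : Renaming (fun x : Γ × ℕ => x.1) :=
  ⟨fun _ => rfl, fun ℓ => ⟨ℓ.1, fun _ _ h => h.1, fun _ _ h => h.1⟩⟩

theorem renaming_fstArr : Renaming (fun x : Γ × (ℕ → ℕ) => x.1) :=
  ⟨fun _ => rfl, fun ℓ => ⟨ℓ.1, fun _ _ h => h.1, fun _ _ h => h.1⟩⟩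

theorem Renaming.pushNum {Δ : Type} [Ctx Δ] {m : Δ → Γ} (hm : Renaming m) :
    Renaming (fun x : Δ × ℕ => (m x.1, x.2)) :=
  ⟨fun x => hm.1 x.1, fun ℓ => by
    obtain ⟨ℓ', h1, h2⟩ := hm.2 ℓ.1
    exact ⟨(ℓ', ℓ.2), fun _ _ h => ⟨h1 _ _ h.1, h.2⟩, fun _ _ h => ⟨h2 _ _ h.1, h.2⟩⟩⟩

theorem let_ {f : Γ → ℕ} {g : Γ × ℕ → ℕ} (hf : Comp f) (hg : Comp g) :
    Comp (fun γ => g (γ, f γ)) := by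
  intro ℓ lr la hb
  obtain ⟨p, d, hp⟩ := hf ℓ lr la hb
  -- Register `lr` holds the value of `f`, so `g` works one level higher and its result is moved
  -- down afterwards.
  obtain ⟨q, d', hq⟩ := hg (ℓ, lr) (lr + 1) la ⟨below_mono hb (by omega) le_rfl, by simp⟩
  refine ⟨.seq p (.seq q (.assign lr (.reg (lr + 1)))), d + (d' + 2 + 1) + 1,
    fun γ s hr ht => ?_⟩
  obtain ⟨t, s1, e1, ht1, v1, S1, T1⟩ := hp γ s hr ht
  obtain ⟨t', s2, e2, ht2, v2, S2, T2⟩ := hq (γ, f γ) s1 ⟨frame hb hr S1, v1⟩ T1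
  refine ⟨_, _, .seq e1 (.seq e2 (.assign _ _ _)),
    fuel_add_le ht1 (fuel_add_le ht2 (le_fuel_pow _ 2)), ?_, ?_, T2.setReg _ _⟩
  · simp [Expr.eval, v2]
  · exact S1.trans ((S2.mono (by omega) le_rfl).trans (Same.setReg _ _ _ _ le_rfl))

theorem lift {f : Γ → ℕ} (hf : Comp f) : Comp (fun x : Γ × ℕ => f x.1) :=
  hf.rename renaming_fstNum

theorem liftArr {f : Γ → ℕ} (hf : Comp f) : Comp (fun x : Γ × (ℕ → ℕ) => f x.1) :=
  hf.rename renaming_fstArr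

theorem add {f g : Γ → ℕ} (hf : Comp f) (hg : Comp g) : Comp (fun γ => f γ + g γ) :=
  let_ (g := fun x : Γ × ℕ => x.2 + g x.1) hf
    (let_ (g := fun x : (Γ × ℕ) × ℕ => x.1.2 + x.2) hg.lift
      (of_expr fun ℓ => ⟨.add (.reg ℓ.1.2) (.reg ℓ.2), fun _ _ h => by
        simp only [Expr.eval, h.1.2, h.2]⟩))

theorem sub {f g : Γ → ℕ} (hf : Comp f) (hg : Comp g) : Comp (fun γ => f γ - g γ) :=
  let_ (g := fun x : Γ × ℕ => x.2 - g x.1) hf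
    (let_ (g := fun x : (Γ × ℕ) × ℕ => x.1.2 - x.2) hg.lift
      (of_expr fun ℓ => ⟨.sub (.reg ℓ.1.2) (.reg ℓ.2), fun _ _ h => by
        simp only [Expr.eval, h.1.2, h.2]⟩))

open Classical in
theorem ite_ne {c f g : Γ → ℕ} (hc : Comp c) (hf : Comp f) (hg : Comp g) :
    Comp (fun γ => if c γ ≠ 0 then f γ else g γ) := by
  intro ℓ lr la hb
  obtain ⟨p, d, hp⟩ := hc ℓ lr la hb
  obtain ⟨q, d1, hq⟩ := hf ℓ lr la hb
  obtain ⟨r, d2, hr'⟩ := hg ℓ lr la hb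
  refine ⟨.seq p (.ite (.reg lr) q r), d + (2 + (d1 + d2 + 1) + 1) + 1, fun γ s hr ht => ?_⟩
  obtain ⟨t, s1, e1, ht1, v1, S1, T1⟩ := hp γ s hr ht
  have hr1 := frame hb hr S1
  by_cases h : c γ = 0
  · obtain ⟨t', s2, e2, ht2, v2, S2, T2⟩ := hr' γ s1 hr1 T1
    refine ⟨_, s2, .seq e1 (.ite_false (by simp [Expr.eval, v1, h]) e2), fuel_add_le ht1
      (fuel_add_le (le_fuel_pow _ 2) (ht2.trans (Nat.pow_le_pow_right (by omega) (by omega)))),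
      by simp [h, v2], S1.trans S2, T2⟩
  · obtain ⟨t', s2, e2, ht2, v2, S2, T2⟩ := hq γ s1 hr1 T1
    refine ⟨_, s2, .seq e1 (.ite_true (by simp [Expr.eval, v1, h]) e2), fuel_add_le ht1
      (fuel_add_le (le_fuel_pow _ 2) (ht2.trans (Nat.pow_le_pow_right (by omega) (by omega)))),
      by simp [h, v2], S1.trans S2, T2⟩

/-- Numeric recursion along the fuel. -/
theorem natRec {f : Γ → ℕ} {g : (Γ × ℕ) × ℕ → ℕ} (hf : Comp f) (hg : Comp g) :
    Comp (fun γ => Nat.rec (motive := fun _ => ℕ) (f γ) (fun i acc => g ((γ, i), acc))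
      (Ctx.fuel γ)) := by
  intro ℓ lr la hb
  obtain ⟨p, d, hp⟩ := hf ℓ lr la hb
  -- The accumulator lives in `lr`, where the result is expected, the counter in `lr + 1`; each new
  -- value is computed in `lr + 2`.
  obtain ⟨q, d', hq⟩ := hg ((ℓ, lr + 1), lr) (lr + 2) la
    ⟨⟨below_mono hb (by omega) le_rfl, by simp⟩, by simp⟩
  let body : Prog := .seq q (.seq (.assign lr (.reg (lr + 2)))
    (.assign (lr + 1) (.add (.reg (lr + 1)) (.const 1))))
  refine ⟨.seq p (.seq (.assign (lr + 1) (.const 0))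
    (loop (lr + 1) body)),
    d + (2 + ((d' + (2 + 4 + 1) + 1) + 6) + 1) + 1, fun γ s hr ht => ?_⟩
  obtain ⟨t, s1, e1, ht1, v1, S1, T1⟩ := hp γ s hr ht
  have h3 := below_three hb
  have hw := exec_loop (r := lr + 1) (body := body) (N := Ctx.fuel γ)
    (d := (d' + (2 + 4 + 1) + 1))
    (fun j s' => Same lr la s s' ∧ Tail la (Ctx.fuel γ) s' ∧ s'.reg (lr + 1) = j ∧
      s'.reg lr = Nat.rec (motive := fun _ => ℕ) (f γ) (fun i acc => g ((γ, i), acc)) j)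
    ?_ ?_ (s := s1.setReg (lr + 1) 0) ?_
  · obtain ⟨t', s2, e2, ht2, S2, T2, -, v2⟩ := hw
    refine ⟨_, s2, .seq e1 (.seq (.assign _ _ _) e2), fuel_add_le ht1 (fuel_add_le
      (le_fuel_pow _ 2) ht2), v2, S2, T2⟩
  · rintro j hj s' ⟨S', T', hj', hv'⟩
    obtain ⟨t', s2, e2, ht2, v2, S2, T2⟩ := hq ((γ, j), s'.reg lr) s'
      ⟨⟨frame hb hr S', hj'⟩, rfl⟩ T'
    refine ⟨_, _, .seq e2 (.seq (.assign _ _ _) (.assign _ _ _)),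
      fuel_add_le ht2 (fuel_add_le (le_fuel_pow _ 2) (le_fuel_pow _ 4)), ?_, ?_, ?_, ?_⟩
    · exact S'.trans ((S2.mono (by omega) le_rfl).trans ((Same.setReg _ _ _ _ le_rfl).trans
        (Same.setReg _ _ _ _ (by omega))))
    · exact (T2.setReg _ _).setReg _ _
    · simp [Expr.eval, S2.1 (lr + 1) (by omega), hj']
    · simp [Expr.eval, v2, hv']
  · rintro j hj s' ⟨S', T', hj', hv'⟩
    exact ⟨rel_fuel (frame hb hr S'), hj'⟩
  · refine ⟨S1.trans (Same.setReg _ _ _ _ (by omega)), T1.setReg _ _, by simp, ?_⟩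
    simp [v1]

end Comp

/-- The array with the values `f i` for `i < N` and `0` elsewhere. -/
def tab (N : ℕ) (f : ℕ → ℕ) (i : ℕ) : ℕ := if i < N then f i else 0

theorem tab_of_lt {N i : ℕ} (f : ℕ → ℕ) (h : i < N) : tab N f i = f i := if_pos h

/-- Iteration of a transformation of arrays of length `N`. -/
def arrIter (N : ℕ) (init : ℕ → ℕ) (step : ℕ → (ℕ → ℕ) → ℕ → ℕ) : ℕ → ℕ → ℕ
  | 0 => tab N init
  | j + 1 => tab N (step j (arrIter N init step j))

theorem arrIter_of_le {N : ℕ} (init : ℕ → ℕ) (step : ℕ → (ℕ → ℕ) → ℕ → ℕ) (j : ℕ) {i : ℕ}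
    (h : N ≤ i) : arrIter N init step j i = 0 := by
  cases j <;> simp [arrIter, tab, h]

/-- Increment the register `r`. -/
def incr (r : ℕ) : Prog := .assign r (.add (.reg r) (.const 1))

/-- Write into array `b` all values computed by `p`, with the counter in register `r` and the value
in register `r + 1`. -/
def fillProg (b r : ℕ) (p : Prog) : Prog :=
  .seq (.assign r (.const 0)) (loop r
    (.seq p (.seq (.write b (.reg r) (.reg (r + 1))) (incr r))))

/-- The array `b` lies in scratch space (`la ≤ b`) but is protected from `p` (`b < lap`). The `Tail`
condition supplies the zeros beyond the fuel, so the array becomes exactly a `tab`. -/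
theorem exec_fill {Γ : Type} [Ctx Γ] {f : Γ × ℕ → ℕ} {ℓ : Lay Γ} {lr la lap b d : ℕ} {p : Prog}
    (hb : below ℓ lr la) (hp : Computes f (ℓ, lr) (lr + 1) lap p d) {γ : Γ} {s : State}
    (hr : rel ℓ γ s) (ht : Tail la (Ctx.fuel γ) s) (hba : la ≤ b) (hbp : b < lap) :
    ∃ t s', Exec (fillProg b lr p) s t s' ∧ t ≤ (Ctx.fuel γ + 2) ^ (d + 18) ∧
      s'.arr b = tab (Ctx.fuel γ) (fun i => f (γ, i)) ∧ Same lr la s s' ∧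
      Tail la (Ctx.fuel γ) s' := by
  have h3 := below_three hb
  have hw := exec_loop (r := lr)
    (body := .seq p (.seq (.write b (.reg lr) (.reg (lr + 1))) (incr lr)))
    (N := Ctx.fuel γ) (d := (d + (3 + 4 + 1) + 1))
    (fun j s' => Same lr la s s' ∧ Tail la (Ctx.fuel γ) s' ∧ s'.reg lr = j ∧
      ∀ i < j, s'.arr b i = f (γ, i)) ?_ ?_ (s := s.setReg lr 0) ?_
  · obtain ⟨t', s2, e2, ht2, S2, T2, -, v2⟩ := hw
    refine ⟨_, s2, .seq (.assign _ _ _) e2, ?_, ?_, S2, T2⟩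
    · refine (fuel_add_le (le_fuel_pow _ 2) ht2).trans_eq ?_
      congr 1; omega
    · funext i
      by_cases hi : i < Ctx.fuel γ
      · rw [v2 i hi, tab_of_lt _ hi]
      · rw [T2 b hba i (by omega), tab, if_neg hi]
  · rintro j hj s' ⟨S', T', hj', hv'⟩
    obtain ⟨t', s2, e2, ht2, v2, S2, T2⟩ := hp (γ, j) s' ⟨frame hb hr S', hj'⟩
      (T'.mono (by omega) le_rfl)
    replace T2 := T'.of_same S2 T2
    refine ⟨_, _, .seq e2 (.seq (.write _ _ _ _) (.assign _ _ _)),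
      fuel_add_le ht2 (fuel_add_le (le_fuel_pow _ 3) (le_fuel_pow _ 4)), ?_, ?_, ?_, ?_⟩
    · exact S'.trans ((S2.mono (by omega) (by omega)).trans ((Same.setArr _ _ _ _ _ hba).trans
        (Same.setReg _ _ _ _ (by omega))))
    · refine (T2.setArr _ _ ?_).setReg _ _
      simpa [Expr.eval, S2.1 lr (by omega), hj'] using hj
    · simp [Expr.eval, S2.1 lr (by omega), hj']
    · intro i hi
      simp only [State.setReg_arr, State.setArr_arr, Function.update_self, Expr.eval,
        S2.1 lr (by omega), hj', v2, S2.2 b hbp, Function.update_apply]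
      split_ifs with hij
      · rw [hij]
      · exact hv' i (by omega)
  · rintro j hj s' ⟨S', T', hj', hv'⟩
    exact ⟨rel_fuel (frame hb hr S'), hj'⟩
  · exact ⟨Same.setReg _ _ _ _ le_rfl, ht.setReg _ _, by simp, by simp⟩

/-- Copy the array `b'` to the array `b`, with the counter in register `r`. -/
def copyProg (b b' r : ℕ) : Prog :=
  .seq (.assign r (.const 0)) (loop r
    (.seq (.write b (.reg r) (.read b' (.reg r))) (incr r)))

theorem exec_copy {N lr la b b' : ℕ} {s : State} (h3 : 3 < lr) (hN : s.reg 3 = N)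
    (ht : Tail la N s) (hba : la ≤ b) (hba' : la ≤ b') (hbb : b ≠ b') :
    ∃ t s', Exec (copyProg b b' lr) s t s' ∧ t ≤ (N + 2) ^ 18 ∧
      s'.arr b = s.arr b' ∧ Same lr la s s' ∧ Tail la N s' := by
  have hw := exec_loop (r := lr)
    (body := .seq (.write b (.reg lr) (.read b' (.reg lr))) (incr lr))
    (N := N) (d := (4 + 4 + 1))
    (fun j s' => Same lr la s s' ∧ Tail la N s' ∧ s'.reg lr = j ∧ s'.arr b' = s.arr b' ∧
      ∀ i < j, s'.arr b i = s.arr b' i) ?_ ?_ (s := s.setReg lr 0) ?_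
  · obtain ⟨t', s2, e2, ht2, S2, T2, -, -, v2⟩ := hw
    refine ⟨_, s2, .seq (.assign _ _ _) e2, ?_, ?_, S2, T2⟩
    · exact (fuel_add_le (le_fuel_pow _ 2) ht2).trans_eq
        (congrArg ((N + 2) ^ ·) (by norm_num))
    · funext i
      by_cases hi : i < N
      · exact v2 i hi
      · rw [T2 b hba i (by omega), ht b' hba' i (by omega)]
  · rintro j hj s' ⟨S', T', hj', hb', hv'⟩
    refine ⟨_, _, .seq (.write _ _ _ _) (.assign _ _ _),
      fuel_add_le (le_fuel_pow _ 4) (le_fuel_pow _ 4), ?_, ?_, ?_, ?_, ?_⟩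
    · exact S'.trans ((Same.setArr _ _ _ _ _ hba).trans (Same.setReg _ _ _ _ le_rfl))
    · refine (T'.setArr _ _ ?_).setReg _ _
      simpa [Expr.eval, hj'] using hj
    · simp [Expr.eval, hj']
    · simp [hbb.symm, hb']
    · intro i hi
      simp only [State.setReg_arr, State.setArr_arr, Function.update_self, Expr.eval,
        hj', hb', Function.update_apply]
      split_ifs with hij
      · rw [hij]
      · exact hv' i (by omega)
  · rintro j hj s' ⟨S', T', hj', -, hv'⟩
    exact ⟨(S'.1 3 h3).trans hN, hj'⟩
  · exact ⟨Same.setReg _ _ _ _ le_rfl, ht.setReg _ _, by simp, rfl, by simp⟩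

namespace Comp

variable {Γ : Type} [Ctx Γ]

/-- Computing with an array obtained by iteration along the fuel. -/
theorem letIter {init : Γ × ℕ → ℕ} {step : ((Γ × ℕ) × (ℕ → ℕ)) × ℕ → ℕ} {g : Γ × (ℕ → ℕ) → ℕ}
    (hi : Comp init) (hs : Comp step) (hg : Comp g) :
    Comp (fun γ => g (γ, arrIter (Ctx.fuel γ) (fun i => init (γ, i))
      (fun j a i => step (((γ, j), a), i)) (Ctx.fuel γ))) := by
  intro ℓ lr la hb
  obtain ⟨pi, d1, hpi⟩ := hi (ℓ, lr + 1) (lr + 2) (la + 2)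
    ⟨below_mono hb (by omega) (by omega), by simp⟩
  obtain ⟨ps, d2, hps⟩ := hs (((ℓ, lr), la), lr + 1) (lr + 2) (la + 2)
    ⟨⟨⟨below_mono hb (by omega) (by omega), by simp⟩, by simp⟩, by simp⟩
  obtain ⟨pg, d3, hpg⟩ := hg (ℓ, la) lr (la + 1) ⟨below_mono hb le_rfl (by omega), by simp⟩
  -- Double buffering: the new array is written to `la + 1` while `la` is still being read, and then
  -- copied back.
  let body : Prog := .seq (fillProg (la + 1) (lr + 1) ps)
    (.seq (copyProg la (la + 1) (lr + 1)) (incr lr))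
  have h3 := below_three hb
  refine ⟨.seq (fillProg la (lr + 1) pi) (.seq (.assign lr (.const 0))
    (.seq (loop lr body) pg)),
    (d1 + 18) + (2 + ((((d2 + 18) + (18 + 4 + 1) + 1) + 6) + d3 + 1) + 1) + 1,
    fun γ s hr ht => ?_⟩
  obtain ⟨t, s1, e1, ht1, v1, S1, T1⟩ := exec_fill (below_mono hb (by omega) le_rfl) hpi hr ht
    (le_refl la) (by omega)
  replace S1 := S1.mono (Nat.le_succ lr) le_rfl
  have hw := exec_loop (r := lr) (body := body)
    (N := Ctx.fuel γ) (d := ((d2 + 18) + (18 + 4 + 1) + 1))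
    (fun j s' => Same lr la s s' ∧ Tail la (Ctx.fuel γ) s' ∧ s'.reg lr = j ∧
      s'.arr la = arrIter (Ctx.fuel γ) (fun i => init (γ, i))
        (fun j a i => step (((γ, j), a), i)) j) ?_ ?_ (s := s1.setReg lr 0) ?_
  · obtain ⟨t', s2, e2, ht2, S2, T2, -, v2⟩ := hw
    obtain ⟨t3, s3, e3, ht3, v3, S3, T3⟩ := hpg (γ, _) s2 ⟨frame hb hr S2, v2⟩
      (T2.mono (by omega) le_rfl)
    refine ⟨_, s3, .seq e1 (.seq (.assign _ _ _) (.seq e2 e3)), fuel_add_le ht1 (fuel_add_le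
      (le_fuel_pow _ 2) (fuel_add_le ht2 ht3)), v3, S2.trans (S3.mono le_rfl (by omega)),
      T2.of_same S3 T3⟩
  · rintro j hj s' ⟨S', T', hj', hv'⟩
    have hr' := frame hb hr S'
    obtain ⟨t1, s2, e2, ht2, v2, S2, T2⟩ := exec_fill (Γ := (Γ × ℕ) × (ℕ → ℕ))
      (γ := ((γ, j), s'.arr la)) (s := s') (ℓ := ((ℓ, lr), la)) (la := la + 1) (b := la + 1)
      ⟨⟨below_mono hb (by omega) (by omega), by simp⟩, by simp⟩ hps
      ⟨⟨hr', hj'⟩, rfl⟩ (T'.mono (by omega) le_rfl) le_rfl (by omega)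
    simp only [Ctx.fuel_pushNum, Ctx.fuel_pushArr] at ht2 v2 T2
    replace T2 := T'.of_same S2 T2
    obtain ⟨t3, s3, e3, ht3, v3, S3, T3⟩ := exec_copy (N := Ctx.fuel γ) (lr := lr + 1) (la := la)
      (b := la) (b' := la + 1) (s := s2) (by omega) (rel_fuel (frame hb hr'
        (S2.mono (by omega) (by omega)))) T2 le_rfl (by omega) (by omega)
    refine ⟨_, _, .seq e2 (.seq e3 (.assign _ _ _)),
      (fuel_add_le ht2 (fuel_add_le ht3 (le_fuel_pow _ 4))).trans_eq
        (congrArg ((Ctx.fuel γ + 2) ^ ·) (by omega)), ?_, T3.setReg _ _, ?_, ?_⟩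
    · exact S'.trans ((S2.mono (by omega) (by omega)).trans ((S3.mono (by omega) le_rfl).trans
        (Same.setReg _ _ _ _ le_rfl)))
    · simp [Expr.eval, S3.1 lr (by omega), S2.1 lr (by omega), hj']
    · simp only [State.setReg_arr, v3, v2, arrIter]
      rw [hv']
  · rintro j hj s' ⟨S', T', hj', hv'⟩
    exact ⟨rel_fuel (frame hb hr S'), hj'⟩
  · exact ⟨S1.trans (Same.setReg _ _ _ _ le_rfl), T1.setReg _ _, by simp, v1⟩

end Comp

end RAM

/-! ### Decidable predicates, counting and bounded quantification. -/

namespace RAM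

open Ctx Classical Finset

variable {Γ : Type} [Ctx Γ]

/-- A property of contexts that is decidable in polynomial time with respect to the fuel. -/
def CompP (P : Γ → Prop) : Prop := Comp (fun γ => if P γ then 1 else 0)

/-- A family of functions on `ℕ` that is computable uniformly in the context. -/
def CompA (A : Γ → ℕ → ℕ) : Prop := Comp (fun x : Γ × ℕ => A x.1 x.2)

/-- A family of sets of natural numbers that is decidable uniformly in the context. -/
def CompS (U : Γ → ℕ → Prop) : Prop := CompP (fun x : Γ × ℕ => U x.1 x.2)

/-- A family of relations on `ℕ` that is decidable uniformly in the context. -/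
def CompR (E : Γ → ℕ → ℕ → Prop) : Prop := CompP (fun x : (Γ × ℕ) × ℕ => E x.1.1 x.1.2 x.2)

theorem Comp.of_eq {f g : Γ → ℕ} (hf : Comp f) (h : ∀ γ, f γ = g γ) : Comp g :=
  (funext h : f = g) ▸ hf

theorem CompP.of_iff {P Q : Γ → Prop} (hP : CompP P) (h : ∀ γ, P γ ↔ Q γ) : CompP Q :=
  (funext fun γ => propext (h γ) : P = Q) ▸ hP

theorem CompP.lift {P : Γ → Prop} (h : CompP P) : CompP (fun x : Γ × ℕ => P x.1) := Comp.lift h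

theorem CompA.lift {A : Γ → ℕ → ℕ} (h : CompA A) : CompA (fun x : Γ × ℕ => A x.1) :=
  Comp.rename h Comp.renaming_fstNum.pushNum

theorem CompA.liftArr {A : Γ → ℕ → ℕ} (h : CompA A) : CompA (fun x : Γ × (ℕ → ℕ) => A x.1) :=
  Comp.rename h Comp.renaming_fstArr.pushNum

theorem CompS.lift {U : Γ → ℕ → Prop} (h : CompS U) : CompS (fun x : Γ × ℕ => U x.1) :=
  Comp.rename h Comp.renaming_fstNum.pushNum

theorem CompS.liftArr {U : Γ → ℕ → Prop} (h : CompS U) : CompS (fun x : Γ × (ℕ → ℕ) => U x.1) :=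
  Comp.rename h Comp.renaming_fstArr.pushNum

theorem CompR.lift {E : Γ → ℕ → ℕ → Prop} (h : CompR E) : CompR (fun x : Γ × ℕ => E x.1) :=
  Comp.rename h Comp.renaming_fstNum.pushNum.pushNum

theorem CompR.liftArr {E : Γ → ℕ → ℕ → Prop} (h : CompR E) :
    CompR (fun x : Γ × (ℕ → ℕ) => E x.1) :=
  Comp.rename h Comp.renaming_fstArr.pushNum.pushNum

theorem CompA.app {A : Γ → ℕ → ℕ} {e : Γ → ℕ} (hA : CompA A) (he : Comp e) :
    Comp (fun γ => A γ (e γ)) := Comp.let_ (g := fun x : Γ × ℕ => A x.1 x.2) he hA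

theorem CompS.app {U : Γ → ℕ → Prop} {e : Γ → ℕ} (hU : CompS U) (he : Comp e) :
    CompP (fun γ => U γ (e γ)) :=
  Comp.let_ (g := fun x : Γ × ℕ => if U x.1 x.2 then 1 else 0) he hU

theorem CompR.app {E : Γ → ℕ → ℕ → Prop} {e e' : Γ → ℕ} (hE : CompR E) (he : Comp e)
    (he' : Comp e') : CompP (fun γ => E γ (e γ) (e' γ)) :=
  Comp.let_ (g := fun x : Γ × ℕ => if E x.1 x.2 (e' x.1) then 1 else 0) he
    (Comp.let_ (g := fun x : (Γ × ℕ) × ℕ => if E x.1.1 x.1.2 x.2 then 1 else 0) he'.lift hE)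

theorem CompA.var : CompA (fun x : Γ × (ℕ → ℕ) => x.2) :=
  Comp.of_expr fun ℓ => ⟨.read ℓ.1.2 (.reg ℓ.2), fun _ _ h => by
    simp only [Expr.eval, h.1.2, h.2]⟩

/-- The decidability instance is arbitrary, so that the lemma applies to any `if`, whichever
instance was elaborated. -/
theorem Comp.ite {P : Γ → Prop} {inst : ∀ γ, Decidable (P γ)} {f g : Γ → ℕ}
    (hP : CompP P) (hf : Comp f) (hg : Comp g) :
    Comp (fun γ => if P γ then f γ else g γ) :=
  (Comp.ite_ne hP hf hg).of_eq fun γ => by by_cases h : P γ <;> simp [h]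

namespace CompP

theorem ne_zero {f : Γ → ℕ} (hf : Comp f) : CompP (fun γ => f γ ≠ 0) :=
  (Comp.ite_ne hf (.const 1) (.const 0)).of_eq fun _ => by congr

theorem not {P : Γ → Prop} (hP : CompP P) : CompP (fun γ => ¬ P γ) :=
  (Comp.ite (inst := fun _ => propDecidable _) hP (.const 0) (.const 1)).of_eq
    fun γ => by by_cases h : P γ <;> simp [h]

theorem and {P Q : Γ → Prop} (hP : CompP P) (hQ : CompP Q) : CompP (fun γ => P γ ∧ Q γ) :=
  (Comp.ite (inst := fun _ => propDecidable _) hP hQ (.const 0)).of_eq fun γ => by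
    by_cases h : P γ <;> by_cases h' : Q γ <;> simp [h, h']

theorem or {P Q : Γ → Prop} (hP : CompP P) (hQ : CompP Q) : CompP (fun γ => P γ ∨ Q γ) :=
  (hP.not.and hQ.not).not.of_iff fun γ => by tauto

theorem imp {P Q : Γ → Prop} (hP : CompP P) (hQ : CompP Q) : CompP (fun γ => P γ → Q γ) :=
  (hP.not.or hQ).of_iff fun γ => by tauto

theorem lt {f g : Γ → ℕ} (hf : Comp f) (hg : Comp g) : CompP (fun γ => f γ < g γ) :=
  (ne_zero (hg.sub hf)).of_iff fun γ => by omega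

theorem le {f g : Γ → ℕ} (hf : Comp f) (hg : Comp g) : CompP (fun γ => f γ ≤ g γ) :=
  (lt hg hf).not.of_iff fun γ => by omega

theorem eq {f g : Γ → ℕ} (hf : Comp f) (hg : Comp g) : CompP (fun γ => f γ = g γ) :=
  ((le hf hg).and (le hg hf)).of_iff fun γ => by omega

end CompP

theorem Comp.sum {f : Γ → ℕ → ℕ} (hf : CompA f) :
    Comp (fun γ => ∑ i ∈ range (Ctx.fuel γ), f γ i) := by
  refine (Comp.natRec (g := fun x : (Γ × ℕ) × ℕ => x.2 + f x.1.1 x.1.2) (.const 0)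
    (Comp.add .var (Comp.lift hf))).of_eq fun γ => ?_
  induction Ctx.fuel γ with
  | zero => simp
  | succ n ih => rw [sum_range_succ, ← ih]

theorem Comp.count {P : Γ → ℕ → Prop} {inst : ∀ γ, DecidablePred (P γ)} (hP : CompS P) :
    Comp (fun γ => ((range (Ctx.fuel γ)).filter (P γ)).card) :=
  (Comp.sum (f := fun γ i => if P γ i then 1 else 0)
    (Comp.of_eq hP fun x => by by_cases h : P x.1 x.2 <;> simp [h])).of_eq fun γ =>
      (card_filter _ _).symm

/-- A bounded quantifier is a count compared with zero. Exhaustive search over all numbers below the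
fuel is therefore polynomial in the fuel. -/
theorem CompP.exists_lt {P : Γ → ℕ → Prop} (hP : CompS P) :
    CompP (fun γ => ∃ i < Ctx.fuel γ, P γ i) :=
  (CompP.ne_zero (Comp.count (inst := fun _ _ => propDecidable _) hP)).of_iff fun γ => by
    simp [Finset.filter_eq_empty_iff]

theorem CompP.forall_lt {P : Γ → ℕ → Prop} (hP : CompS P) :
    CompP (fun γ => ∀ i < Ctx.fuel γ, P γ i) :=
  (CompP.exists_lt (P := fun γ i => ¬ P γ i) (CompP.not hP)).not.of_iff fun γ => by
    push Not; rfl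

/-! ### Arithmetic -/

/-- The product, if the second factor is at most `N`. -/
def mulN (N a b : ℕ) : ℕ := ∑ i ∈ range N, if i < b then a else 0

theorem mulN_eq {N b : ℕ} (a : ℕ) (h : b ≤ N) : mulN N a b = a * b := by
  rw [mulN, ← sum_filter, sum_const]
  have : (range N).filter (· < b) = range b := by ext; simp; omega
  rw [this, card_range, smul_eq_mul, mul_comm]

theorem Comp.mulN {a b : Γ → ℕ} (ha : Comp a) (hb : Comp b) :
    Comp (fun γ => mulN (Ctx.fuel γ) (a γ) (b γ)) :=
  Comp.sum (f := fun γ i => if i < b γ then a γ else 0)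
    (Comp.ite (.lt .var hb.lift) ha.lift (.const 0))

/-- The quotient, for a dividend smaller than `N`. -/
def divN (N a b : ℕ) : ℕ := ((range N).filter fun q => mulN N b (q + 1) ≤ a).card

/-- The `q` with `b * (q + 1) ≤ a` are exactly those below `a / b`, and all of them are below `N`.
-/
theorem divN_eq {N a b : ℕ} (h : a < N) (hb : 0 < b) : divN N a b = a / b := by
  have : (range N).filter (fun q => mulN N b (q + 1) ≤ a) = range (a / b) := by
    ext q
    simp only [mem_filter, mem_range]
    constructor
    · rintro ⟨h1, h2⟩
      rw [mulN_eq _ (by omega), mul_comm] at h2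
      exact (Nat.le_div_iff_mul_le hb).2 h2
    · intro hq
      have h1 : q < N := hq.trans_le ((Nat.div_le_self a b).trans h.le)
      refine ⟨h1, ?_⟩
      rw [mulN_eq _ (by omega), mul_comm]
      exact (Nat.le_div_iff_mul_le hb).1 hq
  rw [divN, this, card_range]

theorem Comp.divN {a b : Γ → ℕ} (ha : Comp a) (hb : Comp b) :
    Comp (fun γ => divN (Ctx.fuel γ) (a γ) (b γ)) :=
  Comp.count (P := fun γ q => RAM.mulN (Ctx.fuel γ) (b γ) (q + 1) ≤ a γ)
    (CompP.le (Comp.mulN (Γ := Γ × ℕ) hb.lift (Comp.var.add (.const 1))) ha.lift)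

/-- The remainder, for a dividend smaller than `N`. -/
def modN (N a b : ℕ) : ℕ := a - mulN N b (divN N a b)

theorem modN_eq {N a b : ℕ} (h : a < N) (hb : 0 < b) : modN N a b = a % b := by
  rw [modN, divN_eq h hb, mulN_eq _ ((Nat.div_le_self a b).trans h.le)]
  have := Nat.div_add_mod a b
  omega

theorem Comp.modN {a b : Γ → ℕ} (ha : Comp a) (hb : Comp b) :
    Comp (fun γ => modN (Ctx.fuel γ) (a γ) (b γ)) := ha.sub (hb.mulN (ha.divN hb))

/-- The power, if base and exponent are at most `N`. -/
def powN (N b e : ℕ) : ℕ :=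
  Nat.rec (motive := fun _ => ℕ) 1 (fun i acc => if i < e then mulN N acc b else acc) N

/-- Only the second factor of `mulN` is bounded, and the accumulator is the first one. The power
itself may exceed `N`, which makes it possible to compute a much larger fuel from a small one. -/
theorem powN_eq {N b e : ℕ} (hb : b ≤ N) (he : e ≤ N) : powN N b e = b ^ e := by
  have : ∀ m, Nat.rec (motive := fun _ => ℕ) 1
      (fun i acc => if i < e then mulN N acc b else acc) m = b ^ min m e := by
    intro m
    induction m with
    | zero => simp
    | succ m ih =>
      simp only [ih]
      rw [mulN_eq _ hb]
      split_ifs with h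
      · rw [← pow_succ]; congr 1; omega
      · congr 1; omega
  rw [powN, this, min_eq_right he]

theorem Comp.powN {b e : Γ → ℕ} (hb : Comp b) (he : Comp e) :
    Comp (fun γ => powN (Ctx.fuel γ) (b γ) (e γ)) :=
  Comp.natRec (g := fun x : (Γ × ℕ) × ℕ => if x.1.2 < e x.1.1 then
    RAM.mulN (Ctx.fuel x.1.1) x.2 (b x.1.1) else x.2) (.const 1)
    (Comp.ite (.lt Comp.var.lift he.lift.lift)
      (Comp.mulN (Γ := (Γ × ℕ) × ℕ) .var hb.lift.lift) .var)

/-- The digit at place `i` of a number `x < N` in base `b`. -/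
def digN (N b x i : ℕ) : ℕ :=
  modN N (Nat.rec (motive := fun _ => ℕ) x (fun j y => if j < i then divN N y b else y) N) b

theorem digN_eq {N b x i : ℕ} (hx : x < N) (hi : i ≤ N) (hb : 0 < b) :
    digN N b x i = x / b ^ i % b := by
  have : ∀ m, Nat.rec (motive := fun _ => ℕ) x
      (fun j y => if j < i then divN N y b else y) m = x / b ^ min m i := by
    intro m
    induction m with
    | zero => simp
    | succ m ih =>
      simp only [ih]
      split_ifs with h
      · rw [divN_eq ((Nat.div_le_self _ _).trans_lt hx) hb, Nat.div_div_eq_div_mul, ← pow_succ]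
        congr 2; omega
      · congr 2; omega
  rw [digN, this, min_eq_right hi, modN_eq ((Nat.div_le_self _ _).trans_lt hx) hb]

theorem Comp.digN {b x i : Γ → ℕ} (hb : Comp b) (hx : Comp x) (hi : Comp i) :
    Comp (fun γ => digN (Ctx.fuel γ) (b γ) (x γ) (i γ)) :=
  Comp.modN (Comp.natRec (g := fun z : (Γ × ℕ) × ℕ => if z.1.2 < i z.1.1 then
    RAM.divN (Ctx.fuel z.1.1) z.2 (b z.1.1) else z.2) hx
    (Comp.ite (.lt Comp.var.lift hi.lift.lift)
      (Comp.divN (Γ := (Γ × ℕ) × ℕ) .var hb.lift.lift) .var)) hb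

/-- Guesses and partial solutions are encoded as digit strings, so that searching for them is
quantification over numbers. -/
theorem exists_digits {b L : ℕ} (f : ℕ → ℕ) (hf : ∀ i < L, f i < b) :
    ∃ x < b ^ L, ∀ i < L, x / b ^ i % b = f i := by
  induction L generalizing f with
  | zero => exact ⟨0, by simp, by simp⟩
  | succ L ih =>
    obtain ⟨x, hx, h⟩ := ih (fun i => f (i + 1)) fun i hi => hf _ (by omega)
    have h0 := hf 0 (by omega)
    refine ⟨f 0 + b * x, ?_, fun i hi => ?_⟩
    · calc f 0 + b * x < b + b * x := by omega
        _ = b * (x + 1) := by ring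
        _ ≤ b * b ^ L := Nat.mul_le_mul_left _ hx
        _ = b ^ (L + 1) := by ring
    · cases i with
      | zero => simp [Nat.mod_eq_of_lt h0]
      | succ i =>
        rw [pow_succ', ← Nat.div_div_eq_div_mul, Nat.add_mul_div_left _ _ (by omega),
          Nat.div_eq_of_lt h0, zero_add, h i (by omega)]

end RAM

/-! ### Forests as degenerate vertex sets. -/

section

open Finset RAM

namespace SimpleGraph

open Classical

/-- The neighbours of `v` in `B`. -/
noncomputable def nbrsIn (H : SimpleGraph ℕ) (B : Finset ℕ) (v : ℕ) : Finset ℕ := B.filter (H.Adj v)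

/-- Every nonempty subset of `A` contains a vertex with at most one neighbour in the subset. For
finite sets this means that `A` induces a forest. -/
def Degenerate (H : SimpleGraph ℕ) (A : Finset ℕ) : Prop :=
  ∀ B ⊆ A, B.Nonempty → ∃ v ∈ B, (H.nbrsIn B v).card ≤ 1

variable {H : SimpleGraph ℕ} {A B : Finset ℕ} {u v : ℕ}

@[simp] theorem mem_nbrsIn : u ∈ H.nbrsIn B v ↔ u ∈ B ∧ H.Adj v u := mem_filter

theorem nbrsIn_mono (h : A ⊆ B) : H.nbrsIn A v ⊆ H.nbrsIn B v := filter_subset_filter _ h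

theorem nbrsIn_insert_self : H.nbrsIn (insert v A) v = H.nbrsIn A v := by
  ext u
  simp only [mem_nbrsIn, mem_insert]
  constructor
  · rintro ⟨rfl | h, h'⟩
    · exact absurd h' (H.loopless.irrefl _)
    · exact ⟨h, h'⟩
  · exact fun h => ⟨.inr h.1, h.2⟩

theorem Degenerate.mono (h : H.Degenerate A) (hB : B ⊆ A) : H.Degenerate B :=
  fun C hC => h C (hC.trans hB)

theorem Degenerate.insert (h : H.Degenerate A) (hv : (H.nbrsIn A v).card ≤ 1) :
    H.Degenerate (insert v A) := by
  intro B hB hne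
  by_cases hvB : v ∈ B
  · refine ⟨v, hvB, le_trans (card_le_card ?_) hv⟩
    rw [← nbrsIn_insert_self (A := A)]
    exact nbrsIn_mono hB
  · exact h B ((subset_insert_iff_of_notMem hvB).1 hB) hne

/-- A forest is built by adding one vertex at a time with at most one neighbour among the earlier
ones: take off the vertex provided by degeneracy and add it last. -/
theorem Degenerate.induction {P : Finset ℕ → Prop} (h0 : P ∅)
    (hi : ∀ v A, v ∉ A → (H.nbrsIn A v).card ≤ 1 → H.Degenerate A → P A → P (Insert.insert v A)) :
    ∀ A, H.Degenerate A → P A := by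
  intro A
  induction A using Finset.strongInduction with
  | H A ih =>
    intro hA
    rcases A.eq_empty_or_nonempty with rfl | hne
    · exact h0
    · obtain ⟨v, hv, hd⟩ := hA A Subset.rfl hne
      rw [← insert_erase hv, nbrsIn_insert_self] at hd
      have hA' := hA.mono (erase_subset v A)
      have := hi v (A.erase v) (notMem_erase v A) hd hA' (ih _ (erase_ssubset hv) hA')
      rwa [insert_erase hv] at this

/-- Twice the number of edges within `A`. -/
noncomputable def degSum (H : SimpleGraph ℕ) (A : Finset ℕ) : ℕ := ∑ v ∈ A, (H.nbrsIn A v).card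

theorem degSum_insert (hv : v ∉ A) :
    H.degSum (insert v A) = H.degSum A + 2 * (H.nbrsIn A v).card := by
  have h1 : ∀ u ∈ A, (H.nbrsIn (insert v A) u).card =
      (H.nbrsIn A u).card + if H.Adj v u then 1 else 0 := by
    intro u hu
    rw [nbrsIn, filter_insert]
    by_cases h : H.Adj v u
    · rw [if_pos h.symm, card_insert_of_notMem (by simp [hv]), if_pos h]; rfl
    · rw [if_neg (fun h' => h h'.symm), if_neg h]; rfl
  rw [degSum, sum_insert hv, nbrsIn_insert_self, sum_congr rfl h1, sum_add_distrib, degSum,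
    ← card_filter]
  have : (A.filter (H.Adj v)).card = (H.nbrsIn A v).card := rfl
  rw [this]
  ring

/-- A forest has no more edges than vertices, since each added vertex brings at most one edge. This
bounds the number of guesses in the search. -/
theorem Degenerate.degSum_le (h : H.Degenerate A) : H.degSum A ≤ 2 * A.card := by
  refine Degenerate.induction (P := fun A => H.degSum A ≤ 2 * A.card) (by simp [degSum]) ?_ A h
  intro v A hv hd _ ih
  rw [degSum_insert hv, card_insert_of_notMem hv]
  omega

/-- Forests are bipartite: the added vertex avoids the colour of its at most one neighbour. -/
theorem Degenerate.exists_coloring (h : H.Degenerate A) :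
    ∃ c : ℕ → Bool, ∀ u ∈ A, ∀ v ∈ A, H.Adj u v → c u ≠ c v := by
  refine Degenerate.induction
    (P := fun A => ∃ c : ℕ → Bool, ∀ u ∈ A, ∀ v ∈ A, H.Adj u v → c u ≠ c v) (by simp) ?_ A h
  rintro v A hv hd _ ⟨c, hc⟩
  obtain ⟨b, hb⟩ : ∃ b : Bool, ∀ u ∈ A, H.Adj v u → c u ≠ b := by
    rcases Finset.card_le_one_iff_subset_singleton.1 hd with ⟨x, hx⟩
    refine ⟨!c x, fun u hu huv => ?_⟩
    have : u = x := by simpa using hx (mem_nbrsIn.2 ⟨hu, huv⟩)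
    simp [this]
  have hne : ∀ u ∈ A, u ≠ v := fun u hu h => hv (h ▸ hu)
  refine ⟨Function.update c v b, fun u hu w hw huw => ?_⟩
  rcases mem_insert.1 hu with rfl | hu <;> rcases mem_insert.1 hw with rfl | hw
  · exact absurd huw (H.loopless.irrefl _)
  · simpa [hne w hw] using (hb w hw huw).symm
  · rename_i h
    simpa [hne u h] using hb u h huw.symm
  · simpa [hne u hu, hne w hw] using hc u hu w hw huw

/-! ### Elimination of vertices of degree at most one -/

/-- The vertex `v` is alive and has at most one neighbour that is alive. -/
def Removable (N : ℕ) (E : ℕ → ℕ → Prop) (key : ℕ → ℕ) (v : ℕ) : Prop :=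
  key v = 0 ∧ ((range N).filter fun u => key u = 0 ∧ E v u).card ≤ 1

/-- Remove the smallest removable vertex in step `j`. -/
noncomputable def elimStep (N : ℕ) (E : ℕ → ℕ → Prop) (j : ℕ) (key : ℕ → ℕ) (v : ℕ) : ℕ :=
  if Removable N E key v ∧ ∀ u < N, u < v → ¬ Removable N E key u then j + 2 else key v

/-- The state of the elimination process on the set `U` after `j` steps: a vertex has the value `0`
as long as it is alive, and the value `i + 2` if it was removed in step `i`. -/
noncomputable def elimKeys (N : ℕ) (E : ℕ → ℕ → Prop) (U : ℕ → Prop) : ℕ → ℕ → ℕ :=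
  arrIter N (fun v => if U v then 0 else 1) (elimStep N E)

/-- Choosing the smallest removable vertex ensures that each step changes at most one entry. -/
theorem elimStep_cases (N : ℕ) (E : ℕ → ℕ → Prop) (j : ℕ) (key : ℕ → ℕ)
    (hk : ∀ i, N ≤ i → key i = 0) :
    ((∀ v < N, ¬ Removable N E key v) ∧ tab N (elimStep N E j key) = key) ∨
    ∃ v < N, Removable N E key v ∧
      tab N (elimStep N E j key) = Function.update key v (j + 2) := by
  by_cases h : ∃ v, v < N ∧ Removable N E key v
  · right
    have hm : ∀ u < N, u < Nat.find h → ¬ Removable N E key u :=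
      fun u hu hlt h' => Nat.find_min h hlt ⟨hu, h'⟩
    obtain ⟨h1, h2⟩ := Nat.find_spec h
    refine ⟨Nat.find h, h1, h2, funext fun i => ?_⟩
    by_cases hi : i < N
    · rw [tab_of_lt _ hi, elimStep]
      by_cases hif : i = Nat.find h
      · subst hif
        rw [Function.update_self, if_pos]
        exact ⟨h2, hm⟩
      · rw [Function.update_of_ne hif, if_neg]
        rintro ⟨h3, h4⟩
        rcases lt_or_gt_of_ne hif with hlt | hlt
        · exact hm i hi hlt h3
        · exact h4 _ h1 hlt h2
    · have : i ≠ Nat.find h := by omega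
      simp [tab, hi, this, hk i (by omega)]
  · left
    push Not at h
    refine ⟨h, funext fun i => ?_⟩
    by_cases hi : i < N
    · rw [tab_of_lt _ hi, elimStep, if_neg fun h' => h i hi h'.1]
    · simp [tab, hi, hk i (by omega)]

theorem elimKeys_zero {N : ℕ} {E : ℕ → ℕ → Prop} {U : ℕ → Prop} :
    ∀ i, ∀ v < N, elimKeys N E U i v = 0 → U v := by
  intro i
  induction i with
  | zero =>
    intro v hv h0
    by_contra h
    simp [elimKeys, arrIter, tab, hv, h] at h0
  | succ i ihi =>
    intro v hv h0
    have h1 : elimKeys N E U (i + 1) v = elimStep N E i (elimKeys N E U i) v :=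
      tab_of_lt _ hv
    rw [h1, elimStep] at h0
    split_ifs at h0
    exact ihi v hv h0

/-- The times of removal in an elimination process on the set `A`. -/
structure IsElimination (H : SimpleGraph ℕ) (A : Finset ℕ) (N : ℕ) (key : ℕ → ℕ) : Prop where
  le : ∀ v, key v ≤ N + 1
  mem : ∀ v, 2 ≤ key v → v ∈ A
  inj : ∀ u v, 2 ≤ key u → key u = key v → u = v
  ne_one : ∀ v ∈ A, key v ≠ 1
  nbrs : ∀ v, 2 ≤ key v →
    (A.filter fun u => H.Adj v u ∧ (key u = 0 ∨ key v < key u)).card ≤ 1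

/-- A vertex removed in step `j` has at most one living neighbour then, and everything removed later
or never is still alive at that moment. Times start at 2 because 0 means alive and 1 means outside
the set. -/
theorem isElimination_elimKeys (H : SimpleGraph ℕ) {N : ℕ} {U : ℕ → Prop}
    (hA : ∀ v, v ∈ A ↔ v < N ∧ U v) :
    ∀ j, IsElimination H A j (elimKeys N H.Adj U j) := by
  intro j
  induction j with
  | zero =>
    have h0 : ∀ v, elimKeys N H.Adj U 0 v = if v < N then if U v then 0 else 1 else 0 :=
      fun v => rfl
    have h1 : ∀ v, elimKeys N H.Adj U 0 v ≤ 1 := by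
      intro v; rw [h0]; split_ifs <;> omega
    refine ⟨h1, fun v hv => ?_, fun u v hu => ?_, fun v hv => ?_, fun v hv => ?_⟩
    · have := h1 v; omega
    · have := h1 u; omega
    · have := (hA v).1 hv
      simp [h0, this]
    · have := h1 v; omega
  | succ j ih =>
    have hN : ∀ i, N ≤ i → elimKeys N H.Adj U j i = 0 := fun i hi => arrIter_of_le _ _ j hi
    have hs : elimKeys N H.Adj U (j + 1) = tab N (elimStep N H.Adj j (elimKeys N H.Adj U j)) := rfl
    rw [hs]
    have hone := elimKeys_zero (N := N) (E := H.Adj) (U := U) j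
    rcases elimStep_cases N H.Adj j (elimKeys N H.Adj U j) hN with ⟨-, h⟩ | ⟨x, hx, hr, h⟩
    · rw [h]
      exact ⟨fun v => (ih.le v).trans (by omega), ih.mem, ih.inj, ih.ne_one, ih.nbrs⟩
    · rw [h]
      have hxA : x ∈ A := (hA x).2 ⟨hx, hone x hx hr.1⟩
      generalize elimKeys N H.Adj U j = key at *
      refine ⟨fun v => ?_, fun v hv => ?_, fun u v hu huv => ?_, fun v hv => ?_, fun v hv => ?_⟩
      · have := ih.le v
        rw [Function.update_apply]; split_ifs <;> omega
      · by_cases hvx : v = x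
        · rwa [hvx]
        · rw [Function.update_of_ne hvx] at hv
          exact ih.mem v hv
      · have h1 := ih.le v
        have h2 := ih.le u
        simp only [Function.update_apply] at hu huv
        split_ifs at hu huv with h3 h4 h4
        · rw [h3, h4]
        · omega
        · omega
        · exact ih.inj u v hu huv
      · have := ih.ne_one v hv
        rw [Function.update_apply]; split_ifs <;> omega
      · by_cases hvx : v = x
        · subst hvx
          refine le_trans (card_le_card fun u hu => ?_) hr.2
          simp only [mem_filter, Function.update_self, mem_range] at hu ⊢
          obtain ⟨hu, huv, hk⟩ := hu
          have huN := ((hA u).1 hu).1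
          have hne : u ≠ v := huv.ne'
          rw [Function.update_of_ne hne] at hk
          have := ih.le u
          exact ⟨huN, by omega, huv⟩
        · rw [Function.update_of_ne hvx] at hv ⊢
          refine le_trans (card_le_card fun u hu => ?_) (ih.nbrs v hv)
          simp only [mem_filter] at hu ⊢
          refine ⟨hu.1, hu.2.1, ?_⟩
          have := hu.2.2
          rw [Function.update_apply] at this
          have := hr.1
          split_ifs at * with hux
          · subst hux; omega
          · assumption

/-- Degeneracy provides a removable vertex as long as some vertex is alive, so each step makes
progress. -/
theorem elimKeys_card (H : SimpleGraph ℕ) {N : ℕ} {U : ℕ → Prop}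
    (hA : ∀ v, v ∈ A ↔ v < N ∧ U v) (hd : H.Degenerate A) (j : ℕ) :
    (A.filter fun v => elimKeys N H.Adj U j v = 0).card ≤ A.card - j := by
  induction j with
  | zero => exact (card_le_card (filter_subset _ _)).trans (by omega)
  | succ j ih =>
    have hN : ∀ i, N ≤ i → elimKeys N H.Adj U j i = 0 := fun i hi => arrIter_of_le _ _ j hi
    have hs : elimKeys N H.Adj U (j + 1) = tab N (elimStep N H.Adj j (elimKeys N H.Adj U j)) := rfl
    have hone := elimKeys_zero (N := N) (E := H.Adj) (U := U) j
    rw [hs]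
    generalize elimKeys N H.Adj U j = key at *
    rcases elimStep_cases N H.Adj j key hN with ⟨hno, h⟩ | ⟨x, hx, hr, h⟩
    · rw [h]
      rcases (A.filter fun v => key v = 0).eq_empty_or_nonempty with he | hne
      · simp [he]
      · obtain ⟨v, hv, hdv⟩ := hd _ (filter_subset _ _) hne
        rw [mem_filter] at hv
        refine absurd ⟨hv.2, le_trans (card_le_card fun u hu => ?_) hdv⟩
          (hno v ((hA v).1 hv.1).1)
        simp only [mem_filter, mem_nbrsIn, mem_range] at hu ⊢
        exact ⟨⟨(hA u).2 ⟨hu.1, hone u hu.1 hu.2.1⟩, hu.2.1⟩, hu.2.2⟩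
    · rw [h]
      have hxA : x ∈ A := (hA x).2 ⟨hx, hone x hx hr.1⟩
      have hsub : (A.filter fun v => Function.update key x (j + 2) v = 0) ⊆
          (A.filter fun v => key v = 0).erase x := by
        intro v hv
        simp only [mem_filter, mem_erase] at hv ⊢
        by_cases hvx : v = x
        · subst hvx; simp at hv
        · rw [Function.update_of_ne hvx] at hv
          exact ⟨hvx, hv⟩
      have h1 := card_le_card hsub
      rw [card_erase_of_mem (by simp [hxA, hr.1])] at h1
      omega

/-- Forests are recognized by running the elimination. If everything is removed, the vertex of `B`
removed first has at most one neighbour in `B`, because all others go later; conversely `N` steps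
exhaust a degenerate set. -/
theorem elimKeys_ne_zero_iff (H : SimpleGraph ℕ) {N : ℕ} {U : ℕ → Prop}
    (hA : ∀ v, v ∈ A ↔ v < N ∧ U v) :
    (∀ v ∈ A, elimKeys N H.Adj U N v ≠ 0) ↔ H.Degenerate A := by
  constructor
  · intro h B hB hne
    have hel := isElimination_elimKeys H hA N
    obtain ⟨v, hv, hmin⟩ := exists_min_image B (elimKeys N H.Adj U N) hne
    have hv0 := h v (hB hv)
    have hv1 := hel.ne_one v (hB hv)
    refine ⟨v, hv, le_trans (card_le_card fun u hu => ?_) (hel.nbrs v (by omega))⟩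
    rw [mem_nbrsIn] at hu
    refine mem_filter.2 ⟨hB hu.1, hu.2, .inr (lt_of_le_of_ne (hmin u hu.1) fun he => ?_)⟩
    exact hu.2.ne (hel.inj v u (by omega) he)
  · intro hd v hv h0
    have h1 := elimKeys_card H hA hd N
    have h2 : A.card ≤ N := by
      have : A ⊆ range N := fun v hv => mem_range.2 ((hA v).1 hv).1
      simpa using card_le_card this
    rw [Nat.sub_eq_zero_of_le h2, Nat.le_zero, card_eq_zero] at h1
    have : v ∈ A.filter fun v => elimKeys N H.Adj U N v = 0 := mem_filter.2 ⟨hv, h0⟩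
    rw [h1] at this
    exact absurd this (notMem_empty v)

end SimpleGraph

/-! ### Computability of the elimination process. -/

namespace RAM

open SimpleGraph Classical

variable {Γ : Type} [Ctx Γ]

theorem compS_removable {E : Γ → ℕ → ℕ → Prop} {key : Γ → ℕ → ℕ} (hE : CompR E)
    (hk : CompA key) : CompS (fun γ => Removable (Ctx.fuel γ) (E γ) (key γ)) :=
  .and (.eq hk (.const 0)) (.le (.count (P := fun (x : Γ × ℕ) u => key x.1 u = 0 ∧ E x.1 x.2 u)
    (.and (.eq (CompA.app hk.lift.lift .var) (.const 0)) hE)) (.const 1))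

/-- The context is first extended by the index at which the final array is to be read; the whole
array is recomputed for each query, which costs only a polynomial factor. -/
theorem compA_elimKeys {E : Γ → ℕ → ℕ → Prop} {U : Γ → ℕ → Prop} (hE : CompR E)
    (hU : CompS U) : CompA (fun γ => elimKeys (Ctx.fuel γ) (E γ) (U γ) (Ctx.fuel γ)) := by
  have hinit : Comp (fun x : (Γ × ℕ) × ℕ => if U x.1.1 x.2 then 0 else 1) :=
    .ite hU.lift (.const 0) (.const 1)
  have hr : CompS (fun x : ((Γ × ℕ) × ℕ) × (ℕ → ℕ) =>
      Removable (Ctx.fuel x) (E x.1.1.1) x.2) :=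
    compS_removable hE.lift.lift.liftArr .var
  have hstep : Comp (fun x : (((Γ × ℕ) × ℕ) × (ℕ → ℕ)) × ℕ =>
      elimStep (Ctx.fuel x.1.1.1.1) (E x.1.1.1.1) x.1.1.2 x.1.2 x.2) :=
    .ite (.and hr (CompP.forall_lt (Γ := (((Γ × ℕ) × ℕ) × (ℕ → ℕ)) × ℕ)
      (P := fun x u => u < x.2 → ¬ Removable (Ctx.fuel x) (E x.1.1.1.1) x.1.2 u)
      (.imp (.lt .var Comp.var.lift) (.not (hr.lift.lift.app .var)))))
      (.add (Comp.lift (Comp.liftArr .var)) (.const 2)) CompA.var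
  exact Comp.letIter (Γ := Γ × ℕ) (g := fun x => x.2 x.1.2) hinit hstep
    (CompA.var.app (Comp.liftArr .var))

end RAM

/-! ### Search states for feedback vertex sets and the exchange argument. -/

namespace SimpleGraph

open Classical

variable {H : SimpleGraph ℕ} {A W U X Y : Finset ℕ} {k v : ℕ}

/-- The state of a search for a feedback vertex set of size at most `k` of the graph on `A`: the
vertices in `X` are deleted, those in `W` are kept, those in `U` are undecided, and the remaining
ones are irrelevant. The set `Y` completes `X` to a solution. -/
structure IsSearchState (H : SimpleGraph ℕ) (k : ℕ) (A W U X Y : Finset ℕ) : Prop where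
  sub : Y ⊆ U
  degenerate : H.Degenerate ((W ∪ U) \ Y)
  card_le : X.card + Y.card ≤ k
  lift : ∀ Z ⊆ U, H.Degenerate ((W ∪ U) \ Z) → H.Degenerate (A \ (X ∪ Z))

namespace IsSearchState

/-- If `v` lies in the solution, trade it for its undecided neighbour, of which there is at most
one. The size does not grow, and the returned vertex retains at most one neighbour, in `W`, so no
cycle appears. -/
theorem exchange (h : IsSearchState H k A W U X Y)
    (hW : (H.nbrsIn W v).card ≤ 1) (hU : (H.nbrsIn U v).card ≤ 1) :
    ∃ Y', v ∉ Y' ∧ IsSearchState H k A W U X Y' := by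
  by_cases hvY : v ∈ Y
  · refine ⟨Y.erase v ∪ H.nbrsIn U v, by simp, ?_, ?_, ?_, h.lift⟩
    · exact union_subset ((erase_subset _ _).trans h.sub) (filter_subset _ _)
    · refine Degenerate.mono (A := insert v (((W ∪ U) \ Y) \ H.nbrsIn U v))
        (Degenerate.insert (h.degenerate.mono sdiff_subset) ?_) ?_
      · refine (card_le_card fun u hu => ?_).trans hW
        simp only [mem_nbrsIn, mem_sdiff, mem_union] at hu ⊢
        tauto
      · intro u hu
        simp only [mem_insert, mem_sdiff, mem_union, mem_erase] at hu ⊢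
        tauto
    · have h1 := card_union_le (Y.erase v) (H.nbrsIn U v)
      have h2 := card_erase_of_mem hvY
      have h3 : 0 < Y.card := card_pos.2 ⟨v, hvY⟩
      have := h.card_le
      omega
  · exact ⟨Y, hvY, h⟩

/-- Only the split between kept and undecided vertices changes, not their union. -/
theorem keep (h : IsSearchState H k A W U X Y) (hv : v ∈ U) (hvY : v ∉ Y) :
    IsSearchState H k A (insert v W) (U.erase v) X Y := by
  have he : insert v W ∪ U.erase v = W ∪ U := by
    ext u; simp only [mem_union, mem_insert, mem_erase]
    by_cases hu : u = v <;> simp [hu, hv]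
  refine ⟨fun u hu => mem_erase.2 ⟨fun h' => hvY (h' ▸ hu), h.sub hu⟩, ?_, h.card_le, ?_⟩
  · rw [he]; exact h.degenerate
  · intro Z hZ hd
    rw [he] at hd
    exact h.lift Z (hZ.trans (erase_subset _ _)) hd

/-- Having at most one neighbour in `W ∪ U`, the vertex lies on no cycle there, so it can be put
back after the rest is solved. -/
theorem drop (h : IsSearchState H k A W U X Y) (hvY : v ∉ Y)
    (hW : H.nbrsIn W v = ∅) (hU : (H.nbrsIn U v).card ≤ 1) :
    IsSearchState H k A W (U.erase v) X Y := by
  refine ⟨fun u hu => mem_erase.2 ⟨fun h' => hvY (h' ▸ hu), h.sub hu⟩,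
    h.degenerate.mono (sdiff_subset_sdiff (union_subset_union_right (erase_subset _ _))
      Subset.rfl), h.card_le, fun Z hZ hd => ?_⟩
  refine h.lift Z (hZ.trans (erase_subset _ _)) ?_
  refine Degenerate.mono (A := insert v ((W ∪ U.erase v) \ Z)) (hd.insert ?_) ?_
  · refine (card_le_card fun u hu => ?_).trans hU
    have hW' : u ∉ H.nbrsIn W v := by rw [hW]; exact notMem_empty u
    simp only [mem_nbrsIn, mem_sdiff, mem_union, mem_erase] at hu hW' ⊢
    tauto
  · intro u hu
    simp only [mem_insert, mem_sdiff, mem_union, mem_erase] at hu ⊢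
    tauto

theorem delete (h : IsSearchState H k A W U X Y) (hv : v ∈ Y) (hvW : v ∉ W) (hvX : v ∉ X) :
    IsSearchState H k A W (U.erase v) (insert v X) (Y.erase v) := by
  refine ⟨erase_subset_erase _ h.sub, h.degenerate.mono ?_, ?_, fun Z hZ hd => ?_⟩
  · intro u hu
    simp only [mem_sdiff, mem_union, mem_erase] at hu ⊢
    have : u ≠ v := by rintro rfl; simp [hvW] at hu
    tauto
  · have h2 := card_erase_of_mem hv
    have h3 : 0 < Y.card := card_pos.2 ⟨v, hv⟩
    have := h.card_le
    rw [card_insert_of_notMem hvX]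
    omega
  · have := h.lift (insert v Z) (insert_subset (h.sub hv) (hZ.trans (erase_subset _ _))) ?_
    · convert this using 2
      ext u; simp only [mem_union, mem_insert]; tauto
    · convert hd using 1
      ext u
      simp only [mem_sdiff, mem_union, mem_insert, mem_erase]
      have : u = v → u ∉ W := by rintro rfl; exact hvW
      tauto

end IsSearchState

/-! ### The search along an elimination order -/

/-- The number of kept neighbours of `v`. In a status array, `1` and `4` mean kept, `2` and `5`
mean deleted, `3` means irrelevant, and `4` and `5` are the results of guesses. -/
noncomputable def keptDegree (N : ℕ) (E : ℕ → ℕ → Prop) (st : ℕ → ℕ) (v : ℕ) : ℕ :=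
  ((range N).filter fun u => E v u ∧ (st u = 1 ∨ st u = 4)).card

/-- The number of guesses used so far. -/
def guessCount (N : ℕ) (st : ℕ → ℕ) : ℕ := ((range N).filter fun u => st u = 4 ∨ st u = 5).card

/-- The new status of the vertex `v`, with the guess bits `b`. -/
noncomputable def decideStatus (N : ℕ) (E : ℕ → ℕ → Prop) (b : ℕ → Prop) (st : ℕ → ℕ) (v : ℕ) :
    ℕ :=
  if keptDegree N E st v = 0 then 3 else if keptDegree N E st v = 1 then 1 else
    if b (guessCount N st) then 5 else 4

/-- Decide on the vertex that is removed in step `j` of the elimination. -/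
noncomputable def searchStep (N : ℕ) (E : ℕ → ℕ → Prop) (key : ℕ → ℕ) (b : ℕ → Prop) (j : ℕ)
    (st : ℕ → ℕ) (v : ℕ) : ℕ :=
  if key v = j + 2 then decideStatus N E b st v else st v

/-- The status array after `j` steps, if the vertices in `T` with `a` are deleted at the start and
the other vertices in `T` are kept. -/
noncomputable def search (N : ℕ) (E : ℕ → ℕ → Prop) (key : ℕ → ℕ) (T a b : ℕ → Prop) :
    ℕ → ℕ → ℕ :=
  arrIter N (fun v => if T v then if a v then 2 else 1 else 0) (searchStep N E key b)

/-- The kept vertices. -/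
def keptSet (N : ℕ) (st : ℕ → ℕ) : Finset ℕ := (range N).filter fun u => st u = 1 ∨ st u = 4

/-- The deleted vertices. -/
def deletedSet (N : ℕ) (st : ℕ → ℕ) : Finset ℕ := (range N).filter fun u => st u = 2 ∨ st u = 5

theorem card_nbrsIn_keptSet (N : ℕ) (st : ℕ → ℕ) (v : ℕ) :
    (H.nbrsIn (keptSet N st) v).card = keptDegree N H.Adj st v := by
  rw [nbrsIn, keptSet, filter_filter, keptDegree]
  congr 1; ext u; simp only [mem_filter]; tauto

section Update

variable {N x : ℕ} {st : ℕ → ℕ}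

theorem keptSet_update_of_kept (hv : v < N) (hx : x = 1 ∨ x = 4) :
    keptSet N (Function.update st v x) = insert v (keptSet N st) := by
  ext u
  by_cases h : u = v
  · subst h; simp [keptSet, hv, hx]
  · simp [keptSet, h]

theorem keptSet_update_of_not_kept (h0 : st v = 0) (hx : ¬(x = 1 ∨ x = 4)) :
    keptSet N (Function.update st v x) = keptSet N st := by
  ext u
  by_cases h : u = v
  · subst h; simp [keptSet, hx, h0]
  · simp [keptSet, h]

theorem deletedSet_update_of_deleted (hv : v < N) (hx : x = 2 ∨ x = 5) :
    deletedSet N (Function.update st v x) = insert v (deletedSet N st) := by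
  ext u
  by_cases h : u = v
  · subst h; simp [deletedSet, hv, hx]
  · simp [deletedSet, h]

theorem deletedSet_update_of_not_deleted (h0 : st v = 0) (hx : ¬(x = 2 ∨ x = 5)) :
    deletedSet N (Function.update st v x) = deletedSet N st := by
  ext u
  by_cases h : u = v
  · subst h; simp [deletedSet, hx, h0]
  · simp [deletedSet, h]

theorem card_filter_update {p : ℕ → Prop} [DecidablePred p] (hv : v < N) (h0 : ¬ p (st v)) :
    ((range N).filter fun u => p (Function.update st v x u)).card =
      ((range N).filter fun u => p (st u)).card + if p x then 1 else 0 := by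
  have h : ∀ u, u ≠ v → Function.update st v x u = st u := fun u hu => Function.update_of_ne hu _ _
  split_ifs with hx
  · rw [← card_insert_of_notMem (a := v) (by simp [h0])]
    congr 1; ext u
    by_cases huv : u = v
    · subst huv; simp [hv, hx]
    · simp [huv]
  · rw [add_zero]
    congr 1; ext u
    by_cases huv : u = v
    · subst huv; simp [hx, h0]
    · simp [h u huv]

end Update

section Search

variable {N : ℕ} {E : ℕ → ℕ → Prop} {key : ℕ → ℕ} {T a b : ℕ → Prop}

/-- Removal times are injective, so each step decides at most one vertex. -/
theorem search_step (hinj : ∀ u v, 2 ≤ key u → key u = key v → u = v) (j : ℕ) :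
    ((∀ v < N, key v ≠ j + 2) ∧ search N E key T a b (j + 1) = search N E key T a b j) ∨
    ∃ v < N, key v = j + 2 ∧ search N E key T a b (j + 1) =
      Function.update (search N E key T a b j) v
        (decideStatus N E b (search N E key T a b j) v) := by
  have hs : search N E key T a b (j + 1) =
    tab N (searchStep N E key b j (search N E key T a b j)) := rfl
  have hN : ∀ i, N ≤ i → search N E key T a b j i = 0 := fun i hi => arrIter_of_le _ _ j hi
  rw [hs]
  by_cases h : ∃ v < N, key v = j + 2
  · obtain ⟨v, hv, hk⟩ := h
    refine .inr ⟨v, hv, hk, funext fun i => ?_⟩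
    by_cases hi : i < N
    · rw [tab_of_lt _ hi, searchStep]
      by_cases hiv : i = v
      · subst hiv; simp [hk]
      · rw [if_neg fun hk' => hiv (hinj i v (by omega) (by omega)), Function.update_of_ne hiv]
    · have : i ≠ v := by omega
      simp [tab, hi, this, hN i (by omega)]
  · push Not at h
    refine .inl ⟨h, funext fun i => ?_⟩
    by_cases hi : i < N
    · rw [tab_of_lt _ hi, searchStep, if_neg (h i hi)]
    · simp [tab, hi, hN i (by omega)]

theorem search_of_le_key (j : ℕ) (hv : j + 2 ≤ key v) (hT : ¬ T v) :
    search N E key T a b j v = 0 := by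
  induction j with
  | zero => simp [search, arrIter, tab, hT]
  | succ j ih =>
    have hs : search N E key T a b (j + 1) =
      tab N (searchStep N E key b j (search N E key T a b j)) := rfl
    rw [hs, tab]
    split_ifs
    · rw [searchStep, if_neg (by omega), ih (by omega)]
    · rfl

theorem mem_of_search_ne_zero (j : ℕ) (hv : search N E key T a b j v ≠ 0) :
    v < N ∧ (T v ∨ 2 ≤ key v) := by
  induction j with
  | zero =>
    simp only [search, arrIter, tab] at hv
    split_ifs at hv <;> simp_all
  | succ j ih =>
    have hs : search N E key T a b (j + 1) =
      tab N (searchStep N E key b j (search N E key T a b j)) := rfl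
    rw [hs, tab] at hv
    split_ifs at hv with h
    · rw [searchStep] at hv
      split_ifs at hv with h'
      · exact ⟨h, .inr (by omega)⟩
      · exact ih hv
    · exact absurd rfl hv

theorem guessCount_search_step (hinj : ∀ u v, 2 ≤ key u → key u = key v → u = v)
    (hT : ∀ v, 2 ≤ key v → ¬ T v) (j : ℕ) :
    guessCount N (search N E key T a b j) ≤ guessCount N (search N E key T a b (j + 1)) := by
  rcases search_step (N := N) (E := E) (T := T) (a := a) (b := b) hinj j with
    ⟨-, h⟩ | ⟨v, hv, hk, h⟩
  · rw [h]
  · rw [h, guessCount, guessCount, card_filter_update (p := fun x => x = 4 ∨ x = 5) hv]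
    · omega
    · rw [search_of_le_key j hk.ge (hT v (by omega))]; omega

/-- The search depends only on the guess bits that are used. -/
theorem search_congr (hinj : ∀ u v, 2 ≤ key u → key u = key v → u = v)
    (hT : ∀ v, 2 ≤ key v → ¬ T v) {b' : ℕ → Prop} (j : ℕ)
    (h : ∀ c < guessCount N (search N E key T a b j), b c ↔ b' c) :
    search N E key T a b' j = search N E key T a b j := by
  induction j with
  | zero => rfl
  | succ j ih =>
    have hm := guessCount_search_step (N := N) (E := E) (a := a) (b := b) hinj hT j
    have ih := ih fun c hc => h c (hc.trans_le hm)
    have hs : ∀ b, search N E key T a b (j + 1) =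
      tab N (searchStep N E key b j (search N E key T a b j)) := fun _ => rfl
    rw [hs, hs, ih]
    funext i
    by_cases hi : i < N
    · rw [tab_of_lt _ hi, tab_of_lt _ hi, searchStep, searchStep]
      split_ifs with hk
      · rw [decideStatus, decideStatus]
        split_ifs with h1 h2 h3 h4 h4
        any_goals rfl
        all_goals
          -- The branches can differ only in the bit indexed by the current guess count. Using it
          -- raises the count, so this bit is among those on which the two sequences agree.
          exfalso
          have hc : guessCount N (search N E key T a b j) <
              guessCount N (search N E key T a b (j + 1)) := by
            rcases search_step (N := N) (E := E) (T := T) (a := a) (b := b) hinj j with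
              ⟨h', -⟩ | ⟨v, hv, hkv, h'⟩
            · exact absurd hk (h' i hi)
            · have hvi : v = i := hinj v i (by omega) (by omega)
              subst hvi
              rw [h', guessCount, guessCount, card_filter_update (p := fun x => x = 4 ∨ x = 5) hv,
                if_pos]
              · omega
              · rw [decideStatus, if_neg h1, if_neg h2]
                split_ifs
                simp
              · rw [search_of_le_key j hkv.ge (hT v (by omega))]; omega
          have := h _ hc
          tauto
      · rfl
    · simp [tab, hi]

end Search

/-- A feedback vertex set of size at most `k` can be found by a search with suitable guesses. -/
theorem exists_search {N : ℕ} {key : ℕ → ℕ} {R S X₀ : Finset ℕ} (hel : IsElimination H R N key)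
    (hkey : ∀ v ∈ R, 2 ≤ key v) (hRS : Disjoint S R) (hRN : R ⊆ range N) (hSN : S ⊆ range N)
    (hcard : X₀.card ≤ k) (hd : H.Degenerate ((S ∪ R) \ X₀)) :
    ∃ b, (deletedSet N (search N H.Adj key (· ∈ S) (· ∈ X₀) b N)).card ≤ k ∧
      H.Degenerate ((S ∪ R) \ deletedSet N (search N H.Adj key (· ∈ S) (· ∈ X₀) b N)) ∧
      guessCount N (search N H.Adj key (· ∈ S) (· ∈ X₀) b N) ≤ k + S.card := by
  have hT : ∀ v, 2 ≤ key v → ¬ v ∈ S := fun v hv hvS =>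
    Finset.disjoint_left.1 hRS hvS (hel.mem v hv)
  -- The inequality is the potential that bounds guessed keeps. At the start the kept vertices are
  -- part of `S`. Keeping a vertex with one kept neighbour adds 2 to both sides; a guessed keep adds
  -- 4 on the left and, having at least two kept neighbours, at least 4 on the right.
  have main : ∀ j, ∃ b Y, IsSearchState H k (S ∪ R)
      (keptSet N (search N H.Adj key (· ∈ S) (· ∈ X₀) b j)) (R.filter fun v => j + 2 ≤ key v)
      (deletedSet N (search N H.Adj key (· ∈ S) (· ∈ X₀) b j)) Y ∧
      2 * (keptSet N (search N H.Adj key (· ∈ S) (· ∈ X₀) b j)).card +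
      2 * ((range N).filter fun u => search N H.Adj key (· ∈ S) (· ∈ X₀) b j u = 4).card ≤
      H.degSum (keptSet N (search N H.Adj key (· ∈ S) (· ∈ X₀) b j)) + 2 * S.card := by
    intro j
    induction j with
    | zero =>
      have hst : ∀ v, search N H.Adj key (· ∈ S) (· ∈ X₀) (fun _ => True) 0 v =
          if v ∈ S then if v ∈ X₀ then 2 else 1 else 0 := by
        intro v
        simp only [search, arrIter, tab]
        by_cases hv : v ∈ S
        · by_cases hx : v ∈ X₀ <;> simp [hv, hx, mem_range.1 (hSN hv)]
        · simp [hv]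
      have hW : keptSet N (search N H.Adj key (· ∈ S) (· ∈ X₀) (fun _ => True) 0) = S \ X₀ := by
        ext v
        simp only [keptSet, mem_filter, mem_range, mem_sdiff, hst]
        by_cases hv : v ∈ S
        · by_cases hx : v ∈ X₀ <;> simp [hv, hx, mem_range.1 (hSN hv)]
        · simp [hv]
      have hX : deletedSet N (search N H.Adj key (· ∈ S) (· ∈ X₀) (fun _ => True) 0) = S ∩ X₀ := by
        ext v
        simp only [deletedSet, mem_filter, mem_range, mem_inter, hst]
        by_cases hv : v ∈ S
        · by_cases hx : v ∈ X₀ <;> simp [hv, hx, mem_range.1 (hSN hv)]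
        · simp [hv]
      have hU : (R.filter fun v => 0 + 2 ≤ key v) = R :=
        filter_true_of_mem fun v hv => by simpa using hkey v hv
      have h4 : ((range N).filter fun u =>
          search N H.Adj key (· ∈ S) (· ∈ X₀) (fun _ => True) 0 u = 4) = ∅ := by
        refine filter_eq_empty_iff.2 fun v _ => ?_
        rw [hst]
        split_ifs <;> simp
      refine ⟨fun _ => True, R ∩ X₀, ?_, ?_⟩
      · rw [hW, hX, hU]
        refine ⟨inter_subset_left, hd.mono ?_, ?_, fun Z hZ hZd => hZd.mono ?_⟩
        · intro u; simp only [mem_sdiff, mem_union, mem_inter]; tauto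
        · rw [← card_union_of_disjoint]
          · refine (card_le_card ?_).trans hcard
            exact union_subset inter_subset_right inter_subset_right
          · exact hRS.mono inter_subset_left inter_subset_left
        · intro u; simp only [mem_sdiff, mem_union, mem_inter]; tauto
      · rw [hW, h4]
        have := card_le_card (sdiff_subset : S \ X₀ ⊆ S)
        simp only [card_empty]
        omega
    | succ j ih =>
      obtain ⟨b, Y, hst, hpot⟩ := ih
      have hcases := fun b => search_step (N := N) (E := H.Adj) (T := (· ∈ S)) (a := (· ∈ X₀))
        (b := b) hel.inj j
      have hcong := fun b' => search_congr (N := N) (E := H.Adj) (T := (· ∈ S)) (a := (· ∈ X₀))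
        (b := b) (b' := b') hel.inj hT j
      by_cases hex : ∃ v < N, key v = j + 2
      swap
      · push Not at hex
        rcases hcases b with ⟨-, h⟩ | ⟨v, hv, hk, -⟩
        · refine ⟨b, Y, ?_, ?_⟩
          · rw [h]
            convert hst using 1
            refine filter_congr fun v hv => ?_
            have := hex v (mem_range.1 (hRN hv))
            omega
          · rw [h]; exact hpot
        · exact absurd hk (hex v hv)
      obtain ⟨v, hv, hk⟩ := hex
      have hvR : v ∈ R := hel.mem v (by omega)
      have hvS : v ∉ S := hT v (by omega)
      have hstep : ∀ b', search N H.Adj key (· ∈ S) (· ∈ X₀) b' (j + 1) =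
          Function.update (search N H.Adj key (· ∈ S) (· ∈ X₀) b' j) v
          (decideStatus N H.Adj b' (search N H.Adj key (· ∈ S) (· ∈ X₀) b' j) v) := by
        intro b'
        rcases hcases b' with ⟨h, -⟩ | ⟨w, hw, hkw, h⟩
        · exact absurd hk (h v hv)
        · rw [hel.inj v w (by omega) (by omega)]; exact h
      have h0 : search N H.Adj key (· ∈ S) (· ∈ X₀) b j v = 0 :=
        search_of_le_key j hk.ge hvS
      generalize hs : search N H.Adj key (· ∈ S) (· ∈ X₀) b j = st at *
      have hU' : (R.filter fun v => j + 1 + 2 ≤ key v) =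
          (R.filter fun v => j + 2 ≤ key v).erase v := by
        ext u
        simp only [mem_filter, mem_erase]
        constructor
        · rintro ⟨h1, h2⟩
          exact ⟨by rintro rfl; omega, h1, by omega⟩
        · rintro ⟨h1, h2, h3⟩
          have : key u ≠ key v := fun h' => h1 (hel.inj u v (by omega) h')
          exact ⟨h2, by omega⟩
      have hvU : v ∈ R.filter fun v => j + 2 ≤ key v := mem_filter.2 ⟨hvR, hk.ge⟩
      have hnU : (H.nbrsIn (R.filter fun v => j + 2 ≤ key v) v).card ≤ 1 := by
        refine (card_le_card fun u hu => ?_).trans (hel.nbrs v (by omega))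
        simp only [mem_nbrsIn, mem_filter] at hu ⊢
        have : key v ≠ key u := fun h' => hu.2.ne (hel.inj v u (by omega) h')
        exact ⟨hu.1.1, hu.2, .inr (by omega)⟩
      have hvW : v ∉ keptSet N st := by simp [keptSet, h0]
      have hvX : v ∉ deletedSet N st := by simp [deletedSet, h0]
      have hdegW := card_nbrsIn_keptSet (H := H) N st v
      have hcard4 := fun x => card_filter_update (N := N) (v := v) (x := x) (st := st)
        (p := (· = 4)) hv (by omega)
      rw [hU']
      by_cases hd0 : keptDegree N H.Adj st v = 0
      · obtain ⟨Y', hvY', hst'⟩ := hst.exchange (by omega) hnU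
        have hW0 : H.nbrsIn (keptSet N st) v = ∅ := by rw [← card_eq_zero]; omega
        refine ⟨b, Y', ?_⟩
        rw [hstep b, hs, decideStatus, if_pos hd0, keptSet_update_of_not_kept h0 (by omega),
          deletedSet_update_of_not_deleted h0 (by omega), hcard4]
        exact ⟨hst'.drop hvY' hW0 hnU, by simpa using hpot⟩
      by_cases hd1 : keptDegree N H.Adj st v = 1
      · obtain ⟨Y', hvY', hst'⟩ := hst.exchange (by omega) hnU
        refine ⟨b, Y', ?_⟩
        rw [hstep b, hs, decideStatus, if_neg hd0, if_pos hd1,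
          keptSet_update_of_kept hv (by omega),
          deletedSet_update_of_not_deleted h0 (by omega), hcard4]
        refine ⟨hst'.keep hvU hvY', ?_⟩
        rw [degSum_insert hvW, card_insert_of_notMem hvW, hdegW, hd1]
        simp only [OfNat.one_ne_ofNat, if_false]
        omega
      -- The next guess bit has not been read yet, so it can be set as `Y` dictates without
      -- disturbing the earlier steps.
      have hb' : ∀ q : Prop, search N H.Adj key (· ∈ S) (· ∈ X₀)
          (Function.update b (guessCount N st) q) j = st := by
        intro q
        refine hcong _ fun c hc => ?_
        rw [Function.update_of_ne hc.ne]
      by_cases hvY : v ∈ Y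
      · refine ⟨Function.update b (guessCount N st) True, Y.erase v, ?_⟩
        rw [hstep _, hb', decideStatus, if_neg hd0, if_neg hd1, Function.update_self,
          if_pos trivial, keptSet_update_of_not_kept h0 (by omega),
          deletedSet_update_of_deleted hv (by omega), hcard4]
        exact ⟨hst.delete hvY hvW hvX, by simpa using hpot⟩
      · refine ⟨Function.update b (guessCount N st) False, Y, ?_⟩
        rw [hstep _, hb', decideStatus, if_neg hd0, if_neg hd1, Function.update_self,
          if_neg id, keptSet_update_of_kept hv (by omega),
          deletedSet_update_of_not_deleted h0 (by omega), hcard4]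
        refine ⟨hst.keep hvU hvY, ?_⟩
        rw [degSum_insert hvW, card_insert_of_notMem hvW, hdegW, if_pos rfl]
        omega
  obtain ⟨b, Y, hst, hpot⟩ := main N
  have hU : (R.filter fun v => N + 2 ≤ key v) = ∅ :=
    filter_eq_empty_iff.2 fun v _ => by have := hel.le v; omega
  rw [hU] at hst
  have hY : Y = ∅ := subset_empty.1 hst.sub
  subst hY
  have h1 := hst.degenerate
  have h2 := hst.lift ∅ (Subset.refl _) h1
  have h3 := hst.card_le
  rw [card_empty, add_zero] at h3
  rw [union_empty] at h2
  rw [union_empty, sdiff_empty] at h1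
  refine ⟨b, h3, h2, ?_⟩
  -- At the end the kept set is a forest, so the potential leaves at most `S.card` guessed keeps;
  -- guessed deletions are among the at most `k` deleted vertices.
  have h4 := h1.degSum_le
  have h5 : guessCount N (search N H.Adj key (· ∈ S) (· ∈ X₀) b N) ≤
      ((range N).filter fun u => search N H.Adj key (· ∈ S) (· ∈ X₀) b N u = 4).card +
      (deletedSet N (search N H.Adj key (· ∈ S) (· ∈ X₀) b N)).card := by
    refine (card_le_card fun u hu => ?_).trans (card_union_le _ _)
    simp only [deletedSet, mem_filter, mem_union] at hu ⊢
    tauto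
  omega

end SimpleGraph

/-! ### Least witnesses and ranks. -/

namespace RAM

open Classical

/-- The smallest `i < N` with the property `P`, if there is one. -/
noncomputable def leastN (N : ℕ) (P : ℕ → Prop) : ℕ :=
  ((range N).filter fun i => ∀ j < N, j ≤ i → ¬ P j).card

theorem leastN_spec {N : ℕ} {P : ℕ → Prop} (h : ∃ i < N, P i) :
    leastN N P < N ∧ P (leastN N P) := by
  obtain ⟨h1, h2⟩ := Nat.find_spec h
  have : leastN N P = Nat.find h := by
    rw [leastN, show ((range N).filter fun i => ∀ j < N, j ≤ i → ¬ P j) = range (Nat.find h)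
      from ?_, card_range]
    ext i
    simp only [mem_filter, mem_range]
    constructor
    · rintro ⟨-, h3⟩
      by_contra hi
      exact h3 _ h1 (by omega) h2
    · intro hi
      exact ⟨by omega, fun j hj hji hP => Nat.find_min h (by omega) ⟨hj, hP⟩⟩
  rw [this]
  exact ⟨h1, h2⟩

theorem Comp.leastN {Γ : Type} [Ctx Γ] {P : Γ → ℕ → Prop} (hP : CompS P) :
    Comp (fun γ => leastN (Ctx.fuel γ) (P γ)) :=
  Comp.count (P := fun γ i => ∀ j < Ctx.fuel γ, j ≤ i → ¬ P γ j)
    (CompP.forall_lt (Γ := Γ × ℕ) (P := fun x j => j ≤ x.2 → ¬ P x.1 j)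
      (.imp (.le .var Comp.var.lift) (.not (hP.lift.lift.app .var))))

/-- The position of `v` in the set `T`. -/
noncomputable def rankN (N : ℕ) (T : ℕ → Prop) (v : ℕ) : ℕ :=
  ((range N).filter fun u => u < v ∧ T u).card

theorem Comp.rankN {Γ : Type} [Ctx Γ] {T : Γ → ℕ → Prop} {v : Γ → ℕ} (hT : CompS T)
    (hv : Comp v) : Comp (fun γ => rankN (Ctx.fuel γ) (T γ) (v γ)) :=
  Comp.count (P := fun γ u => u < v γ ∧ T γ u) (.and (.lt .var hv.lift) hT)

theorem rankN_lt {N v : ℕ} {T : ℕ → Prop} {A : Finset ℕ} (hA : ∀ u, u ∈ A ↔ u < N ∧ T u)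
    (hv : v ∈ A) : rankN N T v < A.card := by
  refine card_lt_card ((ssubset_iff_of_subset fun u hu => ?_).2 ⟨v, hv, by simp⟩)
  simp only [mem_filter, mem_range] at hu
  exact (hA u).2 ⟨hu.1, hu.2.2⟩

theorem rankN_lt_rankN {N u v : ℕ} {T : ℕ → Prop} (hu : u < N ∧ T u) (h : u < v) :
    rankN N T u < rankN N T v := by
  refine card_lt_card ((ssubset_iff_of_subset fun w hw => ?_).2 ⟨u, ?_, ?_⟩)
  · simp only [mem_filter, mem_range] at hw ⊢
    exact ⟨hw.1, by omega, hw.2.2⟩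
  · simp [hu, h]
  · simp

theorem rankN_injOn {N u v : ℕ} {T : ℕ → Prop} (hu : u < N ∧ T u) (hv : v < N ∧ T v)
    (h : rankN N T u = rankN N T v) : u = v := by
  rcases lt_trichotomy u v with hlt | heq | hlt
  · exact absurd h (rankN_lt_rankN hu hlt).ne
  · exact heq
  · exact absurd h (rankN_lt_rankN hv hlt).ne'

end RAM

/-! ### Iterative compression. -/

namespace SimpleGraph

open Classical

/-- Numbers outside the set start with key 1, so the test may range over all numbers below the fuel.
-/
theorem elimKeys_ne_zero_iff' (H : SimpleGraph ℕ) {A : Finset ℕ} {N : ℕ} {U : ℕ → Prop}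
    (hA : ∀ v, v ∈ A ↔ v < N ∧ U v) :
    (∀ v < N, elimKeys N H.Adj U N v ≠ 0) ↔ H.Degenerate A := by
  rw [← elimKeys_ne_zero_iff H hA]
  constructor
  · exact fun h v hv => h v ((hA v).1 hv).1
  · exact fun h v hv h0 => h v ((hA v).2 ⟨hv, elimKeys_zero N v hv h0⟩) h0

/-- The search in the graph on the vertices up to `i`, with the guesses encoded by `g`, given a
feedback vertex set `S` of the graph on the vertices below `i`. -/
noncomputable def compressSearch (N : ℕ) (E : ℕ → ℕ → Prop) (k i : ℕ) (S : ℕ → ℕ) (g : ℕ) :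
    ℕ → ℕ :=
  search N E (elimKeys N E (fun v => v < i ∧ S v = 0) N) (fun v => v = i ∨ S v ≠ 0)
    -- Bits `0` to `k` of `g` tell which vertices of the old solution are deleted, indexed by rank;
    -- the bits from `k + 1` on answer the later guesses.
    (fun v => digN N 2 g (rankN N (fun v => v = i ∨ S v ≠ 0) v) ≠ 0)
    (fun c => digN N 2 g (k + 1 + c) ≠ 0) N

/-- The search finds a feedback vertex set of size at most `k`. -/
def CompressSucceeds (N : ℕ) (E : ℕ → ℕ → Prop) (k i : ℕ) (S : ℕ → ℕ) (g : ℕ) : Prop :=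
  ((range N).filter fun u =>
    compressSearch N E k i S g u = 2 ∨ compressSearch N E k i S g u = 5).card ≤ k ∧
  ∀ v < N, elimKeys N E (fun v => v < i + 1 ∧
    ¬ (compressSearch N E k i S g v = 2 ∨ compressSearch N E k i S g v = 5)) N v ≠ 0

/-- One step of iterative compression. -/
noncomputable def compressStep (N : ℕ) (E : ℕ → ℕ → Prop) (n k i : ℕ) (S : ℕ → ℕ) (v : ℕ) : ℕ :=
  -- The iteration takes as many steps as there is fuel; those beyond the last vertex must do
  -- nothing.
  if i < n then
    if compressSearch N E k i S (leastN N (CompressSucceeds N E k i S)) v = 2 ∨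
      compressSearch N E k i S (leastN N (CompressSucceeds N E k i S)) v = 5 then 1 else 0
  else S v

/-- Finding a feedback vertex set of size at most `k` by iterative compression. -/
noncomputable def findFVS (N : ℕ) (E : ℕ → ℕ → Prop) (n k : ℕ) : ℕ → ℕ → ℕ :=
  arrIter N (fun _ => 0) (compressStep N E n k)

theorem findFVS_succ (N : ℕ) (E : ℕ → ℕ → Prop) (n k i : ℕ) :
    findFVS N E n k (i + 1) = tab N (compressStep N E n k i (findFVS N E n k i)) := rfl

/-- The old solution with the new vertex `i` has at most `k + 1` elements. Hence `k + 1` bits for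
these and at most `k + (k + 1)` guess bits suffice, which explains the bound `2 ^ (3 * k + 2)`. -/
theorem exists_compressSucceeds (H : SimpleGraph ℕ) {N k i : ℕ} {S : ℕ → ℕ} {T X₀ : Finset ℕ}
    (hiN : i < N) (hk : 2 ^ (3 * k + 2) ≤ N) (hT : ∀ v, v ∈ T ↔ v < i ∧ S v ≠ 0)
    (hS : ∀ v, S v ≠ 0 → v < i) (hTk : T.card ≤ k) (hTd : H.Degenerate (range i \ T))
    (hX₀ : X₀.card ≤ k) (hd : H.Degenerate (range (i + 1) \ X₀)) :
    ∃ g < N, CompressSucceeds N H.Adj k i S g := by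
  have hR : ∀ v, v ∈ range i \ T ↔ v < N ∧ (v < i ∧ S v = 0) := by
    intro v
    simp only [mem_sdiff, mem_range, hT]
    constructor
    · rintro ⟨h1, h2⟩; exact ⟨by omega, h1, by by_contra h; exact h2 ⟨h1, h⟩⟩
    · rintro ⟨-, h1, h2⟩; exact ⟨h1, fun h => h.2 h2⟩
  have hT' : ∀ v, v ∈ insert i T ↔ v < N ∧ (v = i ∨ S v ≠ 0) := by
    intro v
    simp only [mem_insert, hT]
    constructor
    · rintro (rfl | h)
      · exact ⟨hiN, .inl rfl⟩
      · exact ⟨by omega, .inr h.2⟩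
    · rintro ⟨-, h | h⟩
      · exact .inl h
      · exact .inr ⟨hS v h, h⟩
  have hel := isElimination_elimKeys H hR N
  have hne := (elimKeys_ne_zero_iff H hR).2 hTd
  have hiT : i ∉ T := by simp [hT]
  have hun : insert i T ∪ (range i \ T) = range (i + 1) := by
    ext v
    simp only [mem_union, mem_insert, mem_sdiff, mem_range, hT]
    by_cases hvi : v = i
    · simp [hvi]
    · constructor
      · rintro ((h | h) | h) <;> omega
      · intro h
        have : v < i := by omega
        tauto
  obtain ⟨b, h1, h2, h3⟩ := exists_search (N := N) (S := insert i T) hel (X₀ := X₀) (k := k)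
    (fun v hv => by have := hne v hv; have := hel.ne_one v hv; omega)
    (by
      rw [Finset.disjoint_left]
      intro v hv hv'
      rw [mem_sdiff, mem_range] at hv'
      rcases mem_insert.1 hv with h | h
      · omega
      · exact hv'.2 h)
    (fun v hv => mem_range.2 ((hR v).1 hv).1) (fun v hv => mem_range.2 ((hT' v).1 hv).1)
    hX₀ (by rw [hun]; exact hd)
  have hcT : (insert i T).card ≤ k + 1 := (card_insert_le _ _).trans (by omega)
  have hLN : 3 * k + 2 < N := Nat.lt_two_pow_self.trans_le hk
  obtain ⟨g, hg, hdig⟩ := exists_digits (b := 2) (L := 3 * k + 2) (fun c =>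
    if c < k + 1 then
      if ∃ v ∈ insert i T, rankN N (fun v => v = i ∨ S v ≠ 0) v = c ∧ v ∈ X₀ then 1 else 0
    else if b (c - (k + 1)) then 1 else 0) (fun c _ => by split_ifs <;> simp)
  have hgN : g < N := hg.trans_le hk
  have hbit : ∀ c < 3 * k + 2, digN N 2 g c = _ := fun c hc =>
    (digN_eq hgN (by omega) (by omega)).trans (hdig c hc)
  have hmem : ∀ v, (v = i ∨ S v ≠ 0) ↔ v ∈ insert i T := by
    intro v
    rw [hT']
    constructor
    · rintro (h | h)
      · exact ⟨by omega, .inl h⟩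
      · exact ⟨by have := hS v h; omega, .inr h⟩
    · exact fun h => h.2
  have hsearch : compressSearch N H.Adj k i S g = search N H.Adj
      (elimKeys N H.Adj (fun v => v < i ∧ S v = 0) N) (· ∈ insert i T) (· ∈ X₀) b N := by
    -- Only the bits of `b` that are read are stored in `g`; the remaining ones do not influence the
    -- search.
    rw [← search_congr (b := b) (b' := fun c => digN N 2 g (k + 1 + c) ≠ 0) hel.inj ?_ N ?_]
    · rw [compressSearch, search, search]
      congr 1
      funext v
      by_cases hv : v ∈ insert i T
      · rw [if_pos ((hmem v).2 hv), if_pos hv, hbit _ (by have := rankN_lt hT' hv; omega),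
          if_pos ((rankN_lt hT' hv).trans_le hcT)]
        by_cases hx : v ∈ X₀
        · have hex : ∃ u ∈ insert i T, rankN N (fun v => v = i ∨ S v ≠ 0) u =
              rankN N (fun v => v = i ∨ S v ≠ 0) v ∧ u ∈ X₀ := ⟨v, hv, rfl, hx⟩
          rw [if_pos hx, if_pos hex, if_pos one_ne_zero]
        · have hex : ¬ ∃ u ∈ insert i T, rankN N (fun v => v = i ∨ S v ≠ 0) u =
              rankN N (fun v => v = i ∨ S v ≠ 0) v ∧ u ∈ X₀ := by
            rintro ⟨u, hu, hr, hux⟩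
            exact hx (rankN_injOn ((hT' u).1 hu) ((hT' v).1 hv) hr ▸ hux)
          rw [if_neg hx, if_neg hex, if_neg (not_not.2 rfl)]
      · rw [if_neg fun h => hv ((hmem v).1 h), if_neg hv]
    · intro v hv hvT
      have := hel.mem v hv
      rw [mem_sdiff, mem_range] at this
      rcases mem_insert.1 hvT with h | h
      · omega
      · exact this.2 h
    · intro c hc
      rw [hbit _ (by omega), if_neg (by omega), show k + 1 + c - (k + 1) = c by omega]
      by_cases h : b c <;> simp [h]
  refine ⟨g, hgN, ?_, ?_⟩
  · rw [hsearch]; exact h1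
  · rw [hsearch, elimKeys_ne_zero_iff' H (A := range (i + 1) \ _)]
    · rw [hun] at h2; exact h2
    · intro v
      simp only [mem_sdiff, deletedSet, mem_filter, mem_range]
      constructor
      · rintro ⟨h4, h5⟩
        exact ⟨by omega, h4, fun h => h5 ⟨by omega, h⟩⟩
      · rintro ⟨h4, h5, h6⟩
        exact ⟨h5, fun h => h6 h.2⟩

/-- A solution `X₀` for all vertices also solves every prefix, so each compression succeeds with
some guess and the least successful guess maintains the invariant. -/
theorem findFVS_spec (H : SimpleGraph ℕ) {N n k : ℕ} {X₀ : Finset ℕ} (hnN : n ≤ N)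
    (hk : 2 ^ (3 * k + 2) ≤ N) (hX₀ : X₀.card ≤ k) (hd : H.Degenerate (range n \ X₀)) {i : ℕ}
    (hi : i ≤ n) : (∀ v, findFVS N H.Adj n k i v ≠ 0 → v < i) ∧
      ((range i).filter fun v => findFVS N H.Adj n k i v ≠ 0).card ≤ k ∧
      H.Degenerate (range i \ (range i).filter fun v => findFVS N H.Adj n k i v ≠ 0) := by
  induction i with
  | zero =>
    refine ⟨fun v hv => absurd ?_ hv, by simp, fun B hB hne => ?_⟩
    · simp [findFVS, arrIter, tab]
    · simp at hB; simp [hB] at hne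
  | succ i ih =>
    obtain ⟨h1, h2, h3⟩ := ih (by omega)
    have hex := exists_compressSucceeds H (N := N) (k := k) (i := i) (S := findFVS N H.Adj n k i)
      (X₀ := X₀) (by omega) hk (fun v => by rw [mem_filter, mem_range]) h1 h2 h3 hX₀
      (hd.mono (sdiff_subset_sdiff (range_subset_range.2 hi) Subset.rfl))
    obtain ⟨-, h4, h5⟩ := leastN_spec hex
    generalize hg : leastN N (CompressSucceeds N H.Adj k i (findFVS N H.Adj n k i)) = g at h4 h5
    have hval : ∀ v, findFVS N H.Adj n k (i + 1) v ≠ 0 ↔ v < N ∧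
        (compressSearch N H.Adj k i (findFVS N H.Adj n k i) g v = 2 ∨
        compressSearch N H.Adj k i (findFVS N H.Adj n k i) g v = 5) := by
      intro v
      rw [findFVS_succ, tab]
      by_cases hv : v < N
      · rw [if_pos hv, compressStep, if_pos (by omega), hg]
        simp only [ne_eq, ite_eq_right_iff, one_ne_zero, hv, true_and]
        tauto
      · simp [hv]
    have hlt : ∀ v, findFVS N H.Adj n k (i + 1) v ≠ 0 → v < i + 1 := by
      intro v hv
      have hv' := ((hval v).1 hv).2
      have hne : compressSearch N H.Adj k i (findFVS N H.Adj n k i) g v ≠ 0 := by omega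
      obtain ⟨hvN, h6⟩ := mem_of_search_ne_zero _ hne
      rcases h6 with (h6 | h6) | h6
      · omega
      · have := h1 v h6; omega
      · have hR : ∀ v, v ∈ (range N).filter (fun v => v < i ∧ findFVS N H.Adj n k i v = 0) ↔
            v < N ∧ (v < i ∧ findFVS N H.Adj n k i v = 0) := fun v => by
          rw [mem_filter, mem_range]
        have := ((hR v).1 ((isElimination_elimKeys H hR N).mem v h6)).2.1
        omega
    refine ⟨hlt, (card_le_card fun v hv => ?_).trans h4, ?_⟩
    · have := (hval v).1 (mem_filter.1 hv).2
      exact mem_filter.2 ⟨mem_range.2 this.1, this.2⟩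
    · refine (elimKeys_ne_zero_iff' H fun v => ?_).1 h5
      simp only [mem_sdiff, mem_filter, mem_range, hval]
      constructor
      · rintro ⟨h6, h7⟩
        exact ⟨by omega, h6, fun h => h7 ⟨h6, by omega, h⟩⟩
      · rintro ⟨h6, h7, h8⟩
        exact ⟨h7, fun h => h8 h.2.2⟩

end SimpleGraph

/-! ### Computability of the search and of iterative compression. -/

namespace RAM

open SimpleGraph Classical

variable {Γ : Type} [Ctx Γ]

theorem compA_search {E : Γ → ℕ → ℕ → Prop} {key : Γ → ℕ → ℕ} {T a b : Γ → ℕ → Prop}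
    (hE : CompR E) (hk : CompA key) (hT : CompS T) (ha : CompS a) (hb : CompS b) :
    CompA (fun γ => search (Ctx.fuel γ) (E γ) (key γ) (T γ) (a γ) (b γ) (Ctx.fuel γ)) := by
  have hinit : Comp (fun x : (Γ × ℕ) × ℕ => if T x.1.1 x.2 then if a x.1.1 x.2 then 2 else 1
      else 0) :=
    .ite hT.lift (.ite ha.lift (.const 2) (.const 1)) (.const 0)
  have hst : ∀ m, CompS (fun (x : ((Γ × ℕ) × ℕ) × (ℕ → ℕ)) u => x.2 u = m) := fun m =>
    .eq (CompA.var.lift.app .var) (.const m)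
  have hguess : CompS (fun (x : ((Γ × ℕ) × ℕ) × (ℕ → ℕ)) u => x.2 u = 4 ∨ x.2 u = 5) :=
    .or (hst 4) (hst 5)
  have hcount : Comp (fun x : ((Γ × ℕ) × ℕ) × (ℕ → ℕ) => guessCount (Ctx.fuel x) x.2) :=
    .count hguess
  have hkept : CompS (fun (x : ((Γ × ℕ) × ℕ) × (ℕ → ℕ)) u => x.2 u = 1 ∨ x.2 u = 4) :=
    .or (hst 1) (hst 4)
  have hdeg : CompA (fun x : ((Γ × ℕ) × ℕ) × (ℕ → ℕ) =>
      keptDegree (Ctx.fuel x) (E x.1.1.1) x.2) :=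
    Comp.count (Γ := (((Γ × ℕ) × ℕ) × (ℕ → ℕ)) × ℕ)
      (P := fun x u => E x.1.1.1.1 x.2 u ∧ (x.1.2 u = 1 ∨ x.1.2 u = 4))
      (.and hE.lift.lift.liftArr hkept.lift)
  have hbit : CompP (fun x : ((Γ × ℕ) × ℕ) × (ℕ → ℕ) =>
      b x.1.1.1 (guessCount (Ctx.fuel x) x.2)) := hb.lift.lift.liftArr.app hcount
  have hdec : CompA (fun x : ((Γ × ℕ) × ℕ) × (ℕ → ℕ) =>
      decideStatus (Ctx.fuel x) (E x.1.1.1) (b x.1.1.1) x.2) :=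
    .ite (.eq hdeg (.const 0)) (.const 3) (.ite (.eq hdeg (.const 1)) (.const 1)
      (.ite hbit.lift (.const 5) (.const 4)))
  have hstep : Comp (fun x : (((Γ × ℕ) × ℕ) × (ℕ → ℕ)) × ℕ =>
      searchStep (Ctx.fuel x.1.1.1.1) (E x.1.1.1.1) (key x.1.1.1.1) (b x.1.1.1.1) x.1.1.2 x.1.2
        x.2) :=
    .ite (.eq (hk.lift.lift.liftArr) (.add (Comp.lift (Comp.liftArr .var)) (.const 2))) hdec
      CompA.var
  exact Comp.letIter (Γ := Γ × ℕ) (g := fun x => x.2 x.1.2) hinit hstep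
    (CompA.var.app (Comp.liftArr .var))

theorem compA_compressSearch {E : Γ → ℕ → ℕ → Prop} {k i g : Γ → ℕ} {S : Γ → ℕ → ℕ}
    (hE : CompR E) (hk : Comp k) (hi : Comp i) (hS : CompA S) (hg : Comp g) :
    CompA (fun γ => compressSearch (Ctx.fuel γ) (E γ) (k γ) (i γ) (S γ) (g γ)) := by
  have hT : CompS (fun γ v => v = i γ ∨ S γ v ≠ 0) := .or (.eq .var hi.lift) (.ne_zero hS)
  exact compA_search hE (compA_elimKeys (U := fun γ v => v < i γ ∧ S γ v = 0) hE
    (.and (.lt .var hi.lift) (.eq hS (.const 0)))) hT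
    (.ne_zero (Comp.digN (.const 2) hg.lift (Comp.rankN hT.lift .var)))
    (.ne_zero (Comp.digN (.const 2) hg.lift (.add (.add hk.lift (.const 1)) .var)))

theorem compS_compressSucceeds {E : Γ → ℕ → ℕ → Prop} {k i : Γ → ℕ} {S : Γ → ℕ → ℕ}
    (hE : CompR E) (hk : Comp k) (hi : Comp i) (hS : CompA S) :
    CompS (fun γ => CompressSucceeds (Ctx.fuel γ) (E γ) (k γ) (i γ) (S γ)) := by
  have hc : CompA (fun x : Γ × ℕ => compressSearch (Ctx.fuel x) (E x.1) (k x.1) (i x.1) (S x.1)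
    x.2) := compA_compressSearch hE.lift hk.lift hi.lift hS.lift .var
  have hd : CompS (fun (x : Γ × ℕ) v =>
      compressSearch (Ctx.fuel x) (E x.1) (k x.1) (i x.1) (S x.1) x.2 v = 2 ∨
      compressSearch (Ctx.fuel x) (E x.1) (k x.1) (i x.1) (S x.1) x.2 v = 5) :=
    .or (.eq hc (.const 2)) (.eq hc (.const 5))
  have hU : CompS (fun (x : Γ × ℕ) v => v < i x.1 + 1 ∧
      ¬ (compressSearch (Ctx.fuel x) (E x.1) (k x.1) (i x.1) (S x.1) x.2 v = 2 ∨
      compressSearch (Ctx.fuel x) (E x.1) (k x.1) (i x.1) (S x.1) x.2 v = 5)) :=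
    .and (.lt .var (.add hi.lift.lift (.const 1))) (.not hd)
  exact .and (.le (.count hd) hk.lift) (CompP.forall_lt (Γ := Γ × ℕ)
    (P := fun x v => elimKeys _ _ _ _ v ≠ 0) (.ne_zero (compA_elimKeys hE.lift hU)))

theorem compA_findFVS {E : Γ → ℕ → ℕ → Prop} {n k : Γ → ℕ} (hE : CompR E) (hn : Comp n)
    (hk : Comp k) : CompA (fun γ => findFVS (Ctx.fuel γ) (E γ) (n γ) (k γ) (Ctx.fuel γ)) := by
  have hleast : Comp (fun x : ((Γ × ℕ) × ℕ) × (ℕ → ℕ) => leastN (Ctx.fuel x)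
      (CompressSucceeds (Ctx.fuel x) (E x.1.1.1) (k x.1.1.1) x.1.2 x.2)) :=
    Comp.leastN (compS_compressSucceeds hE.lift.lift.liftArr hk.lift.lift.liftArr
      (Comp.liftArr .var) .var)
  have hc : CompA (fun x : ((Γ × ℕ) × ℕ) × (ℕ → ℕ) => compressSearch (Ctx.fuel x) (E x.1.1.1)
      (k x.1.1.1) x.1.2 x.2 (leastN (Ctx.fuel x)
        (CompressSucceeds (Ctx.fuel x) (E x.1.1.1) (k x.1.1.1) x.1.2 x.2))) :=
    compA_compressSearch hE.lift.lift.liftArr hk.lift.lift.liftArr (Comp.liftArr .var) .var hleast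
  have hstep : Comp (fun x : (((Γ × ℕ) × ℕ) × (ℕ → ℕ)) × ℕ =>
      compressStep (Ctx.fuel x.1.1.1.1) (E x.1.1.1.1) (n x.1.1.1.1) (k x.1.1.1.1) x.1.1.2 x.1.2
        x.2) :=
    .ite (.lt (Comp.lift (Comp.liftArr .var)) hn.lift.lift.liftArr.lift)
      (.ite (.or (.eq hc (.const 2)) (.eq hc (.const 5))) (.const 1) (.const 0)) CompA.var
  exact Comp.letIter (Γ := Γ × ℕ) (init := fun _ => 0) (g := fun x => x.2 x.1.2) (.const 0) hstep
    (CompA.var.app (Comp.liftArr .var))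

end RAM

namespace SimpleGraph

open Classical

/-! ### Dynamic programming along an elimination order

The codes `x < M` stand for partial solutions at a vertex: `col x` is the color of the vertex,
`dd x` is the number of its neighbours of the same color that were taken into account, and `us x s`
is the number of neighbours of `s ∈ S` of the same color as `s` that were taken into account. -/

/-- The code `z` results from `x` by attaching a vertex with code `y`. -/
structure MergeRel (S : Finset ℕ) (D : ℕ) (col dd : ℕ → ℕ) (us : ℕ → ℕ → ℕ) (root : Prop)
    (x y z : ℕ) : Prop where
  col_eq : col z = col x
  dd_le : dd y ≤ D
  -- The root is not a vertex of the graph and only collects the counts for `S`, so its color and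
  -- degree are irrelevant.
  dd_eq : ¬ root → dd z = dd x + (if col x = col y then 1 else 0) ∧ dd z ≤ D ∧
    (col x = col y → dd y + 1 ≤ D)
  us_eq : ∀ s ∈ S, us z s = us x s + us y s ∧ us z s ≤ D

/-- There is a choice of codes in the table `T` for the vertices in `U` and the root `n` that are
together feasible. -/
def Feasible (H : SimpleGraph ℕ) (S : Finset ℕ) (n D M : ℕ) (col dd : ℕ → ℕ) (us : ℕ → ℕ → ℕ)
    (T : ℕ → ℕ → Prop) (U : Finset ℕ) : Prop :=
  ∃ x : ℕ → ℕ, (∀ u ∈ insert n U, x u < M ∧ T u (x u)) ∧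
    (∀ u ∈ U, dd (x u) + (U.filter fun w => H.Adj u w ∧ col (x w) = col (x u)).card ≤ D) ∧
    ∀ s ∈ S, ∑ u ∈ insert n U, us (x u) s ≤ D

variable {H : SimpleGraph ℕ} {S U : Finset ℕ} {n D M B : ℕ} {col dd : ℕ → ℕ} {us : ℕ → ℕ → ℕ}
  {T T' : ℕ → ℕ → Prop}

theorem feasible_empty : H.Feasible S n D M col dd us T ∅ ↔
    ∃ x < M, T n x ∧ ∀ s ∈ S, us x s ≤ D := by
  constructor
  · rintro ⟨x, h1, -, h3⟩
    exact ⟨x n, (h1 n (by simp)).1, (h1 n (by simp)).2, fun s hs => by simpa using h3 s hs⟩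
  · rintro ⟨x, h1, h2, h3⟩
    exact ⟨fun _ => x, by simp [h1, h2], by simp, by simpa using h3⟩

theorem feasible_congr (h : ∀ u ∈ insert n U, ∀ z < M, T' u z ↔ T u z) :
    H.Feasible S n D M col dd us T' U ↔ H.Feasible S n D M col dd us T U := by
  constructor
  all_goals
    rintro ⟨x, h1, h2⟩
    refine ⟨x, fun u hu => ⟨(h1 u hu).1, ?_⟩, h2⟩
    have := h u hu (x u) (h1 u hu).1
    have := (h1 u hu).2
    tauto

/-- Eliminating a vertex with at most one neighbour. -/
theorem feasible_erase
    (hsurj : ∀ (x d : ℕ) (f : ℕ → ℕ), x < M → d ≤ D → (∀ s ∈ S, f s ≤ D) →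
      ∃ z < M, col z = col x ∧ dd z = d ∧ ∀ s ∈ S, us z s = f s)
    {v p : ℕ} (hn : n ∉ U) (hv : v ∈ U)
    (hp : (p = n ∧ ∀ w ∈ U, ¬ H.Adj v w) ∨ (p ∈ U ∧ ∀ w ∈ U, H.Adj v w ↔ w = p))
    (hT : ∀ u ∈ insert n U, u ≠ p → ∀ z < M, T' u z ↔ T u z)
    (hTp : ∀ z < M, T' p z ↔ ∃ x < M, ∃ y < M, T p x ∧ T v y ∧
      MergeRel S D col dd us (p = n) x y z) :
    H.Feasible S n D M col dd us T' (U.erase v) ↔ H.Feasible S n D M col dd us T U := by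
  have hnv : n ≠ v := fun h => hn (h ▸ hv)
  have hpv : p ≠ v := by
    rcases hp with ⟨rfl, -⟩ | ⟨h1, h2⟩
    · exact hnv
    · rintro rfl
      exact H.loopless.irrefl p ((h2 p h1).2 rfl)
  have hpI : p ∈ insert n (U.erase v) := by
    rcases hp with ⟨rfl, -⟩ | ⟨h1, -⟩
    · simp
    · simp [h1, hpv]
  have hins : insert n U = insert v (insert n (U.erase v)) := by
    rw [insert_comm, insert_erase hv]
  have hvI : v ∉ insert n (U.erase v) := by simp [hnv.symm]
  have hadj : ∀ u ∈ U, u ≠ p → ¬ H.Adj u v := by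
    intro u hu hup h
    rcases hp with ⟨-, h2⟩ | ⟨-, h2⟩
    · exact h2 u hu h.symm
    · exact hup ((h2 u hu).1 h.symm)
  have hpU : p ≠ n → p ∈ U ∧ ∀ w ∈ U, H.Adj v w ↔ w = p := fun h => by tauto
  have hsum : ∀ (x x' : ℕ → ℕ) (s : ℕ), (∀ u, u ≠ v → u ≠ p → x' u = x u) →
      us (x' p) s = us (x p) s + us (x v) s →
      ∑ u ∈ insert n (U.erase v), us (x' u) s = ∑ u ∈ insert n U, us (x u) s := by
    intro x x' s h1 h2
    rw [hins, sum_insert hvI, ← add_sum_erase _ _ hpI, ← add_sum_erase _ _ hpI, h2]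
    have : ∑ u ∈ (insert n (U.erase v)).erase p, us (x' u) s =
        ∑ u ∈ (insert n (U.erase v)).erase p, us (x u) s := by
      refine sum_congr rfl fun u hu => ?_
      rw [h1 u (by rintro rfl; exact hvI (mem_of_mem_erase hu)) (ne_of_mem_erase hu)]
    rw [this]
    ring
  constructor
  · rintro ⟨x', h1, h2, h3⟩
    obtain ⟨a, ha, b, hb, hTa, hTb, hm⟩ := (hTp _ (h1 p hpI).1).1 (h1 p hpI).2
    -- The merged code of `p` is split again into a code for `p` and one for the restored vertex
    -- `v`.
    set x : ℕ → ℕ := fun u => if u = v then b else if u = p then a else x' u with hx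
    have hxv : x v = b := by simp [hx]
    have hxp : x p = a := by simp [hx, hpv]
    have hxo : ∀ u, u ≠ v → u ≠ p → x' u = x u := fun u h1 h2 => by simp [hx, h1, h2]
    have hcol : ∀ u, u ≠ v → col (x u) = col (x' u) := by
      intro u hu
      by_cases hup : u = p
      · subst hup; rw [hxp, hm.col_eq]
      · rw [hxo u hu hup]
    refine ⟨x, fun u hu => ?_, fun u hu => ?_, fun s hs => ?_⟩
    · by_cases huv : u = v
      · subst huv; rw [hxv]; exact ⟨hb, hTb⟩
      by_cases hup : u = p
      · subst hup; rw [hxp]; exact ⟨ha, hTa⟩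
      · have hu' : u ∈ insert n (U.erase v) := by
          rw [hins] at hu
          exact (mem_insert.1 hu).resolve_left huv
        rw [← hxo u huv hup]
        exact ⟨(h1 u hu').1, (hT u hu hup _ (h1 u hu').1).1 (h1 u hu').2⟩
    · by_cases huv : u = v
      · subst huv
        by_cases hpn : p = n
        · have : (U.filter fun w => H.Adj u w ∧ col (x w) = col (x u)) = ∅ := by
            refine filter_eq_empty_iff.2 fun w hw h => ?_
            rcases hp with ⟨-, h4⟩ | ⟨h4, -⟩
            · exact h4 w hw h.1
            · exact hn (hpn ▸ h4)
          rw [this, hxv, card_empty, add_zero]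
          exact hm.dd_le
        · obtain ⟨h4, h5⟩ := hpU hpn
          have hsub : (U.filter fun w => H.Adj u w ∧ col (x w) = col (x u)) ⊆
              if col a = col b then {p} else ∅ := by
            intro w hw
            rw [mem_filter] at hw
            have hwp := (h5 w hw.1).1 hw.2.1
            have := hw.2.2
            rw [hwp, hxp, hxv] at this
            simp [this, hwp]
          have hc := card_le_card hsub
          have h6 := (hm.dd_eq hpn).2.2
          have h7 := hm.dd_le
          rw [hxv]
          split_ifs at hc with hab
          · have := h6 hab
            rw [card_singleton] at hc
            rw [hxv] at hc
            omega
          · rw [card_empty, hxv] at hc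
            omega
      have hu' : u ∈ U.erase v := mem_erase.2 ⟨huv, hu⟩
      have h4 := h2 u hu'
      by_cases hup : u = p
      · subst hup
        have hun : u ≠ n := fun h => hn (h ▸ hu)
        have hsub : (U.filter fun w => H.Adj u w ∧ col (x w) = col (x u)) ⊆
            ((U.erase v).filter fun w => H.Adj u w ∧ col (x' w) = col (x' u)) ∪
              if col a = col b then {v} else ∅ := by
          intro w hw
          rw [mem_filter] at hw
          by_cases hwv : w = v
          · have := hw.2.2
            rw [hwv, hxv, hxp] at this
            simp [this, hwv]
          · refine mem_union_left _ (mem_filter.2 ⟨mem_erase.2 ⟨hwv, hw.1⟩, hw.2.1, ?_⟩)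
            rw [← hcol w hwv, ← hcol u huv]
            exact hw.2.2
        have hc := (card_le_card hsub).trans (card_union_le _ _)
        have h6 := (hm.dd_eq hun).1
        rw [hxp] at hc ⊢
        split_ifs at hc h6
        · rw [card_singleton] at hc; omega
        · rw [card_empty] at hc; omega
      · have hsub : (U.filter fun w => H.Adj u w ∧ col (x w) = col (x u)) ⊆
            ((U.erase v).filter fun w => H.Adj u w ∧ col (x' w) = col (x' u)) := by
          intro w hw
          rw [mem_filter] at hw
          have hwv : w ≠ v := by rintro rfl; exact hadj u hu hup hw.2.1
          refine mem_filter.2 ⟨mem_erase.2 ⟨hwv, hw.1⟩, hw.2.1, ?_⟩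
          rw [← hcol w hwv, ← hcol u huv]
          exact hw.2.2
        have hc := card_le_card hsub
        rw [hxo u huv hup] at h4
        simp only [hxo u huv hup] at hc
        omega
    · rw [← hsum x x' s hxo]
      · exact h3 s hs
      · rw [hxp, hxv]; exact (hm.us_eq s hs).1
  · rintro ⟨x, h1, h2, h3⟩
    have hpI' : p ∈ insert n U := hins ▸ mem_insert_of_mem hpI
    have hvI' : v ∈ insert n U := mem_insert_of_mem hv
    have hv2 := h2 v hv
    have hp2 : p ≠ n → dd (x p) + (((U.erase v).filter fun w => H.Adj p w ∧
        col (x w) = col (x p)).card + if col (x p) = col (x v) then 1 else 0) ≤ D := by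
      intro hpn
      obtain ⟨h4, h5⟩ := hpU hpn
      refine le_trans (Nat.add_le_add_left ?_ _) (h2 p h4)
      rw [← insert_erase hv, filter_insert, erase_insert (notMem_erase v U)]
      have hpa : H.Adj p v := ((h5 p h4).2 rfl).symm
      by_cases hc : col (x p) = col (x v)
      · rw [if_pos hc, if_pos ⟨hpa, hc.symm⟩, card_insert_of_notMem (by simp)]
      · rw [if_neg hc, if_neg fun h => hc h.2.symm, add_zero]
    -- The merged counts are realized by a code because joint feasibility bounds them by `D`; at the
    -- root the degree is set to `0` arbitrarily.
    obtain ⟨z, hz, hz1, hz2, hz3⟩ := hsurj (x p)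
      (if p = n then 0 else dd (x p) + if col (x p) = col (x v) then 1 else 0)
      (fun s => us (x p) s + us (x v) s) (h1 p hpI').1 (by
        split_ifs with h4 h5
        · omega
        · have := hp2 h4; rw [if_pos h5] at this; omega
        · have := hp2 h4; omega) (fun s hs => by
        refine le_trans ?_ (h3 s hs)
        rw [hins, sum_insert hvI, ← add_sum_erase _ _ hpI]
        omega)
    set x' : ℕ → ℕ := Function.update x p z with hx'
    have hxp : x' p = z := by simp [hx']
    have hxo : ∀ u, u ≠ p → x' u = x u := fun u h => by simp [hx', h]
    have hcol : ∀ u, col (x' u) = col (x u) := by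
      intro u
      by_cases hup : u = p
      · subst hup; rw [hxp, hz1]
      · rw [hxo u hup]
    refine ⟨x', fun u hu => ?_, fun u hu => ?_, fun s hs => ?_⟩
    · by_cases hup : u = p
      · subst hup
        rw [hxp]
        refine ⟨hz, (hTp z hz).2 ⟨x u, (h1 u hpI').1, x v, (h1 v hvI').1, (h1 u hpI').2,
          (h1 v hvI').2, hz1, by omega, fun hun => ?_, fun s hs => ⟨hz3 s hs, ?_⟩⟩⟩
        · rw [if_neg hun] at hz2
          have h4 := hp2 hun
          obtain ⟨h5, h6⟩ := hpU hun
          refine ⟨hz2, by omega, fun hc => ?_⟩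
          have : 0 < (U.filter fun w => H.Adj v w ∧ col (x w) = col (x v)).card :=
            card_pos.2 ⟨u, mem_filter.2 ⟨h5, (h6 u h5).2 rfl, hc⟩⟩
          omega
        · rw [hz3 s hs]
          refine le_trans ?_ (h3 s hs)
          rw [hins, sum_insert hvI, ← add_sum_erase _ _ hpI]
          omega
      · have hu' : u ∈ insert n U := by rw [hins]; exact mem_insert_of_mem hu
        rw [hxo u hup]
        exact ⟨(h1 u hu').1, (hT u hu' hup _ (h1 u hu').1).2 (h1 u hu').2⟩
    · simp only [hcol]
      by_cases hup : u = p
      · subst hup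
        have hun : u ≠ n := fun h => hn (h ▸ mem_of_mem_erase hu)
        have := hp2 hun
        rw [if_neg hun] at hz2
        rw [hxp, hz2]
        omega
      · rw [hxo u hup]
        refine le_trans (Nat.add_le_add_left (card_le_card ?_) _) (h2 u (mem_of_mem_erase hu))
        exact filter_subset_filter _ (erase_subset _ _)
    · rw [hsum x x' s (fun u _ => hxo u)]
      · exact h3 s hs
      · rw [hxp]; exact hz3 s hs

/-- The codes of the single vertex `v`, for the colors `cs` of the vertices in `S`. -/
def InitRel (H : SimpleGraph ℕ) (S : Finset ℕ) (C : ℕ) (col dd : ℕ → ℕ) (us : ℕ → ℕ → ℕ)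
    (cs : ℕ → ℕ) (v x : ℕ) : Prop :=
  col x < C ∧ dd x = (S.filter fun s => H.Adj v s ∧ cs s = col x).card ∧
    ∀ s ∈ S, us x s = if H.Adj v s ∧ cs s = col x then 1 else 0

/-- The codes of the root, for the colors `cs` of the vertices in `S`. -/
def InitRootRel (H : SimpleGraph ℕ) (S : Finset ℕ) (D : ℕ) (us : ℕ → ℕ → ℕ) (cs : ℕ → ℕ)
    (x : ℕ) : Prop :=
  ∀ s ∈ S, us x s = (S.filter fun u => H.Adj s u ∧ cs u = cs s).card ∧ us x s ≤ D

/-- Equally coloured neighbours split into those in `S` and those in `R`. The initial codes of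
forest vertices count their neighbours in `S` and their contributions to `S`, and the root counts
the edges inside `S`; feasibility adds the rest, so every edge is taken into account at both ends.
-/
theorem feasible_init {R : Finset ℕ} {C : ℕ} {cs : ℕ → ℕ} (hRS : Disjoint S R) (hn : n ∉ R)
    (hCB : C ≤ B)
    (hsurj : ∀ (c d : ℕ) (f : ℕ → ℕ), c < B → d ≤ D → (∀ s ∈ S, f s ≤ D) →
      ∃ z < M, col z = c ∧ dd z = d ∧ ∀ s ∈ S, us z s = f s) (hB : 0 < B)
    (hT : ∀ v ∈ R, ∀ x < M, T v x ↔ InitRel H S C col dd us cs v x)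
    (hTn : ∀ x < M, T n x ↔ InitRootRel H S D us cs x) :
    H.Feasible S n D M col dd us T R ↔ ∃ c : ℕ → ℕ, (∀ s ∈ S, c s = cs s) ∧ (∀ v ∈ R, c v < C) ∧
      ∀ v ∈ S ∪ R, ((S ∪ R).filter fun w => H.Adj v w ∧ c w = c v).card ≤ D := by
  have hcard : ∀ (p : ℕ → Prop) [DecidablePred p], ((S ∪ R).filter p).card =
      (S.filter p).card + (R.filter p).card := by
    intro p _
    rw [filter_union, card_union_of_disjoint (disjoint_filter_filter hRS)]
  have hnotS : ∀ v ∈ R, v ∉ S := fun v hv hs => Finset.disjoint_left.1 hRS hs hv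
  constructor
  · rintro ⟨x, h1, h2, h3⟩
    have hi : ∀ v ∈ R, InitRel H S C col dd us cs v (x v) := fun v hv =>
      (hT v hv _ (h1 v (mem_insert_of_mem hv)).1).1 (h1 v (mem_insert_of_mem hv)).2
    have hr : InitRootRel H S D us cs (x n) :=
      (hTn _ (h1 n (mem_insert_self _ _)).1).1 (h1 n (mem_insert_self _ _)).2
    set c : ℕ → ℕ := fun v => if v ∈ S then cs v else col (x v) with hc
    have hcS : ∀ s ∈ S, c s = cs s := fun s hs => by simp [hc, hs]
    have hcR : ∀ v ∈ R, c v = col (x v) := fun v hv => by simp [hc, hnotS v hv]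
    refine ⟨c, hcS, fun v hv => by rw [hcR v hv]; exact (hi v hv).1, fun v hv => ?_⟩
    rw [hcard]
    rcases mem_union.1 hv with hv | hv
    · refine le_trans (le_of_eq ?_) (h3 v hv)
      rw [sum_insert hn, (hr v hv).1, hcS v hv]
      congr 1
      · exact congrArg card (filter_congr fun w hw => by rw [hcS w hw])
      · refine (card_filter _ _).trans (sum_congr rfl fun w hw => ?_)
        rw [(hi w hw).2.2 v hv, hcR w hw]
        congr 1
        rw [H.adj_comm, eq_comm (a := col (x w))]
    · refine le_trans (le_of_eq ?_) (h2 v hv)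
      rw [(hi v hv).2.1, hcR v hv]
      congr 1
      · exact congrArg card (filter_congr fun w hw => by rw [hcS w hw])
      · exact congrArg card (filter_congr fun w hw => by rw [hcR w hw])
  · rintro ⟨c, h1, h2, h3⟩
    have hR3 : ∀ v ∈ R, (S.filter fun s => H.Adj v s ∧ cs s = c v).card +
        (R.filter fun s => H.Adj v s ∧ c s = c v).card ≤ D := by
      intro v hv
      have := h3 v (mem_union_right _ hv)
      rw [hcard] at this
      convert this using 3
      exact filter_congr fun w hw => by rw [h1 w hw]
    have hS3 : ∀ s ∈ S, (S.filter fun u => H.Adj s u ∧ cs u = cs s).card +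
        (R.filter fun u => H.Adj s u ∧ c u = cs s).card ≤ D := by
      intro s hs
      have := h3 s (mem_union_left _ hs)
      rw [hcard, h1 s hs] at this
      convert this using 3
      exact filter_congr fun w hw => by rw [h1 w hw]
    have hex : ∀ v, ∃ z < M, (v ∈ R → col z = c v ∧ InitRel H S C col dd us cs v z) ∧
        (v = n → InitRootRel H S D us cs z) := by
      intro v
      by_cases hv : v ∈ R
      · obtain ⟨z, hz, hz1, hz2, hz3⟩ := hsurj (c v)
          ((S.filter fun s => H.Adj v s ∧ cs s = c v).card)
          (fun s => if H.Adj v s ∧ cs s = c v then 1 else 0) ((h2 v hv).trans_le hCB)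
          (by have := hR3 v hv; omega) (fun s hs => by
            split_ifs with h
            · have : 0 < (S.filter fun s => H.Adj v s ∧ cs s = c v).card :=
                card_pos.2 ⟨s, mem_filter.2 ⟨hs, h⟩⟩
              have := hR3 v hv
              omega
            · omega)
        refine ⟨z, hz, fun _ => ⟨hz1, ?_, ?_, ?_⟩, fun h => absurd (h ▸ hv) hn⟩
        · rw [hz1]; exact h2 v hv
        · rw [hz1]; exact hz2
        · rw [hz1]; exact hz3
      · obtain ⟨z, hz, -, -, hz3⟩ := hsurj 0 0
          (fun s => (S.filter fun u => H.Adj s u ∧ cs u = cs s).card) hB (by omega)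
          (fun s hs => by have := hS3 s hs; omega)
        refine ⟨z, hz, fun h => absurd h hv, fun _ s hs => ⟨hz3 s hs, ?_⟩⟩
        rw [hz3 s hs]
        have := hS3 s hs
        omega
    choose x hx hxR hxn using hex
    refine ⟨x, fun u hu => ⟨hx u, ?_⟩, fun u hu => ?_, fun s hs => ?_⟩
    · rcases mem_insert.1 hu with rfl | hu
      · exact (hTn _ (hx _)).2 (hxn _ rfl)
      · exact (hT u hu _ (hx u)).2 (hxR u hu).2
    · refine le_trans (le_of_eq ?_) (hR3 u hu)
      rw [(hxR u hu).2.2.1, (hxR u hu).1]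
      congr 1
      exact congrArg card (filter_congr fun w hw => by rw [(hxR w hw).1])
    · refine le_trans (le_of_eq ?_) (hS3 s hs)
      rw [sum_insert hn, (hxn n rfl s hs).1]
      congr 1
      refine Eq.trans (sum_congr rfl fun w hw => ?_) (card_filter _ _).symm
      rw [(hxR w hw).2.2.2 s hs, (hxR w hw).1]
      congr 1
      rw [H.adj_comm, eq_comm (a := cs s)]

/-- The first `n` vertices can be colored with `C` colors such that every vertex has at most `D`
neighbours of the same color. -/
def DefectiveColorable (H : SimpleGraph ℕ) (n C D : ℕ) : Prop :=
  ∃ c : ℕ → ℕ, ∀ v < n, c v < C ∧ ((range n).filter fun w => H.Adj v w ∧ c w = c v).card ≤ D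

/-- Private colours for `S`, given by ranks, and a proper 2-colouring of the forest: no edge is
monochromatic. -/
theorem defectiveColorable_of_card_add_two_le {C : ℕ} (hS : S ⊆ range n)
    (hd : H.Degenerate (range n \ S)) (hC : S.card + 2 ≤ C) : H.DefectiveColorable n C D := by
  obtain ⟨b, hb⟩ := hd.exists_coloring
  have hA : ∀ u, u ∈ S ↔ u < n ∧ u ∈ S := fun u => ⟨fun h => ⟨mem_range.1 (hS h), h⟩, fun h => h.2⟩
  refine ⟨fun v => if v ∈ S then rankN n (· ∈ S) v else if b v then S.card else S.card + 1,
    fun v hv => ⟨?_, ?_⟩⟩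
  · dsimp only
    split_ifs with h
    · have := rankN_lt (T := (· ∈ S)) hA h; omega
    · omega
    · omega
  · refine le_trans (le_of_eq (card_eq_zero.2 (filter_eq_empty_iff.2 ?_))) (Nat.zero_le D)
    rintro w hw ⟨hvw, hc⟩
    dsimp only at hc
    rw [mem_range] at hw
    by_cases hvS : v ∈ S <;> by_cases hwS : w ∈ S
    · rw [if_pos hvS, if_pos hwS] at hc
      exact hvw.ne (rankN_injOn (T := (· ∈ S)) ⟨hw, hwS⟩ ⟨hv, hvS⟩ hc).symm
    · rw [if_pos hvS, if_neg hwS] at hc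
      have := rankN_lt (T := (· ∈ S)) hA hvS
      split_ifs at hc <;> omega
    · rw [if_neg hvS, if_pos hwS] at hc
      have := rankN_lt (T := (· ∈ S)) hA hwS
      split_ifs at hc <;> omega
    · have := hb v (by simp [hv, hvS]) w (by simp [hw, hwS]) hvw
      rw [if_neg hvS, if_neg hwS] at hc
      cases h1 : b v <;> cases h2 : b w <;> rw [h1, h2] at hc this <;> simp at hc this

/-- One colour for all of `S` and two for the forest: monochromatic edges lie inside `S`, where
degrees are at most `S.card - 1`. The three colours are the reason for excluding two. -/
theorem defectiveColorable_of_card_le {C : ℕ}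
    (hd : H.Degenerate (range n \ S)) (hC : 3 ≤ C) (hD : S.card ≤ D + 1) :
    H.DefectiveColorable n C D := by
  obtain ⟨b, hb⟩ := hd.exists_coloring
  refine ⟨fun v => if v ∈ S then 0 else if b v then 1 else 2, fun v hv => ⟨?_, ?_⟩⟩
  · dsimp only
    split_ifs <;> omega
  · dsimp only
    have hsub : ((range n).filter fun w => H.Adj v w ∧
        (if w ∈ S then 0 else if b w then 1 else 2) =
          (if v ∈ S then 0 else if b v then 1 else 2)) ⊆ S.erase v := by
      intro w hw
      rw [mem_filter, mem_range] at hw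
      obtain ⟨hw, hvw, hc⟩ := hw
      refine mem_erase.2 ⟨hvw.ne', ?_⟩
      by_contra hwS
      rw [if_neg hwS] at hc
      by_cases hvS : v ∈ S
      · rw [if_pos hvS] at hc
        split_ifs at hc
      · have := hb v (by simp [hv, hvS]) w (by simp [hw, hwS]) hvw
        rw [if_neg hvS] at hc
        cases h1 : b v <;> cases h2 : b w <;> simp_all
    by_cases hvS : v ∈ S
    · have h1 := card_le_card hsub
      rw [card_erase_of_mem hvS] at h1
      omega
    · refine le_trans (le_of_eq (card_eq_zero.2 (filter_eq_empty_iff.2 ?_))) (Nat.zero_le D)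
      rintro w hw ⟨hvw, hc⟩
      rw [mem_range] at hw
      rw [if_neg hvS] at hc
      by_cases hwS : w ∈ S
      · rw [if_pos hwS] at hc
        split_ifs at hc
      · have := hb v (by simp [hv, hvS]) w (by simp [hw, hwS]) hvw
        rw [if_neg hwS] at hc
        cases h1 : b v <;> cases h2 : b w <;> simp_all

end SimpleGraph

namespace SimpleGraph

open Classical

/-! ### Deciding defective colorability for a given feedback vertex set

A code `x` is a number with `k + 2` digits in base `k + 2`, where `k` is the size of the feedback
vertex set `S`: the numbers for the elements of `S`, followed by the color and the degree. -/

def dpCol (N k x : ℕ) : ℕ := digN N (k + 2) x k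

def dpDeg (N k x : ℕ) : ℕ := digN N (k + 2) x (k + 1)

noncomputable def dpUse (N : ℕ) (S : ℕ → Prop) (k x s : ℕ) : ℕ := digN N (k + 2) x (rankN N S s)

def dpSize (N k : ℕ) : ℕ := powN N (k + 2) (k + 2)

def dpMerge (N : ℕ) (S : ℕ → Prop) (D k : ℕ) (root : Prop) (x y z : ℕ) : Prop :=
  dpCol N k z = dpCol N k x ∧ dpDeg N k y ≤ D ∧
  (¬ root → dpDeg N k z = dpDeg N k x + (if dpCol N k x = dpCol N k y then 1 else 0) ∧
    dpDeg N k z ≤ D ∧ (dpCol N k x = dpCol N k y → dpDeg N k y + 1 ≤ D)) ∧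
  ∀ s < N, S s → dpUse N S k z s = dpUse N S k x s + dpUse N S k y s ∧ dpUse N S k z s ≤ D

/-- The initial table, where the colors of the vertices in `S` are encoded by `g`. -/
def dpInit (N : ℕ) (E : ℕ → ℕ → Prop) (S : ℕ → Prop) (n C D k g v x : ℕ) : Prop :=
  (v = n ∧ ∀ s < N, S s → dpUse N S k x s = ((range N).filter fun u =>
    S u ∧ E s u ∧ dpUse N S k g u = dpUse N S k g s).card ∧ dpUse N S k x s ≤ D) ∨
  (v ≠ n ∧ dpCol N k x < C ∧ dpDeg N k x = ((range N).filter fun s =>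
    S s ∧ E v s ∧ dpUse N S k g s = dpCol N k x).card ∧
    ∀ s < N, S s → dpUse N S k x s = if E v s ∧ dpUse N S k g s = dpCol N k x then 1 else 0)

/-- The vertex `u` is the unique later neighbour of `v`, or it is the root `n` if there is none. -/
def DpParent (N : ℕ) (E : ℕ → ℕ → Prop) (key : ℕ → ℕ) (n v u : ℕ) : Prop :=
  (u = n ∧ ∀ w < N, ¬ (E v w ∧ key v < key w)) ∨ (u ≠ n ∧ E v u ∧ key v < key u)

/-- The new entry `z` of the table of `u` if its child removed in step `j` is attached. -/
def DpEntry (N : ℕ) (S : ℕ → Prop) (n D k : ℕ) (key : ℕ → ℕ) (j : ℕ) (T : ℕ → ℕ) (u z : ℕ) :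
    Prop :=
  ∃ v < N, key v = j + 2 ∧ ∃ x < N, x < dpSize N k ∧ ∃ y < N, y < dpSize N k ∧
    T (mulN N (dpSize N k) u + x) ≠ 0 ∧ T (mulN N (dpSize N k) v + y) ≠ 0 ∧
    dpMerge N S D k (u = n) x y z

/-- All tables share one array: entry `z` of vertex `u` has address `dpSize N k * u + z`. Only the
table of the parent of the vertex removed in step `j` is rewritten. -/
noncomputable def dpStep (N : ℕ) (E : ℕ → ℕ → Prop) (S : ℕ → Prop) (n D k : ℕ) (key : ℕ → ℕ)
    (j : ℕ) (T : ℕ → ℕ) (i : ℕ) : ℕ :=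
  if ∃ v < N, key v = j + 2 ∧ DpParent N E key n v (divN N i (dpSize N k)) then
    if DpEntry N S n D k key j T (divN N i (dpSize N k)) (modN N i (dpSize N k)) then 1 else 0
  else T i

noncomputable def dpTables (N : ℕ) (E : ℕ → ℕ → Prop) (S : ℕ → Prop) (n C D k g : ℕ) :
    ℕ → ℕ → ℕ :=
  arrIter N (fun i => if dpInit N E S n C D k g (divN N i (dpSize N k)) (modN N i (dpSize N k))
    then 1 else 0) (dpStep N E S n D k (elimKeys N E (fun v => v < n ∧ ¬ S v) N))

def DpAccepts (N : ℕ) (E : ℕ → ℕ → Prop) (S : ℕ → Prop) (n C D k g : ℕ) : Prop :=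
  (∀ s < N, S s → dpUse N S k g s < C) ∧ ∃ x < N, x < dpSize N k ∧
    dpTables N E S n C D k g N (mulN N (dpSize N k) n + x) ≠ 0 ∧
    ∀ s < N, S s → dpUse N S k x s ≤ D

/-- The decision procedure, where `k` is the size of the feedback vertex set `S`. -/
def DecideColorable (N : ℕ) (E : ℕ → ℕ → Prop) (S : ℕ → Prop) (n C D k : ℕ) : Prop :=
  (C = 1 ∧ ∀ v < N, ((range N).filter fun w => E v w).card ≤ D) ∨
  (C ≠ 1 ∧ (k + 2 ≤ C ∨ k ≤ D + 1 ∨ ∃ g < N, g < dpSize N k ∧ DpAccepts N E S n C D k g))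

section Correctness

variable {H : SimpleGraph ℕ} {N n C D k : ℕ} {S : ℕ → Prop} {A : Finset ℕ}

theorem dpMerge_iff (hA : ∀ s, s ∈ A ↔ s < N ∧ S s) {root : Prop} {x y z : ℕ} :
    dpMerge N S D k root x y z ↔
      MergeRel A D (dpCol N k) (dpDeg N k) (dpUse N S k) root x y z := by
  constructor
  · rintro ⟨h1, h2, h3, h4⟩
    exact ⟨h1, h2, h3, fun s hs => h4 s ((hA s).1 hs).1 ((hA s).1 hs).2⟩
  · rintro ⟨h1, h2, h3, h4⟩
    exact ⟨h1, h2, h3, fun s hs hs' => h4 s ((hA s).2 ⟨hs, hs'⟩)⟩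

/-- Ranks number the elements of `A` by `0` to `k - 1`, so the digits for `A`, for the colour and
for the degree do not collide. -/
theorem exists_code (hA : ∀ s, s ∈ A ↔ s < N ∧ S s) (hk : A.card = k)
    (hN : (k + 2) ^ (k + 2) ≤ N) (c d : ℕ) (f : ℕ → ℕ) (hc : c < k + 2) (hd : d < k + 2)
    (hf : ∀ s ∈ A, f s < k + 2) : ∃ z < (k + 2) ^ (k + 2), dpCol N k z = c ∧ dpDeg N k z = d ∧
      ∀ s ∈ A, dpUse N S k z s = f s := by
  have hkN : k + 2 ≤ N := (Nat.le_self_pow (by omega) _).trans hN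
  obtain ⟨z, hz, h⟩ := exists_digits (b := k + 2) (L := k + 2) (fun i =>
    if i = k then c else if i = k + 1 then d else
      if h : ∃ s ∈ A, rankN N S s = i then f h.choose else 0) (by
    intro i _
    split_ifs with h1 h2 h3
    · exact hc
    · exact hd
    · exact hf _ h3.choose_spec.1
    · omega)
  have hz' : ∀ i < k + 2, digN N (k + 2) z i = _ := fun i hi =>
    (digN_eq (hz.trans_le hN) (by omega) (by omega)).trans (h i hi)
  refine ⟨z, hz, ?_, ?_, fun s hs => ?_⟩
  · rw [dpCol, hz' _ (by omega), if_pos rfl]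
  · rw [dpDeg, hz' _ (by omega), if_neg (by omega), if_pos rfl]
  · have hr := rankN_lt hA hs
    have hex : ∃ s' ∈ A, rankN N S s' = rankN N S s := ⟨s, hs, rfl⟩
    rw [dpUse, hz' _ (by omega), if_neg (by omega), if_neg (by omega), dif_pos hex]
    have h1 := hex.choose_spec
    rw [rankN_injOn ((hA _).1 h1.1) ((hA _).1 hs) h1.2]

/-- Feasibility of the tables is invariant under elimination: initially it means that the guess `g`
extends to a colouring, finally that the root's table contains an admissible code. -/
theorem dpAccepts_iff (hH : ∀ u v, H.Adj u v → v < n) (hA : ∀ s, s ∈ A ↔ s < N ∧ S s)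
    (hAn : A ⊆ range n) (hk : A.card = k) (hd : H.Degenerate (range n \ A))
    (hN : (n + 1) * (k + 2) ^ (k + 2) ≤ N) (hC : C ≤ k + 1) (hD : D + 2 ≤ k) (g : ℕ) :
    DpAccepts N H.Adj S n C D k g ↔ (∀ s ∈ A, dpUse N S k g s < C) ∧
      ∃ c : ℕ → ℕ, (∀ s ∈ A, c s = dpUse N S k g s) ∧ (∀ v ∈ range n \ A, c v < C) ∧
      ∀ v < n, ((range n).filter fun w => H.Adj v w ∧ c w = c v).card ≤ D := by
  have hMpos : 0 < (k + 2) ^ (k + 2) := Nat.pow_pos (by omega)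
  have hMN : (k + 2) ^ (k + 2) ≤ N := (Nat.le_mul_of_pos_left _ (by omega)).trans hN
  have hkN : k + 2 ≤ N := (Nat.le_self_pow (by omega) _).trans hMN
  have hnN : n + 1 ≤ N := (Nat.le_mul_of_pos_right _ hMpos).trans hN
  have hsize : dpSize N k = (k + 2) ^ (k + 2) := powN_eq hkN hkN
  set M := (k + 2) ^ (k + 2) with hM
  have hidx : ∀ u ≤ n, ∀ z < M, M * u + z < N := by
    intro u hu z hz
    calc M * u + z < M * u + M := by omega
      _ = (u + 1) * M := by ring
      _ ≤ (n + 1) * M := Nat.mul_le_mul_right _ (by omega)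
      _ ≤ N := hN
  have hdiv : ∀ u ≤ n, ∀ z < M, divN N (M * u + z) M = u := by
    intro u hu z hz
    rw [divN_eq (hidx u hu z hz) hMpos, Nat.mul_add_div hMpos, Nat.div_eq_of_lt hz, add_zero]
  have hmod : ∀ u ≤ n, ∀ z < M, modN N (M * u + z) M = z := by
    intro u hu z hz
    rw [modN_eq (hidx u hu z hz) hMpos, Nat.mul_add_mod, Nat.mod_eq_of_lt hz]
  have hR : ∀ v, v ∈ range n \ A ↔ v < N ∧ (v < n ∧ ¬ S v) := by
    intro v
    rw [mem_sdiff, mem_range, hA]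
    constructor
    · rintro ⟨h1, h2⟩; exact ⟨by omega, h1, fun h => h2 ⟨by omega, h⟩⟩
    · rintro ⟨h1, h2, h3⟩; exact ⟨h2, fun h => h3 h.2⟩
  have hel := isElimination_elimKeys H hR N
  have hne := (elimKeys_ne_zero_iff H hR).2 hd
  generalize hkey : elimKeys N H.Adj (fun v => v < n ∧ ¬ S v) N = key at hel hne
  set R := range n \ A with hRdef
  have hRn : ∀ v ∈ R, v < n := fun v hv => ((hR v).1 hv).2.1
  have hnR : n ∉ R := fun h => (hRn n h).ne rfl
  have hkey2 : ∀ v ∈ R, 2 ≤ key v := fun v hv => by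
    have := hne v hv; have := hel.ne_one v hv; omega
  let T : ℕ → ℕ → ℕ → Prop := fun j u z => dpTables N H.Adj S n C D k g j (M * u + z) ≠ 0
  -- The vertices still present before step `j` are those with key at least `j + 2`.
  let F : ℕ → Prop := fun j => H.Feasible A n D M (dpCol N k) (dpDeg N k) (dpUse N S k) (T j)
    (R.filter fun v => j + 2 ≤ key v)
  have hstepT : ∀ j, ∀ u ≤ n, ∀ z < M, T (j + 1) u z ↔
      if ∃ v < N, key v = j + 2 ∧ DpParent N H.Adj key n v u then
        ∃ v < N, key v = j + 2 ∧ ∃ x < M, ∃ y < M, T j u x ∧ T j v y ∧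
          MergeRel A D (dpCol N k) (dpDeg N k) (dpUse N S k) (u = n) x y z
      else T j u z := by
    intro j u hu z hz
    have hs : dpTables N H.Adj S n C D k g (j + 1) =
      tab N (dpStep N H.Adj S n D k key j (dpTables N H.Adj S n C D k g j)) := by
      rw [← hkey]; rfl
    change dpTables N H.Adj S n C D k g (j + 1) (M * u + z) ≠ 0 ↔ _
    rw [hs, tab_of_lt _ (hidx u hu z hz), dpStep, hsize, hdiv u hu z hz, hmod u hu z hz]
    split_ifs with h1 h2
    · refine iff_of_true one_ne_zero ?_
      obtain ⟨v, hv, hkv, x, -, hx, y, -, hy, hTx, hTy, hm⟩ := h2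
      rw [hsize] at hx hy hTx hTy
      rw [mulN_eq _ (by omega)] at hTx hTy
      exact ⟨v, hv, hkv, x, hx, y, hy, hTx, hTy, (dpMerge_iff hA).1 hm⟩
    · refine iff_of_false (fun h => h rfl) fun h => h2 ?_
      obtain ⟨v, hv, hkv, x, hx, y, hy, hTx, hTy, hm⟩ := h
      refine ⟨v, hv, hkv, x, by omega, by omega, y, by omega, by omega, ?_, ?_,
        (dpMerge_iff hA).2 hm⟩
      · rw [hsize, mulN_eq _ (by omega)]; exact hTx
      · rw [hsize, mulN_eq _ (by omega)]; exact hTy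
    · rfl
  have hsurj : ∀ (c d : ℕ) (f : ℕ → ℕ), c < k + 2 → d ≤ D → (∀ s ∈ A, f s ≤ D) →
      ∃ z < M, dpCol N k z = c ∧ dpDeg N k z = d ∧ ∀ s ∈ A, dpUse N S k z s = f s :=
    fun c d f hc hd hf => exists_code hA hk hMN c d f hc (by omega)
      (fun s hs => by have := hf s hs; omega)
  have hstep : ∀ j, F (j + 1) ↔ F j := by
    intro j
    by_cases hex : ∃ v < N, key v = j + 2
    swap
    · push Not at hex
      have hU : (R.filter fun v => j + 1 + 2 ≤ key v) = R.filter fun v => j + 2 ≤ key v :=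
        filter_congr fun v hv => by have := hex v ((hR v).1 hv).1; omega
      change H.Feasible _ _ _ _ _ _ _ _ _ ↔ H.Feasible _ _ _ _ _ _ _ _ _
      rw [hU]
      refine feasible_congr fun u hu z hz => ?_
      have hu' : u ≤ n := by
        rcases mem_insert.1 hu with rfl | hu
        · exact le_rfl
        · exact (hRn u (mem_filter.1 hu).1).le
      rw [hstepT j u hu' z hz, if_neg]
      rintro ⟨v, hv, hk', -⟩
      exact hex v hv hk'
    obtain ⟨v, hv, hkv⟩ := hex
    have hvR : v ∈ R := hel.mem v (by omega)
    have huniq : ∀ w, key w = j + 2 → w = v := fun w hw => hel.inj w v (by omega) (by omega)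
    have hU : (R.filter fun v => j + 1 + 2 ≤ key v) =
        (R.filter fun v => j + 2 ≤ key v).erase v := by
      ext u
      simp only [mem_filter, mem_erase]
      constructor
      · rintro ⟨h1, h2⟩
        exact ⟨by rintro rfl; omega, h1, by omega⟩
      · rintro ⟨h1, h2, h3⟩
        have : key u ≠ j + 2 := fun h' => h1 (huniq u h')
        exact ⟨h2, by omega⟩
    -- The elimination leaves `v` at most one later neighbour; it is the parent, and the root takes
    -- its place if there is none.
    obtain ⟨p, hpn, hp, hpar⟩ : ∃ p ≤ n,
        ((p = n ∧ ∀ w ∈ R.filter fun v => j + 2 ≤ key v, ¬ H.Adj v w) ∨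
        (p ∈ (R.filter fun v => j + 2 ≤ key v) ∧
          ∀ w ∈ R.filter fun v => j + 2 ≤ key v, H.Adj v w ↔ w = p)) ∧
        ∀ u, DpParent N H.Adj key n v u ↔ u = p := by
      have hlater : ∀ w ∈ R.filter (fun v => j + 2 ≤ key v), H.Adj v w → key v < key w := by
        intro w hw hvw
        have : key w ≠ j + 2 := fun h' => hvw.ne (huniq w h').symm
        have := (mem_filter.1 hw).2
        omega
      by_cases hw : ∃ w, H.Adj v w ∧ key v < key w
      · obtain ⟨w, hvw, hkw⟩ := hw
        have hwR : w ∈ R := hel.mem w (by omega)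
        have hone : ∀ u, H.Adj v u → key v < key u → u = w := fun u hu hku =>
          card_le_one.1 (hel.nbrs v (by omega)) u
            (mem_filter.2 ⟨hel.mem u (by omega), hu, .inr hku⟩) w
            (mem_filter.2 ⟨hwR, hvw, .inr hkw⟩)
        refine ⟨w, (hRn w hwR).le, .inr ⟨mem_filter.2 ⟨hwR, by omega⟩, fun u hu => ?_⟩,
          fun u => ?_⟩
        · exact ⟨fun h => hone u h (hlater u hu h), fun h => h ▸ hvw⟩
        · constructor
          · rintro (⟨-, h⟩ | ⟨-, h1, h2⟩)
            · exact absurd ⟨hvw, hkw⟩ (h w ((hR w).1 hwR).1)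
            · exact hone u h1 h2
          · rintro rfl
            exact .inr ⟨fun h => hnR (h ▸ hwR), hvw, hkw⟩
      · push Not at hw
        refine ⟨n, le_rfl, .inl ⟨rfl, fun u hu h => ?_⟩, fun u => ?_⟩
        · exact absurd (hlater u hu h) (by have := hw u h; omega)
        · constructor
          · rintro (⟨h, -⟩ | ⟨-, h1, h2⟩)
            · exact h
            · exact absurd h2 (by have := hw u h1; omega)
          · rintro rfl
            exact .inl ⟨rfl, fun w _ h => absurd h.2 (by have := hw w h.1; omega)⟩
    have hcond : ∀ u, (∃ v < N, key v = j + 2 ∧ DpParent N H.Adj key n v u) ↔ u = p := by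
      intro u
      rw [← hpar u]
      constructor
      · rintro ⟨w, -, hkw, h⟩
        rwa [huniq w hkw] at h
      · exact fun h => ⟨v, hv, hkv, h⟩
    change H.Feasible _ _ _ _ _ _ _ _ _ ↔ H.Feasible _ _ _ _ _ _ _ _ _
    rw [hU]
    refine feasible_erase (p := p) (fun x d f hx hd hf => hsurj _ d f ?_ hd hf)
      (fun h => hnR (mem_filter.1 h).1) (mem_filter.2 ⟨hvR, hkv.ge⟩) hp (fun u hu hup z hz => ?_)
      (fun z hz => ?_)
    · rw [dpCol, digN_eq (hx.trans_le hMN) (by omega) (by omega)]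
      exact Nat.mod_lt _ (by omega)
    · have hu' : u ≤ n := by
        rcases mem_insert.1 hu with rfl | hu
        · exact le_rfl
        · exact (hRn u (mem_filter.1 hu).1).le
      rw [hstepT j u hu' z hz, if_neg (fun h => hup ((hcond u).1 h))]
    · rw [hstepT j p hpn z hz, if_pos ((hcond p).2 rfl)]
      constructor
      · rintro ⟨w, -, hkw, h⟩
        rwa [huniq w hkw] at h
      · exact fun h => ⟨v, hv, hkv, h⟩
  have hF : F N ↔ F 0 := by
    have : ∀ j, F j ↔ F 0 := fun j => by
      induction j with
      | zero => rfl
      | succ j ih => rw [hstep j, ih]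
    exact this N
  have hfilter : ∀ (p : ℕ → Prop) (i₁ : DecidablePred fun s => S s ∧ p s)
      (i₂ : DecidablePred p), ((range N).filter fun s => S s ∧ p s).card = (A.filter p).card := by
    intro p _ _
    refine congrArg card (ext fun s => ?_)
    rw [mem_filter, mem_filter, hA, mem_range, and_assoc]
  have hT0 : ∀ u ≤ n, ∀ z < M, T 0 u z ↔ dpInit N H.Adj S n C D k g u z := by
    intro u hu z hz
    change tab N (fun i => if dpInit N H.Adj S n C D k g (divN N i (dpSize N k))
      (modN N i (dpSize N k)) then 1 else 0) (M * u + z) ≠ 0 ↔ _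
    rw [tab_of_lt _ (hidx u hu z hz), hsize, hdiv u hu z hz, hmod u hu z hz]
    split_ifs with h
    · exact iff_of_true one_ne_zero h
    · exact iff_of_false (fun h => h rfl) h
  have hR0 : (R.filter fun v => 0 + 2 ≤ key v) = R := filter_true_of_mem (by simpa using hkey2)
  have hRN : (R.filter fun v => N + 2 ≤ key v) = ∅ :=
    filter_eq_empty_iff.2 fun v _ => by have := hel.le v; omega
  have hAR : A ∪ R = range n := union_sdiff_of_subset hAn
  have hF0 : F 0 ↔ ∃ c : ℕ → ℕ, (∀ s ∈ A, c s = dpUse N S k g s) ∧ (∀ v ∈ R, c v < C) ∧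
      ∀ v ∈ A ∪ R, ((A ∪ R).filter fun w => H.Adj v w ∧ c w = c v).card ≤ D := by
    change H.Feasible _ _ _ _ _ _ _ _ _ ↔ _
    rw [hR0]
    refine feasible_init (B := k + 2) disjoint_sdiff hnR (by omega) hsurj (by omega)
      (fun v hv x hx => ?_) (fun x hx => ?_)
    · rw [hT0 v (hRn v hv).le x hx, dpInit]
      have hvn : v ≠ n := (hRn v hv).ne
      constructor
      · rintro (h | ⟨-, h1, h2, h3⟩)
        · exact absurd h.1 hvn
        · exact ⟨h1, h2.trans (hfilter _ _ _),
            fun s hs => h3 s ((hA s).1 hs).1 ((hA s).1 hs).2⟩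
      · rintro ⟨h1, h2, h3⟩
        exact .inr ⟨hvn, h1, h2.trans (hfilter _ _ _).symm,
            fun s hs hs' => h3 s ((hA s).2 ⟨hs, hs'⟩)⟩
    · rw [hT0 n le_rfl x hx, dpInit]
      constructor
      · rintro (h | h)
        · intro s hs
          have := h.2 s ((hA s).1 hs).1 ((hA s).1 hs).2
          exact ⟨this.1.trans (hfilter _ _ _), this.2⟩
        · exact absurd rfl h.1
      · intro h
        refine .inl ⟨rfl, fun s hs hs' => ?_⟩
        have := h s ((hA s).2 ⟨hs, hs'⟩)
        exact ⟨this.1.trans (hfilter _ _ _).symm, this.2⟩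
  have hFN : F N ↔ ∃ x < M, T N n x ∧ ∀ s ∈ A, dpUse N S k x s ≤ D := by
    change H.Feasible _ _ _ _ _ _ _ _ _ ↔ _
    rw [hRN]
    exact feasible_empty
  rw [hAR] at hF0
  simp only [mem_range] at hF0
  rw [← hF0, ← hF, hFN, DpAccepts, hsize, mulN_eq _ (by omega)]
  refine and_congr ⟨fun h s hs => h s ((hA s).1 hs).1 ((hA s).1 hs).2,
    fun h s hs hs' => h s ((hA s).2 ⟨hs, hs'⟩)⟩ ?_
  constructor
  · rintro ⟨x, -, hx, h1, h2⟩
    exact ⟨x, hx, h1, fun s hs => h2 s ((hA s).1 hs).1 ((hA s).1 hs).2⟩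
  · rintro ⟨x, hx, h1, h2⟩
    exact ⟨x, hx.trans_le hMN, hx, h1, fun s hs hs' => h2 s ((hA s).2 ⟨hs, hs'⟩)⟩

/-- Once the trivial cases are settled, `C ≤ k + 1` and `D + 2 ≤ k`, so all colours and counts fit
into digits in base `k + 2`. -/
theorem decideColorable_iff (hH : ∀ u v, H.Adj u v → v < n) (hA : ∀ s, s ∈ A ↔ s < N ∧ S s)
    (hAn : A ⊆ range n) (hk : A.card = k) (hd : H.Degenerate (range n \ A))
    (hN : (n + 1) * (k + 2) ^ (k + 2) ≤ N) (hC : 1 ≤ C) (hC2 : C ≠ 2) :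
    DecideColorable N H.Adj S n C D k ↔ H.DefectiveColorable n C D := by
  have hMpos : 0 < (k + 2) ^ (k + 2) := Nat.pow_pos (by omega)
  have hMN : (k + 2) ^ (k + 2) ≤ N := (Nat.le_mul_of_pos_left _ (by omega)).trans hN
  have hkN : k + 2 ≤ N := (Nat.le_self_pow (by omega) _).trans hMN
  have hnN : n + 1 ≤ N := (Nat.le_mul_of_pos_right _ hMpos).trans hN
  have hsize : dpSize N k = (k + 2) ^ (k + 2) := powN_eq hkN hkN
  unfold DecideColorable
  by_cases hC1 : C = 1
  · subst hC1
    simp only [true_and, ne_eq, not_true_eq_false, false_and, or_false]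
    constructor
    · intro h
      refine ⟨fun _ => 0, fun v hv => ⟨one_pos, (card_le_card ?_).trans (h v (by omega))⟩⟩
      intro w hw
      rw [mem_filter, mem_range] at hw ⊢
      exact ⟨by omega, hw.2.1⟩
    · rintro ⟨c, h⟩ v hv
      by_cases hvn : v < n
      · refine (card_le_card ?_).trans (h v hvn).2
        intro w hw
        rw [mem_filter, mem_range] at hw ⊢
        have hw' := hH v w hw.2
        have := (h v hvn).1
        have := (h w hw').1
        exact ⟨hw', hw.2, by omega⟩
      · rw [filter_eq_empty_iff.2 fun w _ hw => hvn (hH w v hw.symm)]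
        exact Nat.zero_le _
  simp only [hC1, false_and, ne_eq, not_false_eq_true, true_and, false_or]
  by_cases hCk : k + 2 ≤ C
  · exact iff_of_true (.inl hCk)
      (defectiveColorable_of_card_add_two_le hAn hd (by omega))
  by_cases hDk : k ≤ D + 1
  · exact iff_of_true (.inr (.inl hDk))
      (defectiveColorable_of_card_le hd (by omega) (by omega))
  simp only [hCk, hDk, false_or, hsize]
  constructor
  · rintro ⟨g, -, hg, h⟩
    obtain ⟨hg', c, h1, h2, h3⟩ :=
      (dpAccepts_iff hH hA hAn hk hd hN (by omega) (by omega) g).1 h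
    refine ⟨c, fun v hv => ⟨?_, h3 v hv⟩⟩
    by_cases hvA : v ∈ A
    · rw [h1 v hvA]; exact hg' v hvA
    · exact h2 v (by simp [hv, hvA])
  · rintro ⟨c, h⟩
    have hc : ∀ s ∈ A, c s < C := fun s hs => (h s (mem_range.1 (hAn hs))).1
    -- The guess uses the same encoding as the states; its colour and degree digits are not needed
    -- and set to `0`.
    obtain ⟨g, hg, -, -, h4⟩ := exists_code hA hk hMN 0 0 c (by omega) (by omega)
      (fun s hs => by have := hc s hs; omega)
    refine ⟨g, hg.trans_le hMN, hg,
      (dpAccepts_iff hH hA hAn hk hd hN (by omega) (by omega) g).2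
      ⟨fun s hs => by rw [h4 s hs]; exact hc s hs, c, fun s hs => (h4 s hs).symm,
        fun v hv => ?_, fun v hv => (h v hv).2⟩⟩
    exact (h v (mem_range.1 (mem_sdiff.1 hv).1)).1

end Correctness

end SimpleGraph

/-! ### Computability of the dynamic program. -/

namespace RAM

open Classical SimpleGraph

variable {Γ : Type} [Ctx Γ] {E : Γ → ℕ → ℕ → Prop} {S : Γ → ℕ → Prop} {n C D k : Γ → ℕ}

theorem comp_dpCol {x : Γ → ℕ} (hk : Comp k) (hx : Comp x) :
    Comp (fun γ => dpCol (Ctx.fuel γ) (k γ) (x γ)) :=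
  Comp.digN (hk.add (.const 2)) hx hk

theorem comp_dpDeg {x : Γ → ℕ} (hk : Comp k) (hx : Comp x) :
    Comp (fun γ => dpDeg (Ctx.fuel γ) (k γ) (x γ)) :=
  Comp.digN (hk.add (.const 2)) hx (hk.add (.const 1))

theorem comp_dpUse {x s : Γ → ℕ} (hS : CompS S) (hk : Comp k) (hx : Comp x) (hs : Comp s) :
    Comp (fun γ => dpUse (Ctx.fuel γ) (S γ) (k γ) (x γ) (s γ)) :=
  Comp.digN (hk.add (.const 2)) hx (Comp.rankN hS hs)

theorem comp_dpSize (hk : Comp k) : Comp (fun γ => dpSize (Ctx.fuel γ) (k γ)) :=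
  Comp.powN (hk.add (.const 2)) (hk.add (.const 2))

theorem compP_dpMerge {root : Γ → Prop} {x y z : Γ → ℕ} (hS : CompS S) (hD : Comp D)
    (hk : Comp k) (hr : CompP root) (hx : Comp x) (hy : Comp y) (hz : Comp z) :
    CompP (fun γ => dpMerge (Ctx.fuel γ) (S γ) (D γ) (k γ) (root γ) (x γ) (y γ) (z γ)) := by
  have heq := CompP.eq (comp_dpCol hk hx) (comp_dpCol hk hy)
  have huse : ∀ {x : Γ → ℕ}, Comp x →
      CompA (fun γ s => dpUse (Ctx.fuel γ) (S γ) (k γ) (x γ) s) := fun hx =>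
    comp_dpUse (Γ := Γ × ℕ) hS.lift hk.lift hx.lift .var
  exact .and (.eq (comp_dpCol hk hz) (comp_dpCol hk hx)) <| .and (.le (comp_dpDeg hk hy) hD) <|
    .and (.imp hr.not <| .and (.eq (comp_dpDeg hk hz) (.add (comp_dpDeg hk hx)
      (.ite heq (.const 1) (.const 0)))) <| .and (.le (comp_dpDeg hk hz) hD)
      (.imp heq (.le (.add (comp_dpDeg hk hy) (.const 1)) hD))) <|
    CompP.forall_lt (P := fun γ s => S γ s → _ ∧ _) (.imp hS <|
      .and (.eq (huse hz) (.add (huse hx) (huse hy))) (.le (huse hz) hD.lift))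

theorem compP_dpInit {g v x : Γ → ℕ} (hE : CompR E) (hS : CompS S) (hn : Comp n) (hC : Comp C)
    (hD : Comp D) (hk : Comp k) (hg : Comp g) (hv : Comp v) (hx : Comp x) :
    CompP (fun γ => dpInit (Ctx.fuel γ) (E γ) (S γ) (n γ) (C γ) (D γ) (k γ) (g γ) (v γ) (x γ)) := by
  have huse : ∀ {x : Γ → ℕ}, Comp x →
      CompA (fun γ s => dpUse (Ctx.fuel γ) (S γ) (k γ) (x γ) s) := fun hx =>
    comp_dpUse (Γ := Γ × ℕ) hS.lift hk.lift hx.lift .var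
  have hadj : CompS (fun γ s => E γ (v γ) s) := hE.lift.app hv.lift .var
  have hcol : CompS (fun γ s => dpUse (Ctx.fuel γ) (S γ) (k γ) (g γ) s =
      dpCol (Ctx.fuel γ) (k γ) (x γ)) := .eq (huse hg) (comp_dpCol hk hx).lift
  refine .or (.and (.eq hv hn) (CompP.forall_lt (P := fun γ s => S γ s → _ ∧ _) (.imp hS <|
    .and (.eq (huse hx) (Comp.count (Γ := Γ × ℕ) (P := fun x u => S x.1 u ∧ E x.1 x.2 u ∧ _ = _)
      (.and hS.lift (.and hE (.eq (CompA.lift (huse hg)) (Comp.lift (huse hg)))))))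
      (.le (huse hx) hD.lift))))
    (.and (.not (.eq hv hn)) (.and (.lt (comp_dpCol hk hx) hC) (.and
      (.eq (comp_dpDeg hk hx) (Comp.count (.and hS (.and hadj hcol)))) (CompP.forall_lt
        (P := fun γ s => S γ s → _ = _) (.imp hS (.eq (huse hx)
          (.ite (.and hadj hcol) (.const 1) (.const 0))))))))

theorem compP_dpParent {key : Γ → ℕ → ℕ} {v u : Γ → ℕ} (hE : CompR E) (hkey : CompA key)
    (hn : Comp n) (hv : Comp v) (hu : Comp u) :
    CompP (fun γ => DpParent (Ctx.fuel γ) (E γ) (key γ) (n γ) (v γ) (u γ)) :=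
  .or (.and (.eq hu hn) (CompP.forall_lt (P := fun γ w => ¬ (E γ (v γ) w ∧ key γ (v γ) < key γ w))
    (.not (.and (hE.lift.app hv.lift .var) (.lt (hkey.app hv).lift hkey)))))
    (.and (.not (.eq hu hn)) (.and (hE.app hv hu) (.lt (hkey.app hv) (hkey.app hu))))

theorem compP_dpEntry {key T : Γ → ℕ → ℕ} {j u z : Γ → ℕ} (hS : CompS S) (hn : Comp n)
    (hD : Comp D) (hk : Comp k) (hkey : CompA key) (hj : Comp j) (hT : CompA T) (hu : Comp u)
    (hz : Comp z) : CompP (fun γ => DpEntry (Ctx.fuel γ) (S γ) (n γ) (D γ) (k γ) (key γ) (j γ)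
      (T γ) (u γ) (z γ)) := by
  have h1 : CompP (fun x : ((Γ × ℕ) × ℕ) × ℕ => x.2 < dpSize (Ctx.fuel x) (k x.1.1.1) ∧
      T x.1.1.1 (mulN (Ctx.fuel x) (dpSize (Ctx.fuel x) (k x.1.1.1)) (u x.1.1.1) + x.1.2) ≠ 0 ∧
      T x.1.1.1 (mulN (Ctx.fuel x) (dpSize (Ctx.fuel x) (k x.1.1.1)) x.1.1.2 + x.2) ≠ 0 ∧
      dpMerge (Ctx.fuel x) (S x.1.1.1) (D x.1.1.1) (k x.1.1.1) (u x.1.1.1 = n x.1.1.1) x.1.2 x.2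
        (z x.1.1.1)) := by
    have hs : Comp (fun x : ((Γ × ℕ) × ℕ) × ℕ => dpSize (Ctx.fuel x) (k x.1.1.1)) :=
      comp_dpSize hk.lift.lift.lift
    exact .and (.lt .var hs) <| .and (.ne_zero (hT.lift.lift.lift.app
      (.add (.mulN hs hu.lift.lift.lift) Comp.var.lift))) <| .and (.ne_zero
      (hT.lift.lift.lift.app (.add (.mulN hs Comp.var.lift.lift) .var))) <|
      compP_dpMerge hS.lift.lift.lift hD.lift.lift.lift hk.lift.lift.lift
        (CompP.eq hu hn).lift.lift.lift Comp.var.lift .var hz.lift.lift.lift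
  have h2 : CompP (fun x : (Γ × ℕ) × ℕ => x.2 < dpSize (Ctx.fuel x) (k x.1.1) ∧
      ∃ y < Ctx.fuel x, y < dpSize (Ctx.fuel x) (k x.1.1) ∧
      T x.1.1 (mulN (Ctx.fuel x) (dpSize (Ctx.fuel x) (k x.1.1)) (u x.1.1) + x.2) ≠ 0 ∧
      T x.1.1 (mulN (Ctx.fuel x) (dpSize (Ctx.fuel x) (k x.1.1)) x.1.2 + y) ≠ 0 ∧
      dpMerge (Ctx.fuel x) (S x.1.1) (D x.1.1) (k x.1.1) (u x.1.1 = n x.1.1) x.2 y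
        (z x.1.1)) :=
    .and (.lt .var (comp_dpSize hk.lift.lift)) (CompP.exists_lt h1)
  have h3 : CompP (fun x : Γ × ℕ => key x.1 x.2 = j x.1 + 2 ∧
      ∃ a < Ctx.fuel x, a < dpSize (Ctx.fuel x) (k x.1) ∧
      ∃ y < Ctx.fuel x, y < dpSize (Ctx.fuel x) (k x.1) ∧
      T x.1 (mulN (Ctx.fuel x) (dpSize (Ctx.fuel x) (k x.1)) (u x.1) + a) ≠ 0 ∧
      T x.1 (mulN (Ctx.fuel x) (dpSize (Ctx.fuel x) (k x.1)) x.2 + y) ≠ 0 ∧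
      dpMerge (Ctx.fuel x) (S x.1) (D x.1) (k x.1) (u x.1 = n x.1) a y (z x.1)) :=
    .and (.eq hkey (.add hj.lift (.const 2))) (CompP.exists_lt h2)
  exact CompP.exists_lt h3

theorem compA_dpStep {key T : Γ → ℕ → ℕ} {j : Γ → ℕ} (hE : CompR E) (hS : CompS S) (hn : Comp n)
    (hD : Comp D) (hk : Comp k) (hkey : CompA key) (hj : Comp j) (hT : CompA T) :
    CompA (fun γ => dpStep (Ctx.fuel γ) (E γ) (S γ) (n γ) (D γ) (k γ) (key γ) (j γ) (T γ)) := by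
  have hu : CompA (fun γ i => divN (Ctx.fuel γ) i (dpSize (Ctx.fuel γ) (k γ))) :=
    Comp.divN (Γ := Γ × ℕ) .var (comp_dpSize hk.lift)
  have hz : CompA (fun γ i => modN (Ctx.fuel γ) i (dpSize (Ctx.fuel γ) (k γ))) :=
    Comp.modN (Γ := Γ × ℕ) .var (comp_dpSize hk.lift)
  refine .ite (CompP.exists_lt (Γ := Γ × ℕ) (P := fun x v => key x.1 v = j x.1 + 2 ∧
    DpParent (Ctx.fuel x) (E x.1) (key x.1) (n x.1) v
      (divN (Ctx.fuel x) x.2 (dpSize (Ctx.fuel x) (k x.1)))) (.and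
    (.eq hkey.lift (.add hj.lift.lift (.const 2))) (compP_dpParent hE.lift.lift hkey.lift.lift
      hn.lift.lift .var (Comp.lift hu)))) (.ite (compP_dpEntry hS.lift hn.lift hD.lift hk.lift
      hkey.lift hj.lift hT.lift hu hz) (.const 1) (.const 0)) hT

theorem compP_dpAccepts {g : Γ → ℕ} (hE : CompR E) (hS : CompS S) (hn : Comp n) (hC : Comp C)
    (hD : Comp D) (hk : Comp k) (hg : Comp g) :
    CompP (fun γ => DpAccepts (Ctx.fuel γ) (E γ) (S γ) (n γ) (C γ) (D γ) (k γ) (g γ)) := by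
  have hU : CompS (fun γ v => v < n γ ∧ ¬ S γ v) := .and (.lt .var hn.lift) (.not hS)
  have hinit : CompA (fun γ i => if dpInit (Ctx.fuel γ) (E γ) (S γ) (n γ) (C γ) (D γ) (k γ) (g γ)
      (divN (Ctx.fuel γ) i (dpSize (Ctx.fuel γ) (k γ)))
      (modN (Ctx.fuel γ) i (dpSize (Ctx.fuel γ) (k γ))) then 1 else 0) :=
    .ite (compP_dpInit hE.lift hS.lift hn.lift hC.lift hD.lift hk.lift hg.lift
      (Comp.divN (Γ := Γ × ℕ) .var (comp_dpSize hk.lift))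
      (Comp.modN (Γ := Γ × ℕ) .var (comp_dpSize hk.lift))) (.const 1) (.const 0)
  have hstep : CompA (fun x : ((Γ × ℕ) × ℕ) × (ℕ → ℕ) => dpStep (Ctx.fuel x) (E x.1.1.1)
      (S x.1.1.1) (n x.1.1.1) (D x.1.1.1) (k x.1.1.1) (elimKeys (Ctx.fuel x) (E x.1.1.1)
        (fun v => v < n x.1.1.1 ∧ ¬ S x.1.1.1 v) (Ctx.fuel x)) x.1.2 x.2) :=
    compA_dpStep hE.lift.lift.liftArr hS.lift.lift.liftArr hn.lift.lift.liftArr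
      hD.lift.lift.liftArr hk.lift.lift.liftArr
      (CompA.liftArr (CompA.lift (CompA.lift (compA_elimKeys hE hU)))) (Comp.liftArr .var) .var
  have huse : ∀ {x : Γ → ℕ}, Comp x →
      CompA (fun γ s => dpUse (Ctx.fuel γ) (S γ) (k γ) (x γ) s) := fun hx =>
    comp_dpUse (Γ := Γ × ℕ) hS.lift hk.lift hx.lift .var
  have htab : CompA (fun γ => dpTables (Ctx.fuel γ) (E γ) (S γ) (n γ) (C γ) (D γ) (k γ) (g γ)
      (Ctx.fuel γ)) :=
    Comp.letIter (Γ := Γ × ℕ) (g := fun x => x.2 x.1.2) (CompA.lift hinit) hstep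
      (CompA.var.app (Comp.liftArr .var))
  refine .and (CompP.forall_lt (P := fun γ s => S γ s → _ < _)
    (.imp hS (.lt (huse hg) hC.lift))) (CompP.exists_lt (P := fun γ x => x < dpSize _ _ ∧
    dpTables _ _ _ _ _ _ _ _ _ (mulN _ _ _ + x) ≠ 0 ∧ ∀ s < Ctx.fuel γ, S γ s → _ ≤ _)
    (.and (.lt .var (comp_dpSize hk.lift)) (.and (.ne_zero (htab.lift.app (.add (Comp.lift
      (.mulN (comp_dpSize hk) hn)) .var))) (CompP.forall_lt (Γ := Γ × ℕ)
      (P := fun x s => S x.1 s → dpUse _ _ _ _ _ ≤ _) (.imp hS.lift (.le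
        (comp_dpUse hS.lift.lift hk.lift.lift Comp.var.lift .var) hD.lift.lift))))))

theorem compP_decideColorable (hE : CompR E) (hS : CompS S) (hn : Comp n) (hC : Comp C)
    (hD : Comp D) (hk : Comp k) :
    CompP (fun γ => DecideColorable (Ctx.fuel γ) (E γ) (S γ) (n γ) (C γ) (D γ) (k γ)) :=
  .or (.and (.eq hC (.const 1)) (CompP.forall_lt (P := fun _ _ => card _ ≤ _)
    (.le (Comp.count (Γ := Γ × ℕ) hE) hD.lift)))
    (.and (.not (.eq hC (.const 1))) (.or (.le (hk.add (.const 2)) hC) (.or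
      (.le hk (hD.add (.const 1))) (CompP.exists_lt (P := fun _ g => g < dpSize _ _ ∧
        DpAccepts _ _ _ _ _ _ _ _) (.and (.lt .var (comp_dpSize hk.lift))
          (compP_dpAccepts hE.lift hS.lift hn.lift hC.lift hD.lift hk.lift .var))))))

end RAM

/-! ### Transfer from finite graphs on `Fin n` to graphs on `ℕ`. -/

namespace SimpleGraph

open Classical

theorem findFVS_of_le (E : ℕ → ℕ → Prop) {N n k i : ℕ} (h : n ≤ i) :
    findFVS N E n k i = findFVS N E n k n := by
  induction i, h using Nat.le_induction with
  | base => rfl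
  | succ i hi ih =>
    rw [findFVS_succ, ← ih]
    funext v
    by_cases hv : v < N
    · rw [tab_of_lt _ hv, compressStep, if_neg (by omega)]
    · rw [tab, if_neg hv, findFVS, arrIter_of_le _ _ _ (by omega)]

/-- Take an end of a longest path. By maximality its neighbours lie on the path, and by acyclicity
only the second vertex of the path can be one. -/
theorem IsAcyclic.exists_degree_le_one {V : Type*} [Fintype V] [Nonempty V] {G : SimpleGraph V}
    (h : G.IsAcyclic) : ∃ v, G.degree v ≤ 1 := by
  obtain ⟨u, v, p, hp, hmax⟩ := Walk.exists_isPath_forall_isPath_length_le_length G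
  have hsnd : ∀ w, G.Adj u w → w = p.snd := fun w hw => by
    refine h.eq_snd_of_adj_start hp hw ?_
    by_contra hmem
    have := hmax _ _ _ (hp.cons hmem (h := hw.symm))
    rw [Walk.length_cons] at this
    omega
  refine ⟨u, card_le_one.2 fun a ha b hb => ?_⟩
  rw [hsnd a ((mem_neighborFinset _ _ _).1 ha), hsnd b ((mem_neighborFinset _ _ _).1 hb)]

section Fin

variable {n : ℕ} (G : SimpleGraph (Fin n))

/-- The graph on the natural numbers that has the given graph on its first `n` vertices. -/
def natGraph : SimpleGraph ℕ := G.map Fin.valEmbedding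

theorem natGraph_adj {u v : ℕ} : G.natGraph.Adj u v ↔ ∃ (i j : Fin n), G.Adj i j ∧ i.val = u ∧
    j.val = v := by
  rw [natGraph, map_adj]; rfl

theorem natGraph_adj_val {i j : Fin n} : G.natGraph.Adj i j ↔ G.Adj i j := by
  rw [natGraph]
  exact map_adj_apply (f := Fin.valEmbedding)

theorem lt_of_natGraph_adj {u v : ℕ} (h : G.natGraph.Adj u v) : v < n := by
  obtain ⟨i, j, -, -, rfl⟩ := G.natGraph_adj.1 h
  exact j.isLt

/-- Every nonempty vertex set outside `S` induces an acyclic graph, which has a vertex of degree at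
most one. -/
theorem degenerate_natGraph {S : Finset (Fin n)} (h : IsFeedbackVertexSet G S) :
    G.natGraph.Degenerate (range n \ S.map Fin.valEmbedding) := by
  intro B hB hne
  have hBn : ∀ v ∈ B, v < n := fun v hv => mem_range.1 (mem_sdiff.1 (hB hv)).1
  have hBS : ∀ v : Fin n, v.val ∈ B → v ∉ S := fun v hv hS =>
    (mem_sdiff.1 (hB hv)).2 (mem_map_of_mem Fin.valEmbedding hS)
  let f : B → {v : Fin n | v ∉ S} := fun v => ⟨⟨v, hBn v v.2⟩, hBS _ v.2⟩
  have hf : Function.Injective f := fun v w hvw => Subtype.ext (by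
    simpa [f] using hvw)
  have hac : (G.induce {v | v ∉ S}).IsAcyclic := h
  have hB' := hac.of_comap ⟨f, hf⟩
  have : Nonempty B := hne.to_subtype
  obtain ⟨v, hv⟩ := hB'.exists_degree_le_one
  refine ⟨v, v.2, le_trans (le_of_eq ?_) hv⟩
  rw [← card_neighborFinset_eq_degree, ← card_map (Function.Embedding.subtype _)]
  congr 1
  ext w
  simp only [mem_nbrsIn, mem_map, mem_neighborFinset, Function.Embedding.subtype_apply]
  constructor
  · rintro ⟨hw, hvw⟩
    exact ⟨⟨w, hw⟩, (G.natGraph_adj_val (i := ⟨v, hBn v v.2⟩) (j := ⟨w, hBn w hw⟩)).1 hvw, rfl⟩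
  · rintro ⟨w, hvw, rfl⟩
    exact ⟨w.2, (G.natGraph_adj_val (i := ⟨v, hBn v v.2⟩) (j := ⟨w, hBn w w.2⟩)).2 hvw⟩

theorem admitsDefectiveColoring_iff (C D : ℕ) :
    AdmitsDefectiveColoring G C D ↔ G.natGraph.DefectiveColorable n C D := by
  have key : ∀ (c : ℕ → ℕ) (v : Fin n), ((range n).filter fun w => G.natGraph.Adj v w ∧
      c w = c v).card = {w : Fin n | G.Adj v w ∧ c w = c v}.ncard := by
    intro c v
    rw [← Set.ncard_image_of_injective _ Fin.val_injective, ← Set.ncard_coe_finset]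
    congr 1
    ext w
    simp only [coe_filter, mem_range, Set.mem_ofPred_eq, Set.mem_image]
    constructor
    · rintro ⟨hw, hvw, h⟩
      exact ⟨⟨w, hw⟩, ⟨(G.natGraph_adj_val (i := v) (j := ⟨w, hw⟩)).1 hvw, h⟩, rfl⟩
    · rintro ⟨w, ⟨hvw, h⟩, rfl⟩
      exact ⟨w.isLt, G.natGraph_adj_val.2 hvw, h⟩
  constructor
  · rintro ⟨col, h⟩
    refine ⟨fun v => if hv : v < n then col ⟨v, hv⟩ else 0, fun v hv => ⟨?_, ?_⟩⟩
    · dsimp only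
      rw [dif_pos hv]; exact (col _).isLt
    · rw [key _ ⟨v, hv⟩]
      simpa [Fin.val_inj, hv] using h ⟨v, hv⟩
  · rintro ⟨c, h⟩
    refine ⟨fun v => ⟨c v, (h v v.isLt).1⟩, fun v => ?_⟩
    have := (h v v.isLt).2
    rw [key] at this
    simpa using this

theorem exists_card_eq_feedbackVertexNumber :
    ∃ S : Finset (Fin n), IsFeedbackVertexSet G S ∧ S.card = feedbackVertexNumber G := by
  refine Nat.sInf_mem (s := {k | ∃ S : Finset (Fin n), IsFeedbackVertexSet G S ∧ S.card = k})
    ⟨_, univ, ?_, rfl⟩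
  have : IsEmpty {v : Fin n | v ∉ univ} := ⟨fun v => v.2 (mem_univ _)⟩
  exact IsAcyclic.of_subsingleton

theorem feedbackVertexNumber_le : feedbackVertexNumber G ≤ n := by
  obtain ⟨S, -, hS⟩ := G.exists_card_eq_feedbackVertexNumber
  rw [← hS]
  simpa using card_le_univ S

end Fin

end SimpleGraph

/-! ### The fuel bound and correctness of one round without a given set. -/

namespace SimpleGraph

open Classical

/-- The feedback vertex set found by iterative compression. -/
def FoundSet (N : ℕ) (E : ℕ → ℕ → Prop) (n k v : ℕ) : Prop := v < n ∧ findFVS N E n k N v ≠ 0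

noncomputable def foundSize (N : ℕ) (E : ℕ → ℕ → Prop) (n k : ℕ) : ℕ :=
  ((range N).filter (FoundSet N E n k)).card

/-- The set found by iterative compression is a feedback vertex set of size at most `k`. -/
def FoundValid (N : ℕ) (E : ℕ → ℕ → Prop) (n k : ℕ) : Prop :=
  foundSize N E n k ≤ k ∧
    ∀ v < N, elimKeys N E (fun v => v < n ∧ ¬ FoundSet N E n k v) N v ≠ 0

/-- The answer to the question, or `2` if no feedback vertex set of size at most `k` is found. -/
noncomputable def searchAnswer (N : ℕ) (E : ℕ → ℕ → Prop) (n C D k : ℕ) : ℕ :=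
  if FoundValid N E n k then
    if DecideColorable N E (FoundSet N E n k) n C D (foundSize N E n k) then 1 else 0
  else 2

/-- The fuel that suffices for a graph with `n` vertices and a feedback vertex set of size `k`. -/
def fuelBound (n k : ℕ) : ℕ := (n + 3) ^ 3 * (k + 3) ^ (3 * k + 9)

theorem fuelBound_mono {n k k' : ℕ} (h : k ≤ k') : fuelBound n k ≤ fuelBound n k' :=
  Nat.mul_le_mul_left _ ((Nat.pow_le_pow_left (by omega) _).trans
    (Nat.pow_le_pow_right (by omega) (by omega)))

theorem le_fuelBound (n k : ℕ) : 3 * n + 9 ≤ fuelBound n k := by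
  calc 3 * n + 9 = (n + 3) ^ 1 * 3 := by ring
    _ ≤ (n + 3) ^ 3 * (k + 3) ^ (3 * k + 9) :=
      Nat.mul_le_mul (Nat.pow_le_pow_right (by omega) (by omega))
        ((show 3 ≤ k + 3 by omega).trans (Nat.le_self_pow (by omega) _))

theorem code_le_fuelBound {n k k' : ℕ} (h : k ≤ k') :
    (n + 1) * (k + 2) ^ (k + 2) ≤ fuelBound n k' := by
  refine le_trans ?_ (fuelBound_mono h)
  exact Nat.mul_le_mul ((show n + 1 ≤ n + 3 by omega).trans (Nat.le_self_pow (by omega) _))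
    ((Nat.pow_le_pow_left (by omega) _).trans (Nat.pow_le_pow_right (by omega) (by omega)))

theorem two_pow_le_fuelBound (n k : ℕ) : 2 ^ (3 * k + 2) ≤ fuelBound n k := by
  refine le_trans ?_ (Nat.le_mul_of_pos_left _ (Nat.pow_pos (by omega)))
  exact (Nat.pow_le_pow_left (by omega) _).trans (Nat.pow_le_pow_right (by omega) (by omega))

section Correctness

variable {n : ℕ} (G : SimpleGraph (Fin n)) {C D k : ℕ}

/-- Validity of the found set is tested explicitly, so the answer is right for any `k`; the found
set may be smaller than `k`, and the fuel then suffices all the more. -/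
theorem searchAnswer_of_foundValid (hC : 1 ≤ C) (hC2 : C ≠ 2)
    (h : FoundValid (fuelBound n k) G.natGraph.Adj n k) :
    searchAnswer (fuelBound n k) G.natGraph.Adj n C D k =
      if AdmitsDefectiveColoring G C D then 1 else 0 := by
  have hN := le_fuelBound n k
  set N := fuelBound n k with hNdef
  rw [searchAnswer, if_pos h]
  have hA : ∀ s, s ∈ (range N).filter (FoundSet N G.natGraph.Adj n k) ↔
      s < N ∧ FoundSet N G.natGraph.Adj n k s := fun s => by rw [mem_filter, mem_range]
  have hd := (elimKeys_ne_zero_iff' G.natGraph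
    (A := range n \ (range N).filter (FoundSet N G.natGraph.Adj n k)) fun v => by
      rw [mem_sdiff, hA, mem_range]
      constructor
      · rintro ⟨h1, h2⟩; exact ⟨by omega, h1, fun h => h2 ⟨by omega, h⟩⟩
      · rintro ⟨h1, h2, h3⟩; exact ⟨h2, fun h => h3 h.2⟩).1 h.2
  have := decideColorable_iff (C := C) (D := D) (fun u v => G.lt_of_natGraph_adj) hA
    (fun v hv => mem_range.2 (mem_filter.1 hv).2.1) rfl hd (code_le_fuelBound h.1) hC hC2
  rw [G.admitsDefectiveColoring_iff, ← this]
  rfl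

theorem searchAnswer_of_not_foundValid (h : ¬ FoundValid (fuelBound n k) G.natGraph.Adj n k) :
    searchAnswer (fuelBound n k) G.natGraph.Adj n C D k = 2 := if_neg h

theorem foundValid_feedbackVertexNumber : FoundValid (fuelBound n (feedbackVertexNumber G))
    G.natGraph.Adj n (feedbackVertexNumber G) := by
  set k := feedbackVertexNumber G with hk
  have hN := le_fuelBound n k
  have h2 := two_pow_le_fuelBound n k
  set N := fuelBound n k with hNdef
  obtain ⟨S, hS, hSk⟩ := G.exists_card_eq_feedbackVertexNumber
  obtain ⟨h3, h4, h5⟩ := findFVS_spec G.natGraph (by omega) h2 (by rw [card_map, hSk])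
    (G.degenerate_natGraph hS) le_rfl
  rw [← findFVS_of_le G.natGraph.Adj (show n ≤ N by omega)] at h3 h4 h5
  have hset : (range N).filter (FoundSet N G.natGraph.Adj n k) =
      (range n).filter fun v => findFVS N G.natGraph.Adj n k N v ≠ 0 := by
    ext v
    simp only [mem_filter, mem_range, FoundSet]
    constructor
    · exact fun h => h.2
    · exact fun h => ⟨by omega, h⟩
  refine ⟨by rw [foundSize, hset]; exact h4, ?_⟩
  rw [elimKeys_ne_zero_iff' (A := range n \ (range n).filter fun v =>
    findFVS N G.natGraph.Adj n k N v ≠ 0)]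
  · exact h5
  · intro v
    simp only [mem_sdiff, mem_filter, mem_range, FoundSet]
    constructor
    · rintro ⟨h6, h7⟩; exact ⟨by omega, h6, h7⟩
    · rintro ⟨-, h6, h7⟩; exact ⟨h6, h7⟩

end Correctness

end SimpleGraph

/-! ### Memory layout and building blocks of the main programs. -/

namespace RAM

open Classical SimpleGraph

/-- The values stored in memory by the main programs. -/
structure Input where
  n : ℕ
  C : ℕ
  D : ℕ
  N : ℕ
  k : ℕ
  adj : ℕ → ℕ
  set : ℕ → ℕ

instance Input.ctx : Ctx Input where
  Lay := Unit
  fuel x := x.N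
  rel _ x s := s.reg 0 = x.n ∧ s.reg 1 = x.C ∧ s.reg 2 = x.D ∧ s.reg 3 = x.N ∧ s.reg 4 = x.k ∧
    s.arr 0 = x.adj ∧ s.arr 1 = x.set
  below _ lr la := 5 ≤ lr ∧ 2 ≤ la
  rel_fuel h := h.2.2.2.1
  below_three h := by omega
  below_mono h h1 h2 := by omega
  frame h h1 h2 := by
    obtain ⟨h3, h4⟩ := h2
    rw [h3 0 (by omega), h3 1 (by omega), h3 2 (by omega), h3 3 (by omega), h3 4 (by omega),
      h4 0 (by omega), h4 1 (by omega)]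
    exact h1

theorem Input.comp_n : Comp Input.n := .of_expr fun _ => ⟨.reg 0, fun _ _ h => h.1⟩

theorem Input.comp_C : Comp Input.C := .of_expr fun _ => ⟨.reg 1, fun _ _ h => h.2.1⟩

theorem Input.comp_D : Comp Input.D := .of_expr fun _ => ⟨.reg 2, fun _ _ h => h.2.2.1⟩

theorem Input.comp_k : Comp Input.k := .of_expr fun _ => ⟨.reg 4, fun _ _ h => h.2.2.2.2.1⟩

theorem Input.compA_adj : CompA Input.adj := Comp.of_expr fun ℓ =>
  ⟨.read 0 (.reg ℓ.2), fun _ _ h => by simp only [Expr.eval, h.1.2.2.2.2.2.1, h.2]⟩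

theorem Input.compA_set : CompA Input.set := Comp.of_expr fun ℓ =>
  ⟨.read 1 (.reg ℓ.2), fun _ _ h => by simp only [Expr.eval, h.1.2.2.2.2.2.2, h.2]⟩

/-- The range checks matter: with `v ≥ n` the address would run into another row of the matrix. -/
def Input.Edge (x : Input) (u v : ℕ) : Prop :=
  u < x.n ∧ v < x.n ∧ x.adj (mulN x.N u x.n + v) ≠ 0

theorem Input.compR_edge : CompR Input.Edge :=
  .and (.lt Comp.var.lift Input.comp_n.lift.lift) <| .and (.lt .var Input.comp_n.lift.lift) <|
    .ne_zero (Input.compA_adj.lift.lift.app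
      (.add (Comp.mulN (Γ := (Input × ℕ) × ℕ) Comp.var.lift Input.comp_n.lift.lift) .var))

def Input.Marked (x : Input) (v : ℕ) : Prop := v < x.n ∧ x.set v ≠ 0

theorem Input.compS_marked : CompS Input.Marked :=
  .and (.lt .var Input.comp_n.lift) (.ne_zero Input.compA_set)

noncomputable def Input.markedCard (x : Input) : ℕ := ((range x.N).filter x.Marked).card

theorem Input.comp_markedCard : Comp Input.markedCard := Comp.count Input.compS_marked

def Input.nextFuel (x : Input) : ℕ :=
  mulN x.N (mulN x.N (mulN x.N (powN x.N (x.k + 3) (x.k + x.k + x.k + 9)) (x.n + 3)) (x.n + 3))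
    (x.n + 3)

theorem Input.comp_nextFuel : Comp Input.nextFuel :=
  have h : Comp fun x : Input => x.n + 3 := Input.comp_n.add (.const 3)
  .mulN (.mulN (.mulN (.powN (Input.comp_k.add (.const 3))
    (((Input.comp_k.add Input.comp_k).add Input.comp_k).add (.const 9))) h) h) h

/-- Base, exponent and second factors must not exceed the current fuel; the largest of them is `3 *
k + 9`, or `n + 3`. This is where the initial fuel `3 * n + 9` comes from. -/
theorem Input.nextFuel_eq {x : Input} (hN : 3 * x.n + 9 ≤ x.N) (hk : x.k ≤ x.n) :
    x.nextFuel = fuelBound x.n x.k := by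
  rw [Input.nextFuel, mulN_eq _ (by omega), mulN_eq _ (by omega), mulN_eq _ (by omega),
    powN_eq (by omega) (by omega), fuelBound,
    show x.k + x.k + x.k + 9 = 3 * x.k + 9 by ring]
  ring

noncomputable def Input.decide (x : Input) : ℕ :=
  if DecideColorable x.N x.Edge x.Marked x.n x.C x.D x.k then 1 else 0

theorem Input.comp_decide : Comp Input.decide :=
  compP_decideColorable Input.compR_edge Input.compS_marked Input.comp_n Input.comp_C Input.comp_D
    Input.comp_k

noncomputable def Input.answer (x : Input) : ℕ := searchAnswer x.N x.Edge x.n x.C x.D x.k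

theorem Input.comp_answer : Comp Input.answer := by
  have hset : CompS (fun x : Input => FoundSet x.N x.Edge x.n x.k) :=
    .and (.lt .var Input.comp_n.lift)
      (.ne_zero (compA_findFVS Input.compR_edge Input.comp_n Input.comp_k))
  have hsize : Comp (fun x : Input => foundSize x.N x.Edge x.n x.k) := Comp.count hset
  have hvalid : CompP (fun x : Input => FoundValid x.N x.Edge x.n x.k) :=
    .and (.le hsize Input.comp_k) (CompP.forall_lt
      (P := fun (x : Input) v => elimKeys x.N x.Edge (fun v => v < x.n ∧ ¬ FoundSet x.N x.Edge x.n x.k v)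
        x.N v ≠ 0) (.ne_zero (compA_elimKeys Input.compR_edge
          (U := fun (x : Input) v => v < x.n ∧ ¬ FoundSet x.N x.Edge x.n x.k v)
          (.and (.lt .var Input.comp_n.lift) (.not hset)))))
  exact .ite hvalid (.ite (compP_decideColorable Input.compR_edge hset Input.comp_n Input.comp_C
    Input.comp_D hsize) (.const 1) (.const 0)) (.const 2)

/-- The memory `s` represents `x`, and the scratch memory is clean. -/
def Input.Holds (x : Input) (s : State) : Prop := Ctx.rel (Γ := Input) () x s ∧ Tail 2 x.N s

/-- Storing a computed value in one of the registers below `6`. -/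
theorem Comp.exists_store {f : Input → ℕ} (hf : Comp f) (r : ℕ) : ∃ p d, ∀ (x : Input) s,
    x.Holds s →
    ∃ t s', Exec p s t s' ∧ t ≤ (x.N + 2) ^ d ∧
      (∀ r' < 6, s'.reg r' = if r' = r then f x else s.reg r') ∧ (∀ a < 2, s'.arr a = s.arr a) ∧
      Tail 2 x.N s' := by
  -- Working from level 6 keeps register 5 free for the result of the main programs.
  obtain ⟨p, d, hp⟩ := hf () 6 2 ⟨by omega, le_rfl⟩
  refine ⟨.seq p (.assign r (.reg 6)), d + 2 + 1, fun x s hs => ?_⟩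
  obtain ⟨t, s', h1, h2, h3, h4, h5⟩ := hp x s hs.1 hs.2
  refine ⟨_, _, .seq h1 (.assign _ _ _), fuel_add_le h2 (le_fuel_pow _ _), fun r' hr' => ?_,
    fun a ha => h4.2 a ha, h5⟩
  simp only [State.setReg_reg, Function.update_apply, Expr.eval, h3]
  split_ifs
  · rfl
  · exact h4.1 r' hr'

/-- Fuel may only grow: memory that is clean beyond the old bound is also clean beyond a larger one.
-/
theorem Comp.exists_storeFuel {f : Input → ℕ} (hf : Comp f) : ∃ p d, ∀ (x : Input) s, x.Holds s →
    x.N ≤ f x → ∃ t s', Exec p s t s' ∧ t ≤ (x.N + 2) ^ d ∧ ({x with N := f x} : Input).Holds s' ∧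
      s'.reg 5 = s.reg 5 := by
  obtain ⟨p, d, h⟩ := hf.exists_store 3
  refine ⟨p, d, fun x s hs hN => ?_⟩
  obtain ⟨t, s', h1, h2, h3, h4, h5⟩ := h x s hs
  refine ⟨t, s', h1, h2, ⟨?_, h5.mono le_rfl hN⟩, by rw [h3 5 (by omega)]; rfl⟩
  obtain ⟨r0, r1, r2, r3, r4, a0, a1⟩ := hs.1
  refine ⟨?_, ?_, ?_, ?_, ?_, ?_, ?_⟩
  all_goals simp_all

theorem Comp.exists_storeParam {f : Input → ℕ} (hf : Comp f) : ∃ p d, ∀ (x : Input) s, x.Holds s →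
    ∃ t s', Exec p s t s' ∧ t ≤ (x.N + 2) ^ d ∧ ({x with k := f x} : Input).Holds s' ∧
      s'.reg 5 = s.reg 5 := by
  obtain ⟨p, d, h⟩ := hf.exists_store 4
  refine ⟨p, d, fun x s hs => ?_⟩
  obtain ⟨t, s', h1, h2, h3, h4, h5⟩ := h x s hs
  refine ⟨t, s', h1, h2, ⟨?_, h5⟩, by rw [h3 5 (by omega)]; rfl⟩
  obtain ⟨r0, r1, r2, r3, r4, a0, a1⟩ := hs.1
  refine ⟨?_, ?_, ?_, ?_, ?_, ?_, ?_⟩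
  all_goals simp_all

theorem Comp.exists_storeResult {f : Input → ℕ} (hf : Comp f) : ∃ p d, ∀ (x : Input) s, x.Holds s →
    ∃ t s', Exec p s t s' ∧ t ≤ (x.N + 2) ^ d ∧ x.Holds s' ∧ s'.reg 5 = f x := by
  obtain ⟨p, d, h⟩ := hf.exists_store 5
  refine ⟨p, d, fun x s hs => ?_⟩
  obtain ⟨t, s', h1, h2, h3, h4, h5⟩ := h x s hs
  refine ⟨t, s', h1, h2, ⟨?_, h5⟩, by rw [h3 5 (by omega)]; rfl⟩
  obtain ⟨r0, r1, r2, r3, r4, a0, a1⟩ := hs.1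
  refine ⟨?_, ?_, ?_, ?_, ?_, ?_, ?_⟩
  all_goals simp_all

end RAM

/-! ### Encoding of instances, time bounds and the main programs. -/

namespace RAM

open Classical SimpleGraph

section Encoding

variable {n : ℕ} (G : SimpleGraph (Fin n)) (C D : ℕ) (S : Finset (Fin n)) (N k : ℕ)

/-- An instance together with the fuel and the parameter. -/
noncomputable def Input.of : Input :=
  ⟨n, C, D, N, k, (inputState G C D S).arr 0, (inputState G C D S).arr 1⟩

variable {N}

theorem Input.edge_of (h : n ≤ N) : (Input.of G C D S N k).Edge = G.natGraph.Adj := by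
  funext u v
  rw [eq_iff_iff, natGraph_adj]
  change (u < n ∧ v < n ∧ (if ∃ i j : Fin n, G.Adj i j ∧ mulN N u n + v = i.val * n + j.val
    then 1 else 0) ≠ 0) ↔ _
  rw [mulN_eq _ h, ite_ne_right_iff, and_iff_left one_ne_zero]
  constructor
  · rintro ⟨hu, hv, i, j, hij, he⟩
    have hi : u = i := by
      have := congrArg (· / n) he
      have hn : 0 < n := by omega
      simpa [Nat.mul_add_div, mul_comm _ n, Nat.mul_add_div hn, Nat.div_eq_of_lt hv,
        Nat.div_eq_of_lt j.isLt] using this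
    subst hi
    exact ⟨i, j, hij, rfl, by omega⟩
  · rintro ⟨i, j, hij, rfl, rfl⟩
    exact ⟨i.isLt, j.isLt, i, j, hij, rfl⟩

theorem Input.marked_of : (Input.of G C D S N k).Marked = (· ∈ S.map Fin.valEmbedding) := by
  funext v
  rw [eq_iff_iff, mem_map]
  change (v < n ∧ (if ∃ w ∈ S, v = w.val then 1 else 0) ≠ 0) ↔ _
  rw [ite_ne_right_iff, and_iff_left one_ne_zero]
  constructor
  · rintro ⟨-, w, hw, rfl⟩
    exact ⟨w, hw, rfl⟩
  · rintro ⟨w, hw, rfl⟩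
    exact ⟨w.isLt, w, hw, rfl⟩

theorem Input.filter_marked_of (h : n ≤ N) :
    (range N).filter (Input.of G C D S N k).Marked = S.map Fin.valEmbedding := by
  ext v
  rw [mem_filter, Input.marked_of, mem_range]
  refine and_iff_right_of_imp fun hv => ?_
  obtain ⟨w, -, rfl⟩ := mem_map.1 hv
  exact w.isLt.trans_le h

theorem Input.holds_init : (Input.of G C D S (3 * n + 9) 0).Holds
    ((inputState G C D S).setReg 3 (3 * n + 9)) := by
  refine ⟨⟨?_, ?_, ?_, ?_, ?_, rfl, rfl⟩, fun a ha i _ => ?_⟩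
  iterate 5 simp [inputState, Input.of]
  have h0 : a ≠ 0 := by omega
  have h1 : a ≠ 1 := by omega
  simp [inputState, h0, h1]

theorem Input.decide_of {G : SimpleGraph (Fin n)} {C D : ℕ} {S : Finset (Fin n)} (hC : 1 ≤ C)
    (hC2 : C ≠ 2) (hS : IsFeedbackVertexSet G S) :
    (Input.of G C D S (fuelBound n S.card) S.card).decide =
      if AdmitsDefectiveColoring G C D then 1 else 0 := by
  have hN := le_fuelBound n S.card
  have := decideColorable_iff (N := fuelBound n S.card) (C := C) (D := D)
    (S := (· ∈ S.map Fin.valEmbedding)) (A := S.map Fin.valEmbedding) (k := S.card)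
    (fun u v => G.lt_of_natGraph_adj) (fun v => ⟨fun hv => ⟨?_, hv⟩, And.right⟩) (fun v hv => ?_)
    (card_map _) (G.degenerate_natGraph hS) (code_le_fuelBound le_rfl) hC hC2
  · rw [Input.decide, Input.marked_of, Input.edge_of _ _ _ _ _ (by omega),
      G.admitsDefectiveColoring_iff, ← this]
    rfl
  all_goals obtain ⟨w, -, rfl⟩ := mem_map.1 hv
  · have := w.isLt
    simp only [Fin.valEmbedding_apply]
    omega
  · exact mem_range.2 w.isLt

end Encoding

section Time

theorem fuelBound_pow_le (n k d : ℕ) : (fuelBound n k + 2) ^ d ≤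
    3 ^ (6 * d) * (k + 3) ^ ((3 * k + 9) * (2 * d)) * (n + 1) ^ (6 * d) := by
  have h := le_fuelBound n k
  calc (fuelBound n k + 2) ^ d ≤ (fuelBound n k ^ 2) ^ d :=
        Nat.pow_le_pow_left (by nlinarith) _
    _ = ((n + 3) ^ (6 * d)) * (k + 3) ^ ((3 * k + 9) * (2 * d)) := by
        rw [fuelBound, mul_pow, mul_pow, ← pow_mul, ← pow_mul, ← pow_mul, ← pow_mul]
        congr 2
        ring
    _ ≤ (3 * (n + 1)) ^ (6 * d) * (k + 3) ^ ((3 * k + 9) * (2 * d)) :=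
        Nat.mul_le_mul_right _ (Nat.pow_le_pow_left (by omega) _)
    _ = _ := by rw [mul_pow]; ring

theorem exists_fuelBound_pow_le (d : ℕ) : ∃ c, ∀ n k, (fuelBound n k + 2) ^ d ≤
    c * k ^ (c * k) * (n + 1) ^ c := by
  -- The first summand settles `k ≤ 1`, where the power of `k` is 1. For `k ≥ 2` one has `k + 3 ≤ k
  -- ^ 3` and `3 * k + 9 ≤ 9 * k`, giving the exponent 3 · 9 · 2 = 54 times `d * k`.
  refine ⟨3 ^ (6 * d) * 4 ^ (24 * d) + 54 * d, fun n k => (fuelBound_pow_le n k d).trans ?_⟩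
  set c := 3 ^ (6 * d) * 4 ^ (24 * d) + 54 * d with hc
  refine Nat.mul_le_mul ?_ (Nat.pow_le_pow_right (by omega) (by omega))
  by_cases hk : k ≤ 1
  · have hk1 : k ^ (c * k) = 1 := by
      interval_cases k <;> simp
    rw [hk1, mul_one]
    refine le_trans (Nat.mul_le_mul_left _ ?_) (Nat.le_add_right _ _)
    refine (Nat.pow_le_pow_left (show k + 3 ≤ 4 by omega) _).trans
      (Nat.pow_le_pow_right (by omega) ?_)
    calc (3 * k + 9) * (2 * d) ≤ 12 * (2 * d) := Nat.mul_le_mul_right _ (by omega)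
      _ = 24 * d := by ring
  · push Not at hk
    have h1 : 3 ^ (6 * d) ≤ c := by
      have : 1 ≤ 4 ^ (24 * d) := Nat.one_le_pow _ _ (by omega)
      nlinarith [Nat.zero_le (3 ^ (6 * d))]
    refine Nat.mul_le_mul h1 ?_
    have h2 : k + 3 ≤ k ^ 3 := by
      have : 2 * 2 ≤ k * k := Nat.mul_le_mul hk hk
      calc k + 3 ≤ (2 * 2) * k := by omega
        _ ≤ k * k * k := Nat.mul_le_mul_right _ this
        _ = k ^ 3 := by ring
    calc (k + 3) ^ ((3 * k + 9) * (2 * d)) ≤ (k ^ 3) ^ (9 * k * (2 * d)) :=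
          (Nat.pow_le_pow_left h2 _).trans (Nat.pow_le_pow_right (by positivity)
            (Nat.mul_le_mul_right _ (by omega)))
      _ = k ^ (54 * d * k) := by rw [← pow_mul]; congr 1; ring
      _ ≤ k ^ (c * k) := Nat.pow_le_pow_right (by omega) (Nat.mul_le_mul_right _ (by omega))

theorem primrec_pow : Primrec₂ fun a b : ℕ => a ^ b :=
  (Primrec.nat_rec' (f := fun p : ℕ × ℕ => p.2) (g := fun _ => 1)
    (h := fun p q => q.2 * p.1) Primrec.snd (Primrec.const 1)
    (Primrec.nat_mul.comp (Primrec.snd.comp Primrec.snd) (Primrec.fst.comp Primrec.fst)).to₂).of_eq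
    fun p => by
      induction p.2 with
      | zero => rfl
      | succ b ih =>
        change _ = p.1 ^ (b + 1)
        rw [pow_succ]
        exact congrArg (· * p.1) ih

theorem computable_timeBound (d : ℕ) :
    Computable fun k => 3 ^ (6 * d) * (k + 3) ^ ((3 * k + 9) * (2 * d)) := by
  refine Primrec.to_comp ?_
  have h3 : Primrec fun k : ℕ => k + 3 := Primrec.nat_add.comp .id (.const 3)
  have h9 : Primrec fun k : ℕ => 3 * k + 9 :=
    Primrec.nat_add.comp (Primrec.nat_mul.comp (.const 3) .id) (.const 9)
  exact Primrec.nat_mul.comp (.const _)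
    (primrec_pow.comp h3 (Primrec.nat_mul.comp h9 (.const (2 * d))))

end Time

/-- The first fuel value, depending on the number of vertices in register `0`. -/
def initFuel : Expr := .add (.add (.add (.reg 0) (.reg 0)) (.reg 0)) (.const 9)

theorem eval_initFuel {n : ℕ} (G : SimpleGraph (Fin n)) (C D : ℕ) (S : Finset (Fin n)) :
    initFuel.eval (inputState G C D S) = 3 * n + 9 := by
  simp only [initFuel, Expr.eval, inputState]
  simp
  ring

/-- A small fuel, linear in `n`, suffices to count the given set and to compute the real fuel, under
which the dynamic program runs. -/
theorem exists_decides_of_feedbackVertexSet : ∃ (p : Prog) (d : ℕ),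
    ∀ (n : ℕ) (G : SimpleGraph (Fin n)) (C D : ℕ) (S : Finset (Fin n)), 1 ≤ C → C ≠ 2 →
      IsFeedbackVertexSet G S → p.DecidesWithin (inputState G C D S)
        ((fuelBound n S.card + 2) ^ d) (AdmitsDefectiveColoring G C D) := by
  obtain ⟨p1, d1, h1⟩ := Input.comp_markedCard.exists_storeParam
  obtain ⟨p2, d2, h2⟩ := Input.comp_nextFuel.exists_storeFuel
  obtain ⟨p3, d3, h3⟩ := Input.comp_decide.exists_storeResult
  refine ⟨.seq (.assign 3 initFuel) (.seq p1 (.seq p2 (.seq p3 (.assign 0 (.reg 5))))),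
    8 + (d1 + (d2 + (d3 + 2 + 1) + 1) + 1) + 1, fun n G C D S hC hC2 hS => ?_⟩
  have hk : S.card ≤ n := by simpa using card_le_univ S
  have hF := le_fuelBound n S.card
  have e0 := Exec.assign (inputState G C D S) 3 initFuel
  rw [eval_initFuel] at e0
  obtain ⟨t1, s1, e1, ht1, hs1, -⟩ := h1 _ _ (Input.holds_init G C D S)
  have hm : (Input.of G C D S (3 * n + 9) 0).markedCard = S.card := by
    have := congrArg card (Input.filter_marked_of G C D S 0 (N := 3 * n + 9) (by omega))
    rw [card_map] at this
    rw [← this]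
    rfl
  rw [hm] at hs1
  have hf : ({Input.of G C D S (3 * n + 9) 0 with k := S.card} : Input).nextFuel =
      fuelBound n S.card := Input.nextFuel_eq le_rfl hk
  obtain ⟨t2, s2, e2, ht2, hs2, -⟩ := h2 _ _ hs1 (by rw [hf]; exact hF)
  rw [hf] at hs2
  obtain ⟨t3, s3, e3, ht3, -, hr⟩ := h3 _ _ hs2
  have hd := Input.decide_of (C := C) (D := D) hC hC2 hS
  have hlow : ∀ d, (3 * n + 9 + 2) ^ d ≤ (fuelBound n S.card + 2) ^ d := fun d =>
    Nat.pow_le_pow_left (by omega) d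
  refine ⟨_, _, .seq e0 (.seq e1 (.seq e2 (.seq e3 (.assign _ _ _)))),
    fuel_add_le (le_fuel_pow _ 8) (fuel_add_le (ht1.trans (hlow _))
      (fuel_add_le (ht2.trans (hlow _)) (fuel_add_le ht3 (le_fuel_pow _ 2)))), ?_⟩
  have hr' : s3.reg 5 = if AdmitsDefectiveColoring G C D then 1 else 0 := hr.trans hd
  simp only [State.setReg_reg, Function.update_self, Expr.eval, hr']
  exact ⟨fun h => if_pos h, fun h => if_neg h⟩

theorem exists_body : ∃ (p : Prog) (d : ℕ), ∀ (n : ℕ) (G : SimpleGraph (Fin n)) (C D N k : ℕ)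
    (s : State), (Input.of G C D ∅ N k).Holds s → k ≤ n → 3 * n + 9 ≤ N → N ≤ fuelBound n k →
    ∃ t s', Exec p s t s' ∧ t ≤ (fuelBound n k + 2) ^ d ∧
      (Input.of G C D ∅ (fuelBound n k) (k + 1)).Holds s' ∧
      s'.reg 5 = searchAnswer (fuelBound n k) G.natGraph.Adj n C D k := by
  obtain ⟨p1, d1, h1⟩ := Input.comp_nextFuel.exists_storeFuel
  obtain ⟨p2, d2, h2⟩ := Input.comp_answer.exists_storeResult
  obtain ⟨p3, d3, h3⟩ := (Input.comp_k.add (.const 1)).exists_storeParam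
  refine ⟨.seq p1 (.seq p2 p3), d1 + (d2 + d3 + 1) + 1, fun n G C D N k s hs hk hN hN' => ?_⟩
  have hf : (Input.of G C D ∅ N k).nextFuel = fuelBound n k := Input.nextFuel_eq hN hk
  obtain ⟨t1, s1, e1, ht1, hs1, -⟩ := h1 _ _ hs (by rw [hf]; exact hN')
  rw [hf] at hs1
  obtain ⟨t2, s2, e2, ht2, hs2, hr⟩ := h2 _ _ hs1
  obtain ⟨t3, s3, e3, ht3, hs3, hr'⟩ := h3 _ _ hs2
  refine ⟨_, s3, .seq e1 (.seq e2 e3), fuel_add_le (ht1.trans (Nat.pow_le_pow_left ?_ _))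
    (fuel_add_le ht2 ht3), hs3, ?_⟩
  · exact Nat.add_le_add_right hN' 2
  · rw [hr', hr]
    change searchAnswer _ (Input.of G C D ∅ (fuelBound n k) k).Edge _ _ _ _ = _
    rw [Input.edge_of _ _ _ _ _ (by have := le_fuelBound n k; omega)]
    rfl

/-- Rounds for `k = 0, 1, ...` continue as long as register 5 contains 2, that is, no valid set was
found. The round for the feedback vertex number succeeds, so neither parameter nor fuel in use ever
exceeds the one for that number during a round. -/
theorem exists_decides : ∃ (p : Prog) (d : ℕ), ∀ (n : ℕ) (G : SimpleGraph (Fin n)) (C D : ℕ),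
    1 ≤ C → C ≠ 2 → p.DecidesWithin (inputState G C D ∅)
      ((fuelBound n (feedbackVertexNumber G) + 2) ^ d) (AdmitsDefectiveColoring G C D) := by
  obtain ⟨body, d, hb⟩ := exists_body
  refine ⟨.seq (.assign 3 initFuel) (.seq (.assign 5 (.const 2)) (.seq
    (.while (.sub (.reg 5) (.const 1)) body) (.assign 0 (.reg 5)))),
    8 + (2 + ((1 + (d + 8 + 1)) + 2 + 1) + 1) + 1, fun n G C D hC hC2 => ?_⟩
  set K := feedbackVertexNumber G with hK
  have hKn : K ≤ n := G.feedbackVertexNumber_le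
  -- Here `m` is the number of rounds left at most. The summand 8 pays for the test before a round
  -- and the final failing test, 4 steps each.
  have loop : ∀ m k N s, k + m = K → (Input.of G C D ∅ N k).Holds s → 3 * n + 9 ≤ N →
      N ≤ fuelBound n k → s.reg 5 = 2 → ∃ t s',
      Exec (.while (.sub (.reg 5) (.const 1)) body) s t s' ∧
      t ≤ (m + 1) * ((fuelBound n K + 2) ^ d + 8) ∧
      s'.reg 5 = if AdmitsDefectiveColoring G C D then 1 else 0 := by
    intro m
    induction m with
    | zero =>
      intro k N s hk hs hN hN' h5
      obtain rfl : k = K := by omega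
      obtain ⟨t, s', e, ht, hs', h5'⟩ := hb n G C D N K s hs hKn hN hN'
      rw [searchAnswer_of_foundValid G hC hC2 (foundValid_feedbackVertexNumber G)] at h5'
      refine ⟨_, s', .while_true (by simp [Expr.eval, h5]) e (.while_false ?_), ?_, h5'⟩
      · simp only [Expr.eval, h5']
        split_ifs <;> rfl
      · simp only [Expr.cost]
        omega
    | succ m ih =>
      intro k N s hk hs hN hN' h5
      obtain ⟨t, s', e, ht, hs', h5'⟩ := hb n G C D N k s hs (by omega) hN hN'
      have ht' : t ≤ (fuelBound n K + 2) ^ d := ht.trans (Nat.pow_le_pow_left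
        (Nat.add_le_add_right (fuelBound_mono (by omega)) 2) _)
      by_cases hv : FoundValid (fuelBound n k) G.natGraph.Adj n k
      · rw [searchAnswer_of_foundValid G hC hC2 hv] at h5'
        refine ⟨_, s', .while_true (by simp [Expr.eval, h5]) e (.while_false ?_), ?_, h5'⟩
        · simp only [Expr.eval, h5']
          split_ifs <;> rfl
        · simp only [Expr.cost]
          nlinarith
      · rw [searchAnswer_of_not_foundValid G hv] at h5'
        obtain ⟨t', s'', e', ht'', h5''⟩ := ih (k + 1) _ s' (by omega) hs' (le_fuelBound n k)
          (fuelBound_mono (by omega)) h5'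
        refine ⟨_, s'', .while_true (by simp [Expr.eval, h5]) e e', ?_, h5''⟩
        simp only [Expr.cost]
        linarith
  have hF := le_fuelBound n K
  have e0 := Exec.assign (inputState G C D ∅) 3 initFuel
  rw [eval_initFuel] at e0
  have hs := Input.holds_init G C D ∅
  -- Register 5 is outside the layout of the input, so setting it does not affect the
  -- representation.
  have hs1 : (Input.of G C D ∅ (3 * n + 9) 0).Holds
      (((inputState G C D ∅).setReg 3 (3 * n + 9)).setReg 5 2) := hs
  obtain ⟨t, s', e, ht, h5⟩ := loop K 0 _ _ (by omega) hs1 le_rfl (le_fuelBound n 0) (by simp)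
  refine ⟨_, _, .seq e0 (.seq (.assign _ _ _) (.seq e (.assign _ _ _))),
    fuel_add_le (le_fuel_pow _ 8) (fuel_add_le (le_fuel_pow _ 2)
      (fuel_add_le (ht.trans (fuel_mul_le ?_ (fuel_add_le le_rfl (le_fuel_pow _ 8))))
        (le_fuel_pow _ 2))), ?_⟩
  · rw [pow_one]; omega
  · simp only [State.setReg_reg, Function.update_self, Expr.eval, h5]
    exact ⟨fun h => if_pos h, fun h => if_neg h⟩

end RAM

end

theorem theorem4 :
    defectiveColoringByFVS.IsFPT ∧
    ∃ (p : RAM.Prog) (c : ℕ),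
      ∀ (n : ℕ) (G : SimpleGraph (Fin n)) (C D : ℕ) (S : Finset (Fin n)),
        1 ≤ C → C ≠ 2 → IsFeedbackVertexSet G S →
          p.DecidesWithin (inputState G C D S)
            (c * S.card ^ (c * S.card) * (n + 1) ^ c)
            (AdmitsDefectiveColoring G C D) := by
  constructor
  · obtain ⟨p, d, h⟩ := RAM.exists_decides
    refine ⟨p, _, 6 * d, RAM.computable_timeBound d, fun x => ?_⟩
    obtain ⟨t, s, e, ht, h1⟩ := h x.n x.G x.C x.D x.one_le_C x.C_ne_two
    exact ⟨t, s, e, ht.trans (RAM.fuelBound_pow_le _ _ d), h1⟩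
  · obtain ⟨p, d, h⟩ := RAM.exists_decides_of_feedbackVertexSet
    obtain ⟨c, hc⟩ := RAM.exists_fuelBound_pow_le d
    refine ⟨p, c, fun n G C D S hC hC2 hS => ?_⟩
    obtain ⟨t, s, e, ht, h1⟩ := h n G C D S hC hC2 hS
    exact ⟨t, s, e, ht.trans (hc n _), h1⟩
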